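/- A *monoid* is a commutative monoid with an absorbing element $0$. A *blueprint* is a monoid $B$ together with a pre-addition, i.e. a congruence $\equiv$ on the semiring $\mathbb N[B]$ of finite formal sums such that $0\equiv(\text{empty sum})$ and such that $a\equiv b$ implies $a=b$ for $a,b\in B$. A *prime ideal* of $B$ is a subset $\mathfrak p$ with $B\mathfrak p\subseteq\mathfrak p$, whose complement is a multiplicative subset, and such that $\sum a_i+c\equiv\sum b_j$ with $a_i,b_j\in\mathfrak p$ implies $c\in\mathfrak p$. The *spectrum* $\operatorname{Spec}B$ is the set of prime ideals with the topology generated by the sets $\{\mathfrak p\mid h\notin\mathfrak p\}$ and with the structure sheaf of locally represented fractions, and a *blue scheme* is a space with a sheaf of blueprints that is locally isomorphic to spectra of blueprints. Morphisms of blue schemes are those morphisms whose maps on stalks are local. An open subset $U$ of a blue scheme $X$ is *affine* if the canonical morphism $U\to\operatorname{Spec}\mathcal O_X(U)$ is an isomorphism. For a blueprint $B$ and a monoid $M$, the *monoid blueprint* $B[M]$ is the smash product $B\wedge M$ with the pre-addition generated by the relations $\sum a_i\wedge 1\equiv\sum b_j\wedge 1$ for all relations $\sum a_i\equiv\sum b_j$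 of $B$. A blueprint $C$ with a morphism $B\to C$ is a *monoid blueprint over $B$* if there is an isomorphism $C\simeq B[M]$ under $B$ for some monoid $M$. A blue scheme $X$ over $B$ is *monoidal over $B$* if it has a covering by open affines $U_i$ with $\mathcal O_X(U_i)\simeq B[M_i]$ over $B$ such that every $U_i\cap U_j$ is covered by open affines $V$ with $\mathcal O_X(V)\simeq B[N]$ over $B$ for which the restriction maps $B[M_i]\to B[N]$ and $B[M_j]\to B[N]$ come from localizations $M_i\to N$ and $M_j\to N$ at multiplicative subsets. Let $\mathbb F_1=\{0,1\}$ be the initial blueprint, in which two formal sums are equivalent if and only if they contain $1$ equally often. A monoidal scheme $X$ over $\mathbb F_1$ is *separated* if its diagonal $\Delta:X\to X\times X$ is a closed immersion of monoidal schemes: for every open affine $W\subseteq X\times X$ with $\mathcal O(W)\simeq\mathbb F_1[N]$ for some monoid $N$, the inverse image $\Delta^{-1}(W)$ is affine with $\mathcal O_X(\Delta^{-1}(W))\simeq\mathbb F_1[N']$ for some monoid $N'$, and $\mathcal O(W)\to\mathcal O_X(\Delta^{-1}(W))$ is surjective. **Corollary.** Let $B$ be a blueprint whose spectrum is connected or empty.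 Let $X$ be a separated monoidal scheme over $\mathbb F_1$ and let $X_B=X\times_{\operatorname{Spec}\mathbb F_1}\operatorname{Spec}B$ be its base extension to $B$. Let $U_1$ and $U_2$ be open affine subsets of $X_B$ such that $\mathcal O_{X_B}(U_1)$ and $\mathcal O_{X_B}(U_2)$ are monoid blueprints over $B$. Then $\mathcal O_{X_B}(U_1\cap U_2)$ is a monoid blueprint over $B$. -/

import Mathlib

universe u

open CategoryTheory TopologicalSpace Opposite

noncomputable section

namespace Blue

/-! ### Blueprints -/

/-- A blueprint: a commutative monoid with zero `A` (the `carrier`) together with a pre-addition,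
that is, an additive and multiplicative equivalence relation on the semiring `ℕ[A]` of finite
formal sums of elements of `A`, for which the zero of `A` is equivalent to the empty sum, and
for which equivalent elements of `A` are equal. -/
structure Blueprint : Type (u + 1) where
  carrier : Type u
  [monoid : CommMonoidWithZero carrier]
  rel : RingCon (MonoidAlgebra ℕ carrier)
  zero_rel : rel (MonoidAlgebra.single 0 1) 0
  proper : ∀ a b : carrier, rel (MonoidAlgebra.single a 1) (MonoidAlgebra.single b 1) → a = b

attribute [instance] Blueprint.monoid

instance : CoeSort Blueprint.{u} (Type u) := ⟨Blueprint.carrier⟩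

namespace Blueprint

/-- A morphism of blueprints: a multiplicative map preserving `0`, `1` and all additive
relations. -/
@[ext]
structure Hom (A B : Blueprint.{u}) : Type u where
  toFun : A →*₀ B
  map_rel : ∀ x y : MonoidAlgebra ℕ A, A.rel x y →
    B.rel (MonoidAlgebra.mapDomainRingHom ℕ (toFun : A →* B) x)
      (MonoidAlgebra.mapDomainRingHom ℕ (toFun : A →* B) y)

def Hom.id (A : Blueprint.{u}) : Hom A A where
  toFun := MonoidWithZeroHom.id A
  map_rel x y h := by
    have e : ((MonoidWithZeroHom.id A : A →*₀ A) : A →* A) = MonoidHom.id A := rfl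
    rw [e, MonoidAlgebra.mapDomainRingHom_id]
    exact h

def Hom.comp {A B C : Blueprint.{u}} (f : Hom A B) (g : Hom B C) : Hom A C where
  toFun := g.toFun.comp f.toFun
  map_rel x y h := by
    have e : ((g.toFun.comp f.toFun : A →*₀ C) : A →* C) =
      (g.toFun : B →* C).comp (f.toFun : A →* B) := rfl
    rw [e, MonoidAlgebra.mapDomainRingHom_comp]
    exact g.map_rel _ _ (f.map_rel _ _ h)

instance : Category.{u} Blueprint.{u} where
  Hom := Hom
  id := Hom.id
  comp := Hom.comp

instance (A B : Blueprint.{u}) : CoeFun (A ⟶ B) (fun _ => A → B) := ⟨fun f => (Hom.toFun f : A → B)⟩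

@[ext]
theorem hom_ext {A B : Blueprint.{u}} {f g : A ⟶ B} (h : ∀ a, f a = g a) : f = g :=
  Hom.ext (MonoidWithZeroHom.ext h)

theorem comp_apply {A B C : Blueprint.{u}} (f : A ⟶ B) (g : B ⟶ C) (a : A) :
    (f ≫ g) a = g (f a) := rfl

theorem isUnit_map {A B : Blueprint.{u}} (f : A ⟶ B) {a : A} (h : IsUnit a) : IsUnit (f a) :=
  h.map (Hom.toFun f)

/-- The blueprint `𝔽₁ = {0, 1}` with the smallest possible pre-addition: two formal sums are
equivalent if and only if they contain the element `1` equally often. -/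
def F1 : Blueprint.{u} where
  carrier := WithZero PUnit.{u + 1}
  rel := RingCon.ker (MonoidAlgebra.lift ℕ ℕ (WithZero PUnit.{u + 1})
    (WithZero.lift' (1 : PUnit.{u + 1} →* ℕ) : WithZero PUnit.{u + 1} →* ℕ)).toRingHom
  zero_rel := by simp
  proper a b h := by
    cases a <;> cases b <;> simp_all

/-! ### Localizations -/

section Localization

variable (B : Blueprint.{u})

/-- The semiring `B⁺ = ℕ[A] / ∼`. -/
def Plus : Type u := B.rel.Quotient

instance : CommSemiring B.Plus := inferInstanceAs (CommSemiring B.rel.Quotient)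

/-- The quotient map `ℕ[A] → B⁺`. -/
def plusMk : MonoidAlgebra ℕ B →+* B.Plus := B.rel.mk'

theorem plusMk_eq_iff (x y : MonoidAlgebra ℕ B) : B.plusMk x = B.plusMk y ↔ B.rel x y :=
  RingCon.eq B.rel

/-- The canonical (injective) map `B → B⁺`. -/
def toPlus : B →* B.Plus :=
  (B.plusMk : MonoidAlgebra ℕ B →* B.Plus).comp (MonoidAlgebra.of ℕ B)

theorem toPlus_eq_iff (a b : B) : B.toPlus a = B.toPlus b ↔ a = b := by
  refine ⟨fun h => B.proper a b ?_, fun h => h ▸ rfl⟩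
  exact (B.plusMk_eq_iff _ _).1 h

theorem toPlus_zero : B.toPlus 0 = 0 :=
  ((B.plusMk_eq_iff _ _).2 B.zero_rel).trans (map_zero B.plusMk)

variable (S : Submonoid B)

/-- The map `S⁻¹B → S⁻¹(B⁺)`, `a / s ↦ a / s`. -/
def locToPlus : Localization S →* Localization (S.map B.toPlus) :=
  (Localization.monoidOf S).map (g := B.toPlus) (T := S.map B.toPlus)
    (fun s => Submonoid.mem_map_of_mem B.toPlus s.2) (Localization.monoidOf (S.map B.toPlus))

theorem locToPlus_mk (a : B) (s : S) :
    locToPlus B S (Localization.mk a s) =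
      Localization.mk (B.toPlus a) ⟨B.toPlus s, Submonoid.mem_map_of_mem B.toPlus s.2⟩ := by
  rw [locToPlus, Localization.mk_eq_monoidOf_mk', Localization.mk_eq_monoidOf_mk',
    Submonoid.LocalizationMap.map_mk']

theorem locToPlus_injective : Function.Injective (locToPlus B S) := by
  intro x y h
  induction x using Localization.induction_on with | H x =>
  induction y using Localization.induction_on with | H y =>
  rw [locToPlus_mk, locToPlus_mk, Localization.mk_eq_mk_iff, Localization.r_iff_exists] at h
  obtain ⟨⟨_, c, hc, rfl⟩, h⟩ := h
  rw [Localization.mk_eq_mk_iff, Localization.r_iff_exists]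
  refine ⟨⟨c, hc⟩, ?_⟩
  rw [← B.toPlus_eq_iff]
  simpa only [map_mul] using h

/-- The localization `S⁻¹B` of a blueprint at a multiplicative subset. Its underlying monoid is
the localization of the underlying monoid, and a relation between formal sums of fractions holds
in `S⁻¹B` if and only if it holds as an equation in the localization `S⁻¹(B⁺)` of the semiring
`B⁺`, i.e. if and only if it becomes a relation of `B` after multiplication with a suitable
common denominator. -/
def localization : Blueprint.{u} where
  carrier := Localization S
  rel := RingCon.ker (MonoidAlgebra.lift ℕ (Localization (S.map B.toPlus)) (Localization S)
    (locToPlus B S)).toRingHom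
  zero_rel := by
    have h : locToPlus B S 0 = 0 := by
      rw [← Localization.mk_zero (1 : S), locToPlus_mk, toPlus_zero]
      exact Localization.mk_zero _
    simp [h]
  proper a b h := by
    have e : ∀ a, MonoidAlgebra.lift ℕ (Localization (S.map B.toPlus)) (Localization S)
        (locToPlus B S) (MonoidAlgebra.single a 1) = locToPlus B S a :=
      fun a => MonoidAlgebra.lift_of _ a
    exact locToPlus_injective B S ((e a).symm.trans (Eq.trans h (e b)))

/-- The localization map `B → S⁻¹B`, `a ↦ a / 1`. -/
def toLocalization : B ⟶ B.localization S :=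
  Hom.mk
    { toFun := fun a => (Localization.mk a 1 : Localization S)
      map_zero' := Localization.mk_zero 1
      map_one' := Localization.mk_one
      map_mul' := fun a b => ((Localization.mk_mul a b (1 : S) 1).trans (by rw [one_mul])).symm }
    (by
      intro x y hxy
      let g : B →* Localization S :=
        { toFun := fun a => Localization.mk a 1
          map_one' := Localization.mk_one
          map_mul' := fun a b => by rw [Localization.mk_mul, one_mul] }
      have key : (MonoidAlgebra.lift ℕ (Localization (S.map B.toPlus)) (Localization S)
          (locToPlus B S)).toRingHom.comp (MonoidAlgebra.mapDomainRingHom ℕ g) =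
          (algebraMap B.Plus (Localization (S.map B.toPlus))).comp B.plusMk := by
        refine MonoidAlgebra.ringHom_ext (fun n => ?_) (fun a => ?_)
        · have e : (MonoidAlgebra.single 1 n : MonoidAlgebra ℕ B) = (n : MonoidAlgebra ℕ B) :=
            (MonoidAlgebra.natCast_def n).symm
          rw [e, map_natCast, map_natCast]
        · have e : MonoidAlgebra.mapDomainRingHom ℕ g (MonoidAlgebra.single a 1) =
              MonoidAlgebra.of ℕ (Localization S) (Localization.mk a 1) :=
            MonoidAlgebra.mapDomain_single
          rw [RingHom.comp_apply, e]
          refine (MonoidAlgebra.lift_of (R := ℕ) (locToPlus B S) _).trans ?_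
          rw [locToPlus_mk, RingHom.comp_apply, ← Localization.mk_one_eq_algebraMap]
          refine congrArg₂ Localization.mk rfl (Subtype.ext (map_one B.toPlus))
      have h := congrArg (algebraMap B.Plus (Localization (S.map B.toPlus)))
        ((B.plusMk_eq_iff x y).2 hxy)
      rw [← RingHom.comp_apply, ← RingHom.comp_apply, ← key] at h
      exact h)

end Localization

/-! ### Monoid blueprints -/

section MonoidBlueprint

variable (B : Blueprint.{u}) (M : Type u) [CommMonoidWithZero M]

/-- The equivalence relation on `B × M` generated by `(a, 0) ∼ (b, 0)` and `(0, m) ∼ (0, n)`: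
it identifies all pairs with a zero component with each other, and nothing else. -/
def smashCon : Con (B × M) where
  r x y := x = y ∨ ((x.1 = 0 ∨ x.2 = 0) ∧ (y.1 = 0 ∨ y.2 = 0))
  iseqv := ⟨fun _ => .inl rfl, by grind, by grind⟩
  mul' := by
    rintro ⟨a, m⟩ ⟨b, n⟩ ⟨c, k⟩ ⟨d, l⟩ h h'
    rcases h with h | ⟨h1, h2⟩ <;> rcases h' with h' | ⟨h1', h2'⟩
    · exact .inl (by rw [h, h'])
    all_goals
      right
      simp only [Prod.mk_mul_mk, Prod.mk.injEq] at *
      constructor <;> grind [zero_mul, mul_zero]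

/-- The smash product `B ∧ M`. -/
abbrev Smash : Type u := (smashCon B M).Quotient

/-- The element `a ∧ m` of the smash product. -/
def smashMk : B × M →* Smash B M := (smashCon B M).mk'

theorem smashMk_eq_iff (x y : B × M) :
    smashMk B M x = smashMk B M y ↔ x = y ∨ ((x.1 = 0 ∨ x.2 = 0) ∧ (y.1 = 0 ∨ y.2 = 0)) :=
  (smashCon B M).eq

theorem smashMk_surjective : Function.Surjective (smashMk B M) := Con.mk'_surjective

instance : CommMonoidWithZero (Smash B M) where
  zero := smashMk B M 0
  zero_mul x := by
    obtain ⟨x, rfl⟩ := smashMk_surjective B M x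
    exact (map_mul (smashMk B M) 0 x).symm.trans (by rw [zero_mul]; rfl)
  mul_zero x := by
    obtain ⟨x, rfl⟩ := smashMk_surjective B M x
    exact (map_mul (smashMk B M) x 0).symm.trans (by rw [mul_zero]; rfl)

theorem smash_zero : (0 : Smash B M) = smashMk B M 0 := rfl

/-- The map `B → B ∧ M`, `a ↦ a ∧ 1`. -/
def smashInl : B →*₀ Smash B M where
  toFun a := smashMk B M (a, 1)
  map_zero' := (smashMk_eq_iff B M _ _).2 (by simp)
  map_one' := rfl
  map_mul' a b := by rw [← map_mul, Prod.mk_mul_mk, one_mul]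

/-- The pre-addition of `B[M]`: it is generated by the relations `∑ aᵢ ∧ 1 ≡ ∑ bⱼ ∧ 1` for
all relations `∑ aᵢ ≡ ∑ bⱼ` of `B`. -/
def smashRel : RingCon (MonoidAlgebra ℕ (Smash B M)) :=
  ringConGen fun x y => ∃ v w : MonoidAlgebra ℕ B, B.rel v w ∧
    x = MonoidAlgebra.mapDomainRingHom ℕ (smashInl B M : B →* Smash B M) v ∧
    y = MonoidAlgebra.mapDomainRingHom ℕ (smashInl B M : B →* Smash B M) w

/-- Auxiliary: two elements of `B⁺[M]` are identified if they have the same coefficients at all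
nonzero elements of `M`. -/
def contractCon : RingCon (MonoidAlgebra B.Plus M) where
  r x y := ∀ m : M, m ≠ 0 → x.coeff m = y.coeff m
  iseqv := ⟨fun _ _ _ => rfl, fun h m hm => (h m hm).symm,
    fun h h' m hm => (h m hm).trans (h' m hm)⟩
  add' h h' m hm := by simp [h m hm, h' m hm]
  mul' {w x y z} h h' m hm := by
    classical
    have key : ∀ {p q r : MonoidAlgebra B.Plus M},
        (∀ m : M, m ≠ 0 → p.coeff m = q.coeff m) → (p * r).coeff m = (q * r).coeff m := by
      intro p q r hpq
      induction r using MonoidAlgebra.induction_linear with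
      | zero => simp
      | add f g hf hg => simp [mul_add, hf, hg]
      | single n b =>
        have hp : ∀ p : MonoidAlgebra B.Plus M, (p * MonoidAlgebra.single n b).coeff m =
            p.coeff.sum fun k c => if k * n = m then c * b else 0 := by
          intro p
          induction p using MonoidAlgebra.induction_linear with
          | zero => simp
          | add f g hf hg =>
            rw [add_mul, MonoidAlgebra.coeff_add, Finsupp.add_apply, hf, hg,
              MonoidAlgebra.coeff_add, Finsupp.sum_add_index']
            · simp
            · intro k c d; split_ifs <;> simp [add_mul]
          | single k c =>
            rw [MonoidAlgebra.single_mul_single, MonoidAlgebra.coeff_single,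
              MonoidAlgebra.coeff_single, Finsupp.sum_single_index (by simp),
              Finsupp.single_apply]
        rw [hp, hp, Finsupp.sum_of_support_subset _ (s := p.coeff.support ∪ q.coeff.support)
            Finset.subset_union_left _ (by simp),
          Finsupp.sum_of_support_subset _ (s := p.coeff.support ∪ q.coeff.support)
            Finset.subset_union_right _ (by simp)]
        refine Finset.sum_congr rfl fun k _ => ?_
        by_cases hk : k * n = m
        · have hk0 : k ≠ 0 := by rintro rfl; exact hm (by rw [← hk, zero_mul])
          rw [hpq k hk0]
        · simp [hk]
    exact (key h).trans (by rw [mul_comm x y, mul_comm x z]; exact key h')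

/-- Auxiliary: the quotient semiring. -/
def Contract : Type u := (contractCon B M).Quotient

instance : CommSemiring (Contract B M) :=
  inferInstanceAs (CommSemiring (contractCon B M).Quotient)

/-- Auxiliary: the quotient map. -/
def contractMk : MonoidAlgebra B.Plus M →+* Contract B M := (contractCon B M).mk'

theorem contractMk_eq_iff (x y : MonoidAlgebra B.Plus M) :
    contractMk B M x = contractMk B M y ↔ ∀ m : M, m ≠ 0 → x.coeff m = y.coeff m :=
  RingCon.eq (contractCon B M)

/-- Auxiliary: the map `B ∧ M → B⁺[M]`, `a ∧ m ↦ a · m`, up to coefficients at `0`. -/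
def smashToContract : Smash B M →* Contract B M :=
  (smashCon B M).lift
    ((contractMk B M : MonoidAlgebra B.Plus M →* Contract B M).comp
      { toFun := fun x => MonoidAlgebra.single x.2 (B.toPlus x.1)
        map_one' := by simp [MonoidAlgebra.one_def]
        map_mul' := fun x y => by simp [MonoidAlgebra.single_mul_single] })
    (by
      rintro ⟨a, m⟩ ⟨b, n⟩ h
      rcases h with h | ⟨h1, h2⟩
      · rw [h]; exact rfl
      · refine (contractMk_eq_iff B M _ _).2 fun k hk => ?_
        simp only at h1 h2
        have aux : ∀ (a : B) (m : M), a = 0 ∨ m = 0 →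
            (MonoidAlgebra.single m (B.toPlus a)).coeff k = 0 := by
          rintro a m (rfl | rfl)
          · simp [toPlus_zero]
          · simp [hk]
        exact (aux a m h1).trans (aux b n h2).symm)

theorem smashToContract_mk (a : B) (m : M) :
    smashToContract B M (smashMk B M (a, m)) =
      contractMk B M (MonoidAlgebra.single m (B.toPlus a)) := rfl

theorem smashToContract_injective : Function.Injective (smashToContract B M) := by
  intro x y h
  obtain ⟨⟨a, m⟩, rfl⟩ := smashMk_surjective B M x
  obtain ⟨⟨b, n⟩, rfl⟩ := smashMk_surjective B M y
  rw [smashToContract_mk, smashToContract_mk] at h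
  have h' : ∀ k : M, k ≠ 0 → (MonoidAlgebra.single m (B.toPlus a)).coeff k =
    (MonoidAlgebra.single n (B.toPlus b)).coeff k := (contractMk_eq_iff B M _ _).1 h
  classical
  simp only [MonoidAlgebra.coeff_single, Finsupp.single_apply] at h'
  have e0 : ∀ a : B, B.toPlus a = 0 → a = 0 := fun a ha =>
    (B.toPlus_eq_iff a 0).1 (ha.trans B.toPlus_zero.symm)
  rw [smashMk_eq_iff]
  have hm := h' m
  have hn := h' n
  simp only [if_true] at hm hn
  by_cases hmn : m = n
  · subst hmn
    by_cases h0 : m = 0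
    · right; simp [h0]
    · left
      simp only [if_true] at hm
      rw [(B.toPlus_eq_iff a b).1 (hm h0)]
  · right
    rw [if_neg (Ne.symm hmn)] at hm
    rw [if_neg hmn] at hn
    refine ⟨?_, ?_⟩
    · by_cases h0 : m = 0
      · exact .inr h0
      · exact .inl (e0 a (hm h0))
    · by_cases h0 : n = 0
      · exact .inr h0
      · exact .inl (e0 b (hn h0).symm)

theorem smashRel_le : smashRel B M ≤ RingCon.ker
    (MonoidAlgebra.lift ℕ (Contract B M) (Smash B M) (smashToContract B M)).toRingHom := by
  refine RingCon.ringConGen_le.2 ?_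
  rintro _ _ ⟨v, w, hvw, rfl, rfl⟩
  have key : (MonoidAlgebra.lift ℕ (Contract B M) (Smash B M)
        (smashToContract B M)).toRingHom.comp
        (MonoidAlgebra.mapDomainRingHom ℕ (smashInl B M : B →* Smash B M)) =
      ((contractMk B M).comp MonoidAlgebra.singleOneRingHom).comp B.plusMk := by
    refine MonoidAlgebra.ringHom_ext (fun n => ?_) (fun a => ?_)
    · have e : (MonoidAlgebra.single 1 n : MonoidAlgebra ℕ B) = (n : MonoidAlgebra ℕ B) :=
        (MonoidAlgebra.natCast_def n).symm
      rw [e, map_natCast, map_natCast]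
    · simp only [RingHom.comp_apply, MonoidAlgebra.mapDomainRingHom_apply,
        MonoidAlgebra.mapDomain_single, AlgHom.toRingHom_eq_coe, RingHom.coe_coe,
        MonoidAlgebra.lift_single, one_smul]
      rfl
  have hv : B.plusMk v = B.plusMk w := (B.plusMk_eq_iff _ _).2 hvw
  have := congrArg ((contractMk B M).comp MonoidAlgebra.singleOneRingHom) hv
  rw [← RingHom.comp_apply, ← RingHom.comp_apply, ← key] at this
  exact this

/-- The monoid blueprint `B[M]` of a monoid `M` over `B`. -/
def monoidBlueprint : Blueprint.{u} where
  carrier := Smash B M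
  rel := smashRel B M
  zero_rel := by
    refine RingCon.le_ringConGen _ _ ⟨_, _, B.zero_rel, ?_, by simp⟩
    simp
  proper a b h := by
    have := smashRel_le B M h
    have e : ∀ a, MonoidAlgebra.lift ℕ (Contract B M) (Smash B M)
        (smashToContract B M) (MonoidAlgebra.single a 1) = smashToContract B M a :=
      fun a => MonoidAlgebra.lift_of _ a
    exact smashToContract_injective B M ((e a).symm.trans (Eq.trans this (e b)))

/-- The structure map `B → B[M]`, `a ↦ a ∧ 1`. -/
def toMonoidBlueprint : B ⟶ monoidBlueprint B M :=
  Hom.mk (smashInl B M) fun v w h => RingCon.le_ringConGen _ _ ⟨v, w, h, rfl, rfl⟩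

/-- A morphism `α : B ⟶ C` exhibits `C` as a monoid blueprint over `B` if `C ≃ B[M]` for some
monoid `M`, compatibly with the maps from `B`. -/
def IsMonoidBlueprint {B C : Blueprint.{u}} (α : B ⟶ C) : Prop :=
  ∃ (M : Type u) (_ : CommMonoidWithZero M) (e : monoidBlueprint B M ≅ C),
    toMonoidBlueprint B M ≫ e.hom = α

end MonoidBlueprint

/-! ### The spectrum -/

section Spectrum

variable (B : Blueprint.{u})

/-- A prime ideal of a blueprint. An ideal is a subset `I` with `B · I ⊆ I` such that
`∑ aᵢ + c ≡ ∑ bⱼ` with `aᵢ, bⱼ ∈ I` implies `c ∈ I`; it is prime if its complement is a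
multiplicative subset. -/
@[ext]
structure Spectrum : Type u where
  ideal : Set B
  mul_mem : ∀ a b : B, b ∈ ideal → a * b ∈ ideal
  mem_of_rel : ∀ (x y : MonoidAlgebra ℕ B) (c : B), (↑x.coeff.support : Set B) ⊆ ideal →
    (↑y.coeff.support : Set B) ⊆ ideal → B.rel (x + MonoidAlgebra.single c 1) y → c ∈ ideal
  one_notMem : (1 : B) ∉ ideal
  mem_or_mem : ∀ a b : B, a * b ∈ ideal → a ∈ ideal ∨ b ∈ ideal

/-- The topology generated by the sets `{p | h ∉ p}`. -/
instance : TopologicalSpace (Spectrum B) :=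
  TopologicalSpace.generateFrom (Set.range fun h : B => {p : Spectrum B | h ∉ p.ideal})

variable {B} in
/-- The complement of a prime ideal. -/
def Spectrum.compl (p : Spectrum B) : Submonoid B where
  carrier := {a | a ∉ p.ideal}
  one_mem' := p.one_notMem
  mul_mem' {a b} ha hb h := (p.mem_or_mem a b h).elim ha hb

/-- The stalk `B_p`. -/
abbrev atPrime (p : Spectrum B) : Blueprint.{u} := B.localization p.compl

variable {B} in
/-- The element `a / f` of `B_p`. -/
def frac (p : Spectrum B) (a f : B) (hf : f ∉ p.ideal) : B.atPrime p :=
  Localization.mk a (⟨f, hf⟩ : p.compl)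

/-- The functions `s` on `U` with `s p ∈ B_p` that are locally represented by fractions. -/
def IsLocallyFraction (U : Opens (Spectrum B)) (s : ∀ p : U, B.atPrime p.1) : Prop :=
  ∀ p : U, ∃ V : Opens (Spectrum B), p.1 ∈ V ∧ ∃ a f : B, ∀ q : U, q.1 ∈ V →
    ∃ hf : f ∉ q.1.ideal, s q = frac q.1 a f hf

/-- The sections of the structure sheaf over `U`. -/
abbrev Sections (U : Opens (Spectrum B)) : Type u :=
  {s : ∀ p : U, B.atPrime p.1 // IsLocallyFraction B U s}

theorem frac_mul (p : Spectrum B) (a b f g : B) (hf hg) :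
    frac p a f hf * frac p b g hg = frac p (a * b) (f * g) (p.compl.mul_mem hf hg) :=
  Localization.mk_mul _ _ _ _

theorem frac_one (p : Spectrum B) : frac p 1 1 p.one_notMem = 1 := Localization.mk_one

theorem frac_zero (p : Spectrum B) : frac p 0 1 p.one_notMem = 0 := Localization.mk_zero _

theorem isLocallyFraction_const (U : Opens (Spectrum B)) (a : B) :
    IsLocallyFraction B U fun p => frac p.1 a 1 p.1.one_notMem :=
  fun _ => ⟨⊤, trivial, a, 1, fun q _ => ⟨q.1.one_notMem, rfl⟩⟩

instance (U : Opens (Spectrum B)) : Mul (Sections B U) where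
  mul s t := ⟨fun p => s.1 p * t.1 p, fun p => by
    obtain ⟨V, hV, a, f, h⟩ := s.2 p
    obtain ⟨W, hW, b, g, h'⟩ := t.2 p
    refine ⟨V ⊓ W, ⟨hV, hW⟩, a * b, f * g, fun q hq => ?_⟩
    obtain ⟨hf, e⟩ := h q hq.1
    obtain ⟨hg, e'⟩ := h' q hq.2
    exact ⟨q.1.compl.mul_mem hf hg, (congrArg₂ (· * ·) e e').trans (frac_mul B q.1 a b f g hf hg)⟩⟩

instance (U : Opens (Spectrum B)) : One (Sections B U) where
  one := ⟨fun _ => 1, by simpa only [frac_one] using isLocallyFraction_const B U 1⟩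

instance (U : Opens (Spectrum B)) : Zero (Sections B U) where
  zero := ⟨fun _ => 0, by simpa only [frac_zero] using isLocallyFraction_const B U 0⟩

instance (U : Opens (Spectrum B)) : CommMonoidWithZero (Sections B U) where
  mul_assoc _ _ _ := Subtype.ext (funext fun _ => mul_assoc _ _ _)
  mul_comm _ _ := Subtype.ext (funext fun _ => mul_comm _ _)
  one_mul _ := Subtype.ext (funext fun _ => one_mul _)
  mul_one _ := Subtype.ext (funext fun _ => mul_one _)
  zero_mul _ := Subtype.ext (funext fun _ => zero_mul _)
  mul_zero _ := Subtype.ext (funext fun _ => mul_zero _)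

/-- The evaluation of sections at a point. -/
def evalHom (U : Opens (Spectrum B)) (p : U) : Sections B U →*₀ B.atPrime p.1 where
  toFun s := s.1 p
  map_zero' := rfl
  map_one' := rfl
  map_mul' _ _ := rfl

/-- The blueprint of sections over `U`: a relation between sections holds if and only if it holds
in all stalks at points of `U`. -/
def sectionsBlueprint (U : Opens (Spectrum B)) : Blueprint.{u} where
  carrier := Sections B U
  rel := ⨅ p : U, (B.atPrime p.1).rel.comap
    (MonoidAlgebra.mapDomainRingHom ℕ (evalHom B U p : Sections B U →* B.atPrime p.1))
  zero_rel := by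
    simp only [RingCon.coe_iInf, iInf_apply, iInf_Prop_eq, RingCon.comap_rel]
    intro p
    simpa using (B.atPrime p.1).zero_rel
  proper s t h := by
    simp only [RingCon.coe_iInf, iInf_apply, iInf_Prop_eq, RingCon.comap_rel] at h
    refine Subtype.ext (funext fun p => (B.atPrime p.1).proper _ _ ?_)
    have h' := h p
    simp only [MonoidAlgebra.mapDomainRingHom_apply, MonoidAlgebra.mapDomain_single] at h'
    exact h'

theorem sectionsBlueprint_rel {U : Opens (Spectrum B)}
    (x y : MonoidAlgebra ℕ (B.sectionsBlueprint U)) :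
    (B.sectionsBlueprint U).rel x y ↔ ∀ p : U, (B.atPrime p.1).rel
      (MonoidAlgebra.mapDomainRingHom ℕ (evalHom B U p : Sections B U →* B.atPrime p.1) x)
      (MonoidAlgebra.mapDomainRingHom ℕ (evalHom B U p : Sections B U →* B.atPrime p.1) y) := by
  have e : (B.sectionsBlueprint U).rel = ⨅ p : U, (B.atPrime p.1).rel.comap
    (MonoidAlgebra.mapDomainRingHom ℕ (evalHom B U p : Sections B U →* B.atPrime p.1)) := rfl
  have e' : ∀ x y : MonoidAlgebra ℕ (Sections B U), (⨅ p : U, (B.atPrime p.1).rel.comap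
    (MonoidAlgebra.mapDomainRingHom ℕ (evalHom B U p : Sections B U →* B.atPrime p.1))) x y ↔
      ∀ p : U, (B.atPrime p.1).rel
      (MonoidAlgebra.mapDomainRingHom ℕ (evalHom B U p : Sections B U →* B.atPrime p.1) x)
      (MonoidAlgebra.mapDomainRingHom ℕ (evalHom B U p : Sections B U →* B.atPrime p.1) y) := by
    intro x y
    simp only [RingCon.coe_iInf, iInf_apply, iInf_Prop_eq, RingCon.comap_rel]
  rw [e]
  exact e' x y

/-- Morphisms into a blueprint of sections can be given pointwise. -/
def homToSections {E : Blueprint.{u}} (U : Opens (Spectrum B)) (φ : ∀ p : U, E ⟶ B.atPrime p.1)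
    (h : ∀ e : E, IsLocallyFraction B U fun p => φ p e) : E ⟶ B.sectionsBlueprint U :=
  Hom.mk
    { toFun := fun e => ⟨fun p => φ p e, h e⟩
      map_zero' := Subtype.ext (funext fun p => map_zero (Hom.toFun (φ p)))
      map_one' := Subtype.ext (funext fun p => map_one (Hom.toFun (φ p)))
      map_mul' := fun a b => Subtype.ext (funext fun p => map_mul (Hom.toFun (φ p)) a b) }
    (by
      intro x y hxy
      rw [sectionsBlueprint_rel]
      intro p
      let g : E →* Sections B U :=
        { toFun := fun e => ⟨fun p => φ p e, h e⟩
          map_one' := Subtype.ext (funext fun p => map_one (Hom.toFun (φ p)))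
          map_mul' := fun a b => Subtype.ext (funext fun p => map_mul (Hom.toFun (φ p)) a b) }
      have e : ∀ z : MonoidAlgebra ℕ E,
          MonoidAlgebra.mapDomainRingHom ℕ (evalHom B U p : Sections B U →* B.atPrime p.1)
            (MonoidAlgebra.mapDomainRingHom ℕ g z) =
          MonoidAlgebra.mapDomainRingHom ℕ ((Hom.toFun (φ p) : E →*₀ B.atPrime p.1) :
            E →* B.atPrime p.1) z := by
        intro z
        rw [← RingHom.comp_apply, ← MonoidAlgebra.mapDomainRingHom_comp]
        rfl
      have := Hom.map_rel (φ p) x y hxy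
      rw [← e, ← e] at this
      exact this)

/-- The evaluation of sections at a point, as a morphism of blueprints. -/
def eval (U : Opens (Spectrum B)) (p : U) : B.sectionsBlueprint U ⟶ B.atPrime p.1 :=
  Hom.mk (evalHom B U p) fun x y h => (sectionsBlueprint_rel B x y).1 h p

theorem section_ext {U : Opens (Spectrum B)} {s t : B.sectionsBlueprint U}
    (h : ∀ p, eval B U p s = eval B U p t) : s = t :=
  Subtype.ext (funext h)

/-- The restriction of sections. -/
def restrictSections {U V : Opens (Spectrum B)} (h : V ≤ U) :
    B.sectionsBlueprint U ⟶ B.sectionsBlueprint V :=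
  homToSections B V (fun p => eval B U ⟨p.1, h p.2⟩) fun s p => by
    obtain ⟨W, hW, a, f, hs⟩ := s.2 ⟨p.1, h p.2⟩
    exact ⟨W, hW, a, f, fun q hq => hs ⟨q.1, h q.2⟩ hq⟩

/-- The structure presheaf on the spectrum. -/
def structurePresheaf : TopCat.Presheaf Blueprint.{u} (TopCat.of (Spectrum B)) where
  obj U := B.sectionsBlueprint U.unop
  map i := restrictSections B i.unop.le
  map_id _ := rfl
  map_comp _ _ := rfl

theorem structurePresheaf_isSheaf : (structurePresheaf B).IsSheaf := by
  intro E
  refine (isSheaf_iff_isSheaf_of_type _ _).1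
    (TopCat.Presheaf.isSheaf_of_isSheafUniqueGluing_types
      (structurePresheaf B ⋙ coyoneda.obj (op E)) ?_)
  intro ι U φ hφ
  let ψ : ∀ i, E ⟶ B.sectionsBlueprint (U i) := fun i => φ i
  have hφ' : ∀ (i j : ι) (p : Spectrum B) (hi : p ∈ U i) (hj : p ∈ U j),
      (φ i : E ⟶ B.sectionsBlueprint (U i)) ≫ eval B (U i) ⟨p, hi⟩ =
        (φ j : E ⟶ B.sectionsBlueprint (U j)) ≫ eval B (U j) ⟨p, hj⟩ := by
    intro i j p hi hj
    exact congrArg (fun ψ : E ⟶ B.sectionsBlueprint (U i ⊓ U j) =>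
      ψ ≫ eval B (U i ⊓ U j) ⟨p, hi, hj⟩) (hφ i j)
  have hU : ∀ p : ↥(iSup U), ∃ i, p.1 ∈ U i := fun p => Opens.mem_iSup.1 p.2
  choose k hk using hU
  let Φ : ∀ p : ↥(iSup U), E ⟶ B.atPrime p.1 := fun p =>
    (φ (k p) : E ⟶ B.sectionsBlueprint (U (k p))) ≫ eval B (U (k p)) ⟨p.1, hk p⟩
  have hΦ : ∀ (i : ι) (p : ↥(iSup U)) (hi : p.1 ∈ U i),
      Φ p = (φ i : E ⟶ B.sectionsBlueprint (U i)) ≫ eval B (U i) ⟨p.1, hi⟩ :=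
    fun i p hi => hφ' _ _ _ _ _
  refine ⟨homToSections B (iSup U) Φ fun e p => ?_, fun i => ?_, fun χ hχ => ?_⟩
  · obtain ⟨V, hV, a, f, h⟩ := (ψ (k p) e).2 ⟨p.1, hk p⟩
    refine ⟨V ⊓ U (k p), ⟨hV, hk p⟩, a, f, fun q hq => ?_⟩
    obtain ⟨hf, e'⟩ := h ⟨q.1, hq.2⟩ hq.1
    refine ⟨hf, ?_⟩
    exact (congrArg (fun χ : E ⟶ B.atPrime q.1 => χ e) (hΦ (k p) q hq.2)).trans e'
  · refine hom_ext fun e => section_ext B fun p => ?_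
    exact congrArg (fun χ : E ⟶ B.atPrime p.1 => χ e)
      (hΦ i ⟨p.1, (le_iSup U i) p.2⟩ p.2)
  · refine hom_ext fun e => section_ext B fun p => ?_
    have := congrArg (fun χ : E ⟶ B.sectionsBlueprint (U (k p)) =>
      eval B (U (k p)) ⟨p.1, hk p⟩ (χ e)) (hχ (k p))
    exact this

end Spectrum

end Blueprint

open AlgebraicGeometry (SheafedSpace)

/-! ### Blue schemes -/

/-- Blueprinted spaces: topological spaces with a sheaf of blueprints. -/
abbrev BlueprintedSpace : Type (u + 1) := SheafedSpace Blueprint.{u}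

/-- The spectrum of a blueprint as a blueprinted space. -/
def specSpace (B : Blueprint.{u}) : BlueprintedSpace.{u} where
  carrier := TopCat.of B.Spectrum
  presheaf := B.structurePresheaf
  IsSheaf := B.structurePresheaf_isSheaf


/-- The canonical map `B → Γ(Spec B)`, sending `a` to the section `a / 1`. -/
def toGlobal (B : Blueprint.{u}) : B ⟶ (specSpace B).presheaf.obj (op ⊤) :=
  Blueprint.homToSections B ⊤ (fun p => B.toLocalization p.1.compl)
    (Blueprint.isLocallyFraction_const B ⊤)

/-- A blueprinted space is affine if it is isomorphic to the spectrum of its blueprint of global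
sections via the canonical morphism, i.e. via an isomorphism that induces the identity on global
sections. -/
def IsAffine (X : BlueprintedSpace.{u}) : Prop :=
  ∃ φ : X ≅ specSpace (X.presheaf.obj (op ⊤)),
    toGlobal (X.presheaf.obj (op ⊤)) ≫ φ.hom.hom.c.app (op ⊤) = 𝟙 (X.presheaf.obj (op ⊤))

/-- A morphism of blueprinted spaces is local if the induced maps between the stalks reflect units:
if the pullback of a section `s` is invertible in a neighbourhood of `x`, then `s` is invertible
in a neighbourhood of `f x`. -/
def IsLocalMorphism {X Y : BlueprintedSpace.{u}} (f : X ⟶ Y) : Prop :=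
  ∀ (V : Opens Y) (s : Y.presheaf.obj (op V)) (x : X), f.hom.base x ∈ V →
    (∃ (W : Opens X) (i : W ⟶ (Opens.map f.hom.base).obj V), x ∈ W ∧
      IsUnit ((f.hom.c.app (op V) ≫ X.presheaf.map i.op) s)) →
    ∃ (V' : Opens Y) (j : V' ⟶ V), f.hom.base x ∈ V' ∧ IsUnit ((Y.presheaf.map j.op) s)

theorem isLocalMorphism_id (X : BlueprintedSpace.{u}) : IsLocalMorphism (𝟙 X) :=
  fun _ _ _ _ ⟨W, i, hx, h⟩ => ⟨W, i, hx, h⟩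

theorem isLocalMorphism_comp {X Y Z : BlueprintedSpace.{u}} {f : X ⟶ Y} {g : Y ⟶ Z}
    (hf : IsLocalMorphism f) (hg : IsLocalMorphism g) : IsLocalMorphism (f ≫ g) := by
  intro V s x hx ⟨W, i, hxW, h⟩
  obtain ⟨W', j, hW', h'⟩ := hf ((Opens.map g.hom.base).obj V) ((g.hom.c.app (op V)) s) x hx
    ⟨W, i, hxW, h⟩
  exact hg V s (f.hom.base x) hx ⟨W', j, hW', h'⟩

/-- A blue scheme is a blueprinted space that is locally isomorphic to spectra of blueprints. -/
structure BlueScheme : Type (u + 1) where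
  toSpace : BlueprintedSpace.{u}
  exists_chart : ∀ x : toSpace, ∃ U : Opens toSpace, x ∈ U ∧ ∃ C : Blueprint.{u},
    Nonempty (toSpace.restrict U.isOpenEmbedding ≅ specSpace C)

namespace BlueScheme

/-- A morphism of blue schemes is a local morphism of blueprinted spaces. -/
@[ext]
structure Hom (X Y : BlueScheme.{u}) : Type u where
  toHom : X.toSpace ⟶ Y.toSpace
  isLocal : IsLocalMorphism toHom

instance : Category.{u} BlueScheme.{u} where
  Hom := Hom
  id X := ⟨𝟙 X.toSpace, isLocalMorphism_id _⟩
  comp f g := ⟨f.toHom ≫ g.toHom, isLocalMorphism_comp f.isLocal g.isLocal⟩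
  id_comp _ := Hom.ext (Category.id_comp _)
  comp_id _ := Hom.ext (Category.comp_id _)
  assoc _ _ _ := Hom.ext (Category.assoc _ _ _)

/-- The spectrum of a blueprint as a blue scheme. -/
def Spec (B : Blueprint.{u}) : BlueScheme.{u} where
  toSpace := specSpace B
  exists_chart _ := ⟨⊤, trivial, B, ⟨(specSpace B).restrictTopIso⟩⟩

/-- The open subsets of a blue scheme. -/
abbrev OpenSubset (X : BlueScheme.{u}) : Type u := Opens X.toSpace

/-- The blueprint `𝒪_X(U)`. -/
abbrev sections (X : BlueScheme.{u}) (U : X.OpenSubset) : Blueprint.{u} :=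
  X.toSpace.presheaf.obj (op U)

/-- The restriction map `𝒪_X(U) → 𝒪_X(V)` for `V ⊆ U`. -/
abbrev res (X : BlueScheme.{u}) {U V : X.OpenSubset} (h : V ≤ U) : X.sections U ⟶ X.sections V :=
  X.toSpace.presheaf.map (homOfLE h).op

/-- The inverse image of an open subset. -/
abbrev preimage {X Y : BlueScheme.{u}} (f : X ⟶ Y) (V : Y.OpenSubset) : X.OpenSubset :=
  (Opens.map f.toHom.hom.base).obj V

/-- The map `𝒪_Y(V) → 𝒪_X(f⁻¹ V)` of a morphism `f : X ⟶ Y`. -/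
abbrev pullbackSections {X Y : BlueScheme.{u}} (f : X ⟶ Y) (V : Y.OpenSubset) :
    Y.sections V ⟶ X.sections (preimage f V) :=
  f.toHom.hom.c.app (op V)

/-- An open subset `U` of `X` is affine if it is an affine blueprinted space. -/
def IsAffineOpen {X : BlueScheme.{u}} (U : X.OpenSubset) : Prop :=
  IsAffine (X.toSpace.restrict U.isOpenEmbedding)

/-- The map `B → 𝒪_X(U)` given by a morphism `π : X ⟶ Spec B`. -/
def structureMap {B : Blueprint.{u}} {X : BlueScheme.{u}} (π : X ⟶ Spec B) (U : X.OpenSubset) :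
    B ⟶ X.sections U :=
  toGlobal B ≫ pullbackSections π ⊤ ≫ X.res (U := preimage π ⊤) (V := U) (fun _ _ => trivial)

/-- For a blue scheme `π : X ⟶ Spec B` over `B` and an open subset `U`, the property that `𝒪_X(U)`
is a monoid blueprint over `B`. -/
def HasMonoidBlueprintSections {B : Blueprint.{u}} {X : BlueScheme.{u}} (π : X ⟶ Spec B)
    (U : X.OpenSubset) : Prop :=
  Blueprint.IsMonoidBlueprint (structureMap π U)

/-- A blue scheme `π : X ⟶ Spec B` over `B` is monoidal over `B` if it has a covering by open
affines `U i` with `𝒪_X(U i) ≃ B[M i]` over `B`, such that the intersections `U i ∩ U j` are covered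
by open affines `V` with `𝒪_X(V) ≃ B[N]` over `B` for which the restriction maps `B[M i] → B[N]` and
`B[M j] → B[N]` are induced by localizations `M i → N` and `M j → N` at multiplicative subsets. -/
def IsMonoidal {B : Blueprint.{u}} {X : BlueScheme.{u}} (π : X ⟶ Spec B) : Prop :=
  ∃ (I : Type u) (U : I → X.OpenSubset) (M : I → Type u) (_ : ∀ i, CommMonoidWithZero (M i))
    (e : ∀ i, Blueprint.monoidBlueprint B (M i) ≅ X.sections (U i)),
    (⨆ i, U i) = ⊤ ∧
    (∀ i, IsAffineOpen (U i)) ∧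
    (∀ i, Blueprint.toMonoidBlueprint B (M i) ≫ (e i).hom = structureMap π (U i)) ∧
    ∀ (i j : I) (x : X.toSpace), x ∈ U i → x ∈ U j →
      ∃ (V : X.OpenSubset) (hi : V ≤ U i) (hj : V ≤ U j) (N : Type u) (_ : CommMonoidWithZero N)
        (e' : Blueprint.monoidBlueprint B N ≅ X.sections V) (f : M i →*₀ N) (g : M j →*₀ N),
        x ∈ V ∧ IsAffineOpen V ∧
        Blueprint.toMonoidBlueprint B N ≫ e'.hom = structureMap π V ∧
        (∃ S : Submonoid (M i), S.IsLocalizationMap f) ∧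
        (∃ S : Submonoid (M j), S.IsLocalizationMap g) ∧
        (∀ m : M i, X.res hi ((e i).hom (Blueprint.smashMk B (M i) (1, m))) =
          e'.hom (Blueprint.smashMk B N (1, f m))) ∧
        (∀ m : M j, X.res hj ((e j).hom (Blueprint.smashMk B (M j) (1, m))) =
          e'.hom (Blueprint.smashMk B N (1, g m)))

/-- An open subset of a blue scheme over `𝔽₁` that is the spectrum of a monoid. -/
def IsMonoidalAffineOpen {X : BlueScheme.{u}} (π : X ⟶ Spec Blueprint.F1.{u})
    (U : X.OpenSubset) : Prop :=
  IsAffineOpen U ∧ HasMonoidBlueprintSections π U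

/-- A closed immersion `i : X ⟶ Y` of monoidal schemes over `𝔽₁`: the inverse image of every open
subset that is the spectrum of a monoid is the spectrum of a monoid, and the induced map of
sections is surjective. -/
def IsMonoidalClosedImmersion {X Y : BlueScheme.{u}} (i : X ⟶ Y)
    (π : Y ⟶ Spec Blueprint.F1.{u}) : Prop :=
  ∀ W : Y.OpenSubset, IsMonoidalAffineOpen π W →
    IsMonoidalAffineOpen (i ≫ π) (preimage i W) ∧
      Function.Surjective (fun s : Y.sections W => (pullbackSections i W) s)

/-- A monoidal scheme over `𝔽₁` is separated if the diagonal `X ⟶ X ×_{Spec 𝔽₁} X` is a closed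
immersion of monoidal schemes. -/
def IsSeparated {X : BlueScheme.{u}} (π : X ⟶ Spec Blueprint.F1.{u}) : Prop :=
  ∃ (P : BlueScheme.{u}) (p₁ p₂ : P ⟶ X) (h : IsPullback p₁ p₂ π π),
    IsMonoidalClosedImmersion (h.lift (𝟙 X) (𝟙 X) rfl) (p₁ ≫ π)

end BlueScheme

end Blue

end

/-! The canonical map from a blueprint `C` to the global sections of `Spec C` need not be an
isomorphism. Two properties of an open set `U` are therefore kept apart: that a morphism `C ⟶ 𝒪(U)`
identifies `U` with the spectrum of `C` (`IsChart`), and that this morphism is an isomorphism. The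
hypotheses give both for `U₁` and `U₂` with `C = B[Mᵢ]`. The goal is a chart of `U₁ ∩ U₂` by some
`B[N]` that is an isomorphism.

Geometry. The points of `X_B` are the pairs of a point of `X` and a prime ideal of `B`, with the
product topology (`exists_point`, `point_ext`, `exists_box`). If `U` has a chart by `B[M]`, then the
fibre of `U` over a prime ideal `P` is an open subset of `X` with a smallest point, which comes from
the prime ideal of `B[M]` whose complement consists of the `b ∧ m` with `b ∉ P` and `m` a unit
(`IsChartOver.exists_generic`). This fibre is locally constant in `P`. As `Spec B` is connected, `U
= p⁻¹(V)` for the smallest neighbourhood `V` of some point of `X` (`IsChartOver.exists_preimage`).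
Such a `V` is the spectrum of a monoid, and by separatedness so is `V₁ ∩ V₂`. Hence `U₁ ∩ U₂ =
p⁻¹(V₁ ∩ V₂)` has a chart by `B[N]` for some monoid `N` (`isChart_prodChart`). If the intersection
is empty, its sections are `B[{0}]`.

Algebra. It remains to see that `B[N] ⟶ 𝒪(U₁ ∩ U₂)` is an isomorphism (`IsChartOver.isIso`), given
that `B[M₁] ⟶ 𝒪(U₁)` is one. The latter forces two properties of `B`: relations can be tested
locally on `Spec B` (`IsChartOver.plus_ext`), and every global section of `Spec B` comes from `B`
(`IsChartOver.toGlobal_surjective`). Locally over `Spec B`, a section over `U₁ ∩ U₂` is a fraction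
`(a / f) n`, so its coefficients glue to elements `b n` of `B`, at most one of which is nonzero
locally. Suppose that `b n` and `b n'` are both nonzero for some `n ≠ n'`. A common invertible
factor turns `n` and `n'` into restrictions of monomials `x ≠ y` from `U₁`, and `b n • x` and `b n'
• y`, having disjoint supports over `Spec B`, glue to a section over `U₁`. This section is a single
monomial `c ∧ m` of `B[M₁]`. By connectedness `m` corresponds to one and the same exponent
everywhere over `Spec B` (`IsChartOver.exists_compare`), so `x = y`, a contradiction. -/

noncomputable section

namespace Blue

namespace Blueprint

/-! ### The semiring of a blueprint -/

section Plus

variable {A B C : Blueprint.{u}}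

theorem hom_mul (f : A ⟶ B) (a b : A) : f (a * b) = f a * f b := map_mul (Hom.toFun f) a b

theorem hom_one (f : A ⟶ B) : f 1 = 1 := map_one (Hom.toFun f)

theorem hom_zero (f : A ⟶ B) : f 0 = 0 := map_zero (Hom.toFun f)

theorem id_apply (a : A) : (𝟙 A : A ⟶ A) a = a := rfl

theorem plusMk_surjective (A : Blueprint.{u}) : Function.Surjective A.plusMk :=
  RingCon.mk'_surjective A.rel

theorem plusMk_single_one (a : A) : A.plusMk (MonoidAlgebra.single a 1) = A.toPlus a := rfl

theorem plusMk_single (a : A) (n : ℕ) : A.plusMk (MonoidAlgebra.single a n) = n • A.toPlus a := by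
  rw [← plusMk_single_one, ← map_nsmul, MonoidAlgebra.smul_single]
  simp

theorem plus_induction {p : A.Plus → Prop} (zero : p 0) (of : ∀ a : A, p (A.toPlus a))
    (add : ∀ x y, p x → p y → p (x + y)) (x : A.Plus) : p x := by
  obtain ⟨x, rfl⟩ := A.plusMk_surjective x
  induction x using MonoidAlgebra.induction_linear with
  | zero => rwa [map_zero]
  | add f g hf hg => rw [map_add]; exact add _ _ hf hg
  | single a n =>
    rw [plusMk_single]
    induction n with
    | zero => rwa [zero_smul]
    | succ n ih => rw [succ_nsmul]; exact add _ _ ih (of a)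

theorem plus_hom_ext {R : Type*} [Semiring R] {f g : A.Plus →+* R}
    (h : ∀ a, f (A.toPlus a) = g (A.toPlus a)) : f = g := by
  ext x
  induction x using plus_induction with
  | zero => simp
  | of a => exact h a
  | add x y hx hy => rw [map_add, map_add, hx, hy]

/-- A semiring homomorphism out of `A⁺` given by a multiplicative map preserving relations. -/
def plusLift {R : Type*} [CommSemiring R] (φ : A →* R)
    (h : ∀ x y, A.rel x y → MonoidAlgebra.lift ℕ R A φ x = MonoidAlgebra.lift ℕ R A φ y) :
    A.Plus →+* R :=
  A.rel.lift (MonoidAlgebra.lift ℕ R A φ : MonoidAlgebra ℕ A →+* R) fun x y hxy => h x y hxy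

theorem plusLift_plusMk {R : Type*} [CommSemiring R] (φ : A →* R)
    (h : ∀ x y, A.rel x y → MonoidAlgebra.lift ℕ R A φ x = MonoidAlgebra.lift ℕ R A φ y)
    (x : MonoidAlgebra ℕ A) : plusLift φ h (A.plusMk x) = MonoidAlgebra.lift ℕ R A φ x := rfl

theorem plusLift_toPlus {R : Type*} [CommSemiring R] (φ : A →* R)
    (h : ∀ x y, A.rel x y → MonoidAlgebra.lift ℕ R A φ x = MonoidAlgebra.lift ℕ R A φ y) (a : A) :
    plusLift φ h (A.toPlus a) = φ a :=
  MonoidAlgebra.lift_of (R := ℕ) φ a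

/-- The semiring homomorphism `A⁺ → B⁺` induced by a morphism of blueprints. -/
def plusMap (f : A ⟶ B) : A.Plus →+* B.Plus :=
  A.rel.lift (B.plusMk.comp (MonoidAlgebra.mapDomainRingHom ℕ (Hom.toFun f : A →* B)))
    fun _ _ h => (B.plusMk_eq_iff _ _).2 (Hom.map_rel f _ _ h)

theorem plusMap_plusMk (f : A ⟶ B) (x : MonoidAlgebra ℕ A) :
    plusMap f (A.plusMk x) =
      B.plusMk (MonoidAlgebra.mapDomainRingHom ℕ (Hom.toFun f : A →* B) x) := rfl

theorem plusMap_toPlus (f : A ⟶ B) (a : A) : plusMap f (A.toPlus a) = B.toPlus (f a) :=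
  (plusMap_plusMk f _).trans (congrArg B.plusMk (by
    simp only [MonoidAlgebra.of_apply, MonoidAlgebra.mapDomainRingHom_apply,
      MonoidAlgebra.mapDomain_single]
    rfl))

theorem plusMap_comp (f : A ⟶ B) (g : B ⟶ C) (x : A.Plus) :
    plusMap (f ≫ g) x = plusMap g (plusMap f x) := by
  refine RingHom.congr_fun (g := (plusMap g).comp (plusMap f)) (plus_hom_ext fun a => ?_) x
  simp only [RingHom.comp_apply, plusMap_toPlus]
  rfl

theorem plusMap_id (x : A.Plus) : plusMap (𝟙 A) x = x := by
  refine RingHom.congr_fun (g := RingHom.id _) (plus_hom_ext fun a => ?_) x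
  rw [plusMap_toPlus]
  rfl

theorem toPlus_injective (A : Blueprint.{u}) : Function.Injective A.toPlus :=
  fun a b => (A.toPlus_eq_iff a b).1

theorem injective_of_plusMap {f : A ⟶ B} (h : Function.Injective (plusMap f)) :
    Function.Injective (fun a => f a) := fun a b e =>
  A.toPlus_injective (h (by rw [plusMap_toPlus, plusMap_toPlus]; exact congrArg _ e))

theorem mapDomainRingHom_single {M N : Type*} [Monoid M] [Monoid N] (f : M →* N) (a : M) (n : ℕ) :
    MonoidAlgebra.mapDomainRingHom ℕ f (MonoidAlgebra.single a n) =
      MonoidAlgebra.single (f a) n := by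
  rw [MonoidAlgebra.mapDomainRingHom_apply, MonoidAlgebra.mapDomain_single]

/-- A morphism of blueprints from a multiplicative map which extends to the semirings. -/
def homOfPlus (φ : A →*₀ B) (Φ : A.Plus →+* B.Plus)
    (h : ∀ a, Φ (A.toPlus a) = B.toPlus (φ a)) : A ⟶ B :=
  Hom.mk φ fun x y hxy => by
    have key : B.plusMk.comp (MonoidAlgebra.mapDomainRingHom ℕ (φ : A →* B)) =
        Φ.comp A.plusMk := by
      refine MonoidAlgebra.ringHom_ext (fun n => ?_) (fun a => ?_)
      · have e : (MonoidAlgebra.single 1 n : MonoidAlgebra ℕ A) = (n : MonoidAlgebra ℕ A) :=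
          (MonoidAlgebra.natCast_def n).symm
        rw [e, map_natCast, map_natCast]
      · rw [RingHom.comp_apply, RingHom.comp_apply, mapDomainRingHom_single, plusMk_single_one,
          plusMk_single_one, h]
        rfl
    rw [← plusMk_eq_iff]
    have := congrArg Φ ((A.plusMk_eq_iff _ _).2 hxy)
    rwa [← RingHom.comp_apply, ← RingHom.comp_apply, ← key] at this

/-- Injectivity on `A⁺` does two things: it makes `f` injective, since `A` embeds into `A⁺`, and it
makes the inverse map respect relations. -/
theorem isIso_of_surjective {f : A ⟶ B} (hs : Function.Surjective fun a => f a)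
    (hp : Function.Injective (plusMap f)) : IsIso f := by
  let e : A ≃ B := Equiv.ofBijective (fun a => f a) ⟨injective_of_plusMap hp, hs⟩
  have he : ∀ b, f (e.symm b) = b := e.apply_symm_apply
  have hi := injective_of_plusMap hp
  let φ : B →*₀ A :=
    { toFun := e.symm
      map_zero' := hi (by simp only [he, hom_zero])
      map_one' := hi (by simp only [he, hom_one])
      map_mul' := fun a b => hi (by simp only [he, hom_mul]) }
  have hφ : ∀ b, f (φ b) = b := he
  let g : B ⟶ A := Hom.mk φ fun x y h => by
    rw [← plusMk_eq_iff]
    apply hp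
    rw [plusMap_plusMk, plusMap_plusMk, plusMk_eq_iff, ← RingHom.comp_apply,
      ← RingHom.comp_apply, ← MonoidAlgebra.mapDomainRingHom_comp]
    have : (Hom.toFun f : A →* B).comp (φ : B →* A) = MonoidHom.id B := MonoidHom.ext hφ
    rw [this, MonoidAlgebra.mapDomainRingHom_id]
    exact h
  exact ⟨g, hom_ext fun a => hi (hφ (f a)), hom_ext hφ⟩

theorem surjective_of_isIso (f : A ⟶ B) [IsIso f] : Function.Surjective fun a => f a :=
  fun b => ⟨inv f b, by
    change f (inv f b) = b
    rw [← comp_apply, IsIso.inv_hom_id, id_apply]⟩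

theorem plusMap_injective_of_isIso (f : A ⟶ B) [IsIso f] : Function.Injective (plusMap f) := by
  refine Function.LeftInverse.injective (g := plusMap (inv f)) fun x => ?_
  rw [← plusMap_comp, IsIso.hom_inv_id, plusMap_id]

/-- The classes in `A⁺` of formal sums of elements of `I`. -/
def formalSums (I : Set A) : AddSubmonoid A.Plus := AddSubmonoid.closure (A.toPlus '' I)

theorem toPlus_mem_formalSums {I : Set A} {a : A} (h : a ∈ I) : A.toPlus a ∈ formalSums I :=
  AddSubmonoid.subset_closure ⟨a, h, rfl⟩

theorem mem_formalSums_univ (x : A.Plus) : x ∈ formalSums (Set.univ : Set A) := by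
  induction x using plus_induction with
  | zero => exact zero_mem _
  | of a => exact toPlus_mem_formalSums trivial
  | add x y hx hy => exact add_mem hx hy

theorem mul_mem_formalSums {I : Set A} (hI : ∀ a b : A, b ∈ I → a * b ∈ I) (a : A) {x : A.Plus}
    (hx : x ∈ formalSums I) : A.toPlus a * x ∈ formalSums I := by
  induction hx using AddSubmonoid.closure_induction with
  | mem x hx =>
    obtain ⟨b, hb, rfl⟩ := hx
    rw [← map_mul]
    exact toPlus_mem_formalSums (hI a b hb)
  | zero => rw [mul_zero]; exact zero_mem _
  | add x y _ _ hx hy => rw [mul_add]; exact add_mem hx hy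

theorem plusMk_mem_formalSums {I : Set A} (x : MonoidAlgebra ℕ A)
    (hx : (↑x.coeff.support : Set A) ⊆ I) : A.plusMk x ∈ formalSums I := by
  have e : x = x.coeff.sum fun a n => MonoidAlgebra.single a n := by
    ext a
    classical
    simp +contextual [Finsupp.sum, MonoidAlgebra.coeff_sum, Finsupp.single_apply, eq_comm]
  rw [e, Finsupp.sum, map_sum]
  refine sum_mem fun a ha => ?_
  rw [plusMk_single]
  exact nsmul_mem (toPlus_mem_formalSums (hx ha)) _

theorem exists_of_mem_formalSums {I : Set A} {v : A.Plus} (hv : v ∈ formalSums I) :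
    ∃ x : MonoidAlgebra ℕ A, (↑x.coeff.support : Set A) ⊆ I ∧ A.plusMk x = v := by
  classical
  induction hv using AddSubmonoid.closure_induction with
  | mem x hx =>
    obtain ⟨b, hb, rfl⟩ := hx
    refine ⟨MonoidAlgebra.single b 1, fun a ha => ?_, rfl⟩
    have := Finsupp.support_single_subset ha
    rw [Finset.mem_singleton] at this
    rwa [this]
  | zero => exact ⟨0, by simp, map_zero _⟩
  | add x y _ _ hx hy =>
    obtain ⟨x, hx, rfl⟩ := hx
    obtain ⟨y, hy, rfl⟩ := hy
    refine ⟨x + y, fun a ha => ?_, map_add _ _ _⟩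
    have := Finsupp.support_add ha
    rw [Finset.mem_union] at this
    exact this.elim (fun h => hx h) (fun h => hy h)

/-- The additive condition on ideals, read in the semiring `A⁺`, where denominators can be cleared
by algebra. -/
theorem Spectrum.mem_of_plus (P : Spectrum A) {x y : A.Plus} {c : A}
    (hx : x ∈ formalSums P.ideal) (hy : y ∈ formalSums P.ideal) (h : x + A.toPlus c = y) :
    c ∈ P.ideal := by
  obtain ⟨x, hx', rfl⟩ := exists_of_mem_formalSums hx
  obtain ⟨y, hy', rfl⟩ := exists_of_mem_formalSums hy
  refine P.mem_of_rel x y c hx' hy' ?_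
  rw [← plusMk_eq_iff, map_add]
  exact h

theorem Spectrum.zero_mem (P : Spectrum A) : (0 : A) ∈ P.ideal :=
  P.mem_of_plus (AddSubmonoid.zero_mem _) (AddSubmonoid.zero_mem _) (by rw [toPlus_zero, add_zero])

theorem Spectrum.mul_notMem_iff (P : Spectrum A) {a b : A} :
    a * b ∉ P.ideal ↔ a ∉ P.ideal ∧ b ∉ P.ideal :=
  ⟨fun h => ⟨fun ha => h (mul_comm a b ▸ P.mul_mem b a ha), fun hb => h (P.mul_mem a b hb)⟩,
    fun ⟨ha, hb⟩ h => (P.mem_or_mem a b h).elim ha hb⟩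

/-- Construction of prime ideals in terms of the semiring `A⁺`. -/
def Spectrum.ofPlus (I : Set A) (mul_mem : ∀ a b : A, b ∈ I → a * b ∈ I)
    (mem : ∀ (x y : A.Plus) (c : A), x ∈ formalSums I → y ∈ formalSums I →
      x + A.toPlus c = y → c ∈ I)
    (one_notMem : (1 : A) ∉ I) (mem_or_mem : ∀ a b : A, a * b ∈ I → a ∈ I ∨ b ∈ I) :
    Spectrum A where
  ideal := I
  mul_mem := mul_mem
  mem_of_rel x y c hx hy h := mem (A.plusMk x) (A.plusMk y) c (plusMk_mem_formalSums x hx)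
    (plusMk_mem_formalSums y hy) (by
      rw [← plusMk_single_one, ← map_add]
      exact (A.plusMk_eq_iff _ _).2 h)
  one_notMem := one_notMem
  mem_or_mem := mem_or_mem

/-- The inverse image of a prime ideal. -/
def Spectrum.comap (f : A ⟶ B) (P : Spectrum B) : Spectrum A :=
  Spectrum.ofPlus {a | f a ∈ P.ideal}
    (fun a b hb => by
      simp only [Set.mem_ofPred_eq, hom_mul] at *
      exact P.mul_mem _ _ hb)
    (fun x y c hx hy h => by
      have aux : ∀ x, x ∈ formalSums {a | f a ∈ P.ideal} → plusMap f x ∈ formalSums P.ideal := by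
        intro x hx
        induction hx using AddSubmonoid.closure_induction with
        | mem x hx =>
          obtain ⟨b, hb, rfl⟩ := hx
          rw [plusMap_toPlus]
          exact toPlus_mem_formalSums hb
        | zero => rw [map_zero]; exact AddSubmonoid.zero_mem _
        | add x y _ _ hx hy => rw [map_add]; exact add_mem hx hy
      refine P.mem_of_plus (aux x hx) (aux y hy) ?_
      rw [← h, map_add, plusMap_toPlus])
    (by simp only [Set.mem_ofPred_eq, hom_one]; exact P.one_notMem)
    (fun a b h => by
      simp only [Set.mem_ofPred_eq, hom_mul] at *
      exact P.mem_or_mem _ _ h)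

end Plus

/-! ### Localizations -/

section Localization

variable (C : Blueprint.{u}) (S : Submonoid C)

/-- The map `a / s ↦ a / s` from `S⁻¹C` to the localization of `C⁺`. -/
def locHom : C.localization S →* Localization (S.map C.toPlus) := locToPlus C S

/-- A semiring carries only one `ℕ`-algebra structure, so the two that occur in `localization_rel`
agree. -/
theorem lift_nat_algebra {R M : Type*} [Semiring R] [Monoid M] (i : Algebra ℕ R) (φ : M →* R)
    (x : MonoidAlgebra ℕ M) :
    @MonoidAlgebra.lift ℕ R M _ _ i _ φ x =
      @MonoidAlgebra.lift ℕ R M _ _ Semiring.toNatAlgebra _ φ x := by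
  cases Subsingleton.elim i Semiring.toNatAlgebra
  rfl

theorem localization_rel (x y : MonoidAlgebra ℕ (C.localization S)) :
    (C.localization S).rel x y ↔
      @MonoidAlgebra.lift ℕ (Localization (S.map C.toPlus)) (C.localization S) _ _
        Semiring.toNatAlgebra _ (locHom C S) x =
      @MonoidAlgebra.lift ℕ (Localization (S.map C.toPlus)) (C.localization S) _ _
        Semiring.toNatAlgebra _ (locHom C S) y := by
  have e := fun x => lift_nat_algebra
    (inferInstanceAs (Algebra ℕ (Localization (S.map C.toPlus)))) (locHom C S) x
  exact ⟨fun h => (e x).symm.trans (Eq.trans h (e y)), fun h => (e x).trans (h.trans (e y).symm)⟩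

/-- The injection of `(S⁻¹C)⁺` into the localization of `C⁺`. -/
def locPlus : (C.localization S).Plus →+* Localization (S.map C.toPlus) :=
  plusLift (locHom C S) fun x y h => (localization_rel C S x y).1 h

theorem locPlus_injective : Function.Injective (locPlus C S) := by
  intro x y h
  obtain ⟨x, rfl⟩ := plusMk_surjective _ x
  obtain ⟨y, rfl⟩ := plusMk_surjective _ y
  rw [locPlus, plusLift_plusMk, plusLift_plusMk] at h
  exact (plusMk_eq_iff (C.localization S) _ _).2 ((localization_rel C S x y).2 h)

theorem toLocalization_apply (c : C) : C.toLocalization S c = Localization.mk c 1 := rfl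

theorem locPlus_toPlus (z : C.localization S) :
    locPlus C S ((C.localization S).toPlus z) = locToPlus C S z :=
  plusLift_toPlus (locHom C S) _ z

theorem locPlus_plusMap (x : C.Plus) :
    locPlus C S (plusMap (C.toLocalization S) x) = algebraMap _ _ x := by
  refine RingHom.congr_fun (f := (locPlus C S).comp (plusMap (C.toLocalization S)))
    (plus_hom_ext fun a => ?_) x
  rw [RingHom.comp_apply, plusMap_toPlus, locPlus_toPlus, toLocalization_apply, locToPlus_mk,
    ← Localization.mk_one_eq_algebraMap]
  exact congrArg₂ Localization.mk rfl (Subtype.ext (map_one C.toPlus))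

/-- `(S⁻¹C)⁺` embeds into `S⁻¹(C⁺)`, and equality in the latter is equality in `C⁺` after
multiplication by one denominator. -/
theorem plusMap_toLocalization_eq_iff (x y : C.Plus) :
    plusMap (C.toLocalization S) x = plusMap (C.toLocalization S) y ↔
      ∃ s ∈ S, C.toPlus s * x = C.toPlus s * y := by
  rw [← (locPlus_injective C S).eq_iff, locPlus_plusMap, locPlus_plusMap,
    IsLocalization.eq_iff_exists (S.map C.toPlus)]
  constructor
  · rintro ⟨⟨_, s, hs, rfl⟩, h⟩
    exact ⟨s, hs, h⟩
  · rintro ⟨s, hs, h⟩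
    exact ⟨⟨_, s, hs, rfl⟩, h⟩

theorem isUnit_toLocalization {s : C} (hs : s ∈ S) : IsUnit (C.toLocalization S s) :=
  IsUnit.of_mul_eq_one (Localization.mk 1 ⟨s, hs⟩ : Localization S) (by
    refine (Localization.mk_mul s 1 1 ⟨s, hs⟩).trans ?_
    rw [mul_one, one_mul]
    exact Localization.mk_self (⟨s, hs⟩ : S))

theorem toLocalization_mul_mk (a : C) (s : S) :
    C.toLocalization S s * (show C.localization S from Localization.mk a s) =
      C.toLocalization S a := by
  refine (Localization.mk_mul s.1 a 1 s).trans ?_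
  rw [toLocalization_apply, one_mul, Localization.mk_eq_mk_iff, Localization.r_iff_exists]
  exact ⟨1, by simp⟩

theorem exists_toLocalization (z : C.localization S) :
    ∃ a, ∃ s ∈ S, C.toLocalization S s * z = C.toLocalization S a := by
  induction z using Localization.induction_on with | H z =>
  exact ⟨z.1, z.2, z.2.2, toLocalization_mul_mk C S z.1 z.2⟩

theorem exists_plusMap_toLocalization (x : (C.localization S).Plus) :
    ∃ (y : C.Plus), ∃ s ∈ S, Blueprint.toPlus _ (C.toLocalization S s) * x =
      plusMap (C.toLocalization S) y := by
  induction x using plus_induction with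
  | zero => exact ⟨0, 1, S.one_mem, by simp⟩
  | of z =>
    obtain ⟨a, s, hs, h⟩ := exists_toLocalization C S z
    exact ⟨C.toPlus a, s, hs, by rw [← map_mul, h, plusMap_toPlus]⟩
  | add x y hx hy =>
    obtain ⟨x', s, hs, hx⟩ := hx
    obtain ⟨y', t, ht, hy⟩ := hy
    refine ⟨C.toPlus t * x' + C.toPlus s * y', s * t, S.mul_mem hs ht, ?_⟩
    rw [hom_mul, map_mul, map_add, map_mul, map_mul, plusMap_toPlus, plusMap_toPlus, ← hx, ← hy]
    ring

variable {C} {D : Blueprint.{u}}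

/-- The universal property of the localization. -/
def locLift (φ : C ⟶ D) (h : ∀ s ∈ S, IsUnit (φ s)) : C.localization S ⟶ D :=
  have hφ : ∀ s : S, IsUnit ((Hom.toFun φ : C →* D) s) := fun s => h s s.2
  homOfPlus
    { toFun := (Localization.monoidOf S).lift hφ
      map_zero' := by
        have : (0 : Localization S) = (Localization.monoidOf S) 0 :=
          ((Localization.mk_zero (1 : S)).symm.trans (Localization.mk_one_eq_monoidOf_mk _))
        refine (congrArg _ this).trans ?_
        rw [Submonoid.LocalizationMap.lift_eq]
        exact hom_zero φ
      map_one' := map_one ((Localization.monoidOf S).lift hφ)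
      map_mul' := fun a b => map_mul ((Localization.monoidOf S).lift hφ) a b }
    ((IsLocalization.lift (M := S.map C.toPlus) (g := plusMap φ) (by
      rintro ⟨_, s, hs, rfl⟩
      rw [plusMap_toPlus]
      exact (h s hs).map D.toPlus)).comp (locPlus C S))
    (by
      intro z
      rw [RingHom.comp_apply, locPlus_toPlus]
      induction z using Localization.induction_on with | H z =>
      rw [locToPlus_mk, Localization.mk_eq_mk'_apply, IsLocalization.lift_mk'_spec]
      simp only [plusMap_toPlus]
      rw [← map_mul]
      refine congrArg D.toPlus ?_
      exact ((Localization.monoidOf S).lift_mk'_spec hφ z.1 _ z.2).1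
        (congrArg _ (Localization.mk_eq_monoidOf_mk'_apply z.1 z.2).symm))

theorem locLift_toLocalization (φ : C ⟶ D) (h : ∀ s ∈ S, IsUnit (φ s)) (c : C) :
    locLift S φ h (C.toLocalization S c) = φ c := by
  refine (congrArg _ (Localization.mk_one_eq_monoidOf_mk c)).trans ?_
  exact Submonoid.LocalizationMap.lift_eq _ _ _

end Localization

/-! ### Monoid blueprints -/

section MonoidBlueprint

variable {B C D : Blueprint.{u}} {M : Type u} [CommMonoidWithZero M]

/-- The element `a ∧ m` of the monoid blueprint `B[M]`. -/
def monomial (a : B) (m : M) : monoidBlueprint B M := smashMk B M (a, m)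

theorem exists_monomial (x : monoidBlueprint B M) : ∃ (a : B) (m : M), x = monomial a m := by
  obtain ⟨⟨a, m⟩, rfl⟩ := smashMk_surjective B M x
  exact ⟨a, m, rfl⟩

theorem monomial_mul (a b : B) (m n : M) :
    monomial (a * b) (m * n) = monomial a m * monomial b n :=
  map_mul (smashMk B M) (a, m) (b, n)

theorem monomial_one : monomial (1 : B) (1 : M) = 1 := rfl

theorem monomial_eq_iff {a b : B} {m n : M} :
    monomial a m = monomial b n ↔
      (a = b ∧ m = n) ∨ ((a = 0 ∨ m = 0) ∧ (b = 0 ∨ n = 0)) := by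
  rw [← Prod.mk.injEq]
  exact smashMk_eq_iff B M _ _

theorem monomial_zero_left (m : M) : monomial (0 : B) m = 0 :=
  (smashMk_eq_iff B M _ _).2 (by simp)

theorem monomial_zero_right (a : B) : monomial a (0 : M) = 0 :=
  (smashMk_eq_iff B M _ _).2 (by simp)

theorem monomial_eq_zero_iff {a : B} {m : M} : monomial a m = 0 ↔ a = 0 ∨ m = 0 := by
  rw [← monomial_zero_right (0 : B), monomial_eq_iff]
  grind

theorem toMonoidBlueprint_apply (a : B) : toMonoidBlueprint B M a = monomial a 1 := rfl

theorem monomial_eq (a : B) (m : M) :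
    monomial a m = toMonoidBlueprint B M a * monomial 1 m := by
  rw [toMonoidBlueprint_apply, ← monomial_mul, mul_one, one_mul]

/-- The map `M → B[M]`, `m ↦ 1 ∧ m`. -/
def monomialHom (B : Blueprint.{u}) (M : Type u) [CommMonoidWithZero M] :
    M →*₀ monoidBlueprint B M where
  toFun m := monomial 1 m
  map_zero' := monomial_zero_right 1
  map_one' := rfl
  map_mul' m n := by rw [← monomial_mul, mul_one]

theorem monomialHom_apply (m : M) : monomialHom B M m = monomial 1 m := rfl

/-- The universal property of `B[M]`. -/
def monoidLift (φ : B ⟶ D) (ψ : M →*₀ D) : monoidBlueprint B M ⟶ D :=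
  let χ : Smash B M →*₀ D :=
    { toFun := (smashCon B M).lift
        { toFun := fun x => φ x.1 * ψ x.2
          map_one' := by simp [hom_one]
          map_mul' := fun x y => by
            simp only [Prod.fst_mul, Prod.snd_mul, map_mul]
            exact mul_mul_mul_comm _ _ _ _ }
        (by
          rintro ⟨a, m⟩ ⟨b, n⟩ h
          rcases h with h | ⟨h, h'⟩
          · rw [h]; exact rfl
          · have aux : ∀ (a : B) (m : M), a = 0 ∨ m = 0 → φ a * ψ m = 0 := by
              rintro a m (rfl | rfl)
              · rw [hom_zero, zero_mul]
              · rw [map_zero, mul_zero]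
            exact (aux a m h).trans (aux b n h').symm)
      map_zero' := by
        change φ 0 * ψ 0 = 0
        rw [map_zero, zero_mul]
      map_one' := map_one _
      map_mul' := map_mul _ }
  have hχ : (χ : Smash B M →* D).comp (smashInl B M : B →* Smash B M) =
      (Hom.toFun φ : B →* D) := MonoidHom.ext fun a => by
    change φ a * ψ 1 = φ a
    rw [map_one, mul_one]
  have key : smashRel B M ≤ RingCon.ker
      (D.plusMk.comp (MonoidAlgebra.mapDomainRingHom ℕ (χ : Smash B M →* D))) := by
    refine RingCon.ringConGen_le.2 ?_
    rintro _ _ ⟨v, w, hvw, rfl, rfl⟩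
    rw [RingCon.ker_apply, RingHom.comp_apply, RingHom.comp_apply, plusMk_eq_iff,
      ← RingHom.comp_apply, ← RingHom.comp_apply, ← MonoidAlgebra.mapDomainRingHom_comp, hχ]
    exact Hom.map_rel φ v w hvw
  Hom.mk χ fun x y h => (D.plusMk_eq_iff _ _).1 (key h)

theorem monoidLift_monomial (φ : B ⟶ D) (ψ : M →*₀ D) (a : B) (m : M) :
    monoidLift φ ψ (monomial a m) = φ a * ψ m := rfl

theorem monoidBlueprint_hom_ext {f g : monoidBlueprint B M ⟶ D}
    (h : ∀ a, f (toMonoidBlueprint B M a) = g (toMonoidBlueprint B M a))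
    (h' : ∀ m : M, f (monomial 1 m) = g (monomial 1 m)) : f = g := by
  refine hom_ext fun x => ?_
  obtain ⟨a, m, rfl⟩ := exists_monomial x
  rw [monomial_eq, hom_mul, hom_mul, h, h']

theorem toMonoidBlueprint_monoidLift (φ : B ⟶ D) (ψ : M →*₀ D) :
    toMonoidBlueprint B M ≫ monoidLift φ ψ = φ := by
  refine hom_ext fun a => ?_
  rw [comp_apply, toMonoidBlueprint_apply, monoidLift_monomial, map_one, mul_one]

/-! #### Coefficients -/

/-- The map `B[M]⁺ → B⁺[M]`, up to coefficients at `0`. -/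
def plusToContract (B : Blueprint.{u}) (M : Type u) [CommMonoidWithZero M] :
    (monoidBlueprint B M).Plus →+* Contract B M :=
  plusLift (A := monoidBlueprint B M) (smashToContract B M) fun _ _ h => smashRel_le B M h

theorem plusToContract_toPlus (a : B) (m : M) :
    plusToContract B M ((monoidBlueprint B M).toPlus (monomial a m)) =
      contractMk B M (MonoidAlgebra.single m (B.toPlus a)) :=
  (plusLift_toPlus (A := monoidBlueprint B M) _ _ _).trans (smashToContract_mk B M a m)

/-- The coefficient at `n ≠ 0`. -/
def contractCoeff (n : M) (hn : n ≠ 0) : Contract B M →+ B.Plus where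
  toFun := Quotient.lift (fun x : MonoidAlgebra B.Plus M => x.coeff n) fun _ _ h => h n hn
  map_zero' := rfl
  map_add' x y := by
    obtain ⟨x, rfl⟩ := RingCon.mk'_surjective (contractCon B M) x
    obtain ⟨y, rfl⟩ := RingCon.mk'_surjective (contractCon B M) y
    exact rfl

theorem contractCoeff_mk (n : M) (hn : n ≠ 0) (x : MonoidAlgebra B.Plus M) :
    contractCoeff n hn (contractMk B M x) = x.coeff n := rfl

/-- The coefficient of an element of `B[M]⁺` at `n ≠ 0`. -/
def plusCoeff (n : M) (hn : n ≠ 0) : (monoidBlueprint B M).Plus →+ B.Plus :=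
  (contractCoeff n hn).comp (plusToContract B M : (monoidBlueprint B M).Plus →+ Contract B M)

theorem plusCoeff_apply (n : M) (hn : n ≠ 0) (x : (monoidBlueprint B M).Plus) :
    plusCoeff n hn x = contractCoeff n hn (plusToContract B M x) := rfl

open Classical in
theorem plusCoeff_monomial (n : M) (hn : n ≠ 0) (a : B) (m : M) :
    plusCoeff n hn ((monoidBlueprint B M).toPlus (monomial a m)) =
      if m = n then B.toPlus a else 0 := by
  rw [plusCoeff_apply, plusToContract_toPlus, contractCoeff_mk, MonoidAlgebra.coeff_single,
    Finsupp.single_apply]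

/-- Multiplication by the unit `m` permutes the exponents, so only the term at `n` contributes at `m
* n`. -/
theorem plusCoeff_mul (n : M) (a : B) (m : M) (hm : IsUnit m) (h : m * n ≠ 0) (hn : n ≠ 0)
    (x : (monoidBlueprint B M).Plus) :
    plusCoeff (m * n) h ((monoidBlueprint B M).toPlus (monomial a m) * x) =
      B.toPlus a * plusCoeff n hn x := by
  classical
  induction x using plus_induction with
  | zero => simp
  | of z =>
    obtain ⟨b, k, rfl⟩ := exists_monomial z
    rw [← map_mul, ← monomial_mul, plusCoeff_monomial, plusCoeff_monomial, map_mul, mul_ite,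
      mul_zero]
    simp only [hm.mul_right_inj]
  | add x y hx hy => rw [mul_add, map_add, map_add, hx, hy, mul_add]

/-- The map `B⁺[M] → B[M]⁺`. -/
def plusOfCoeffs (B : Blueprint.{u}) (M : Type u) [CommMonoidWithZero M] :
    MonoidAlgebra B.Plus M →+* (monoidBlueprint B M).Plus :=
  MonoidAlgebra.liftNCRingHom (plusMap (toMonoidBlueprint B M))
    ((monoidBlueprint B M).toPlus.comp (monomialHom B M : M →* monoidBlueprint B M))
    fun _ _ => mul_comm _ _

theorem plusOfCoeffs_single (m : M) (x : B.Plus) :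
    plusOfCoeffs B M (MonoidAlgebra.single m x) =
      plusMap (toMonoidBlueprint B M) x * (monoidBlueprint B M).toPlus (monomial 1 m) :=
  MonoidAlgebra.liftNC_single _ _ _ _

/-- The coefficient at the exponent `0` is lost because `a ∧ 0 = 0`. -/
theorem plusOfCoeffs_congr {x y : MonoidAlgebra B.Plus M}
    (h : ∀ m : M, m ≠ 0 → x.coeff m = y.coeff m) : plusOfCoeffs B M x = plusOfCoeffs B M y := by
  classical
  have e : ∀ x : MonoidAlgebra B.Plus M, x = x.coeff.sum fun a n => MonoidAlgebra.single a n := by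
    intro x
    ext a
    simp +contextual [Finsupp.sum, MonoidAlgebra.coeff_sum, Finsupp.single_apply, eq_comm]
  have h0 : ∀ m : M, plusOfCoeffs B M (MonoidAlgebra.single m 0) = 0 := by simp
  rw [e x, e y, Finsupp.sum_of_support_subset _ (s := x.coeff.support ∪ y.coeff.support)
      Finset.subset_union_left _ (by simp),
    Finsupp.sum_of_support_subset _ (s := x.coeff.support ∪ y.coeff.support)
      Finset.subset_union_right _ (by simp), map_sum, map_sum]
  refine Finset.sum_congr rfl fun m _ => ?_
  by_cases hm : m = 0
  · rw [plusOfCoeffs_single, plusOfCoeffs_single, hm, monomial_zero_right, toPlus_zero, mul_zero,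
      mul_zero]
  · rw [h m hm]

theorem plusToContract_plusOfCoeffs (x : MonoidAlgebra B.Plus M) :
    plusToContract B M (plusOfCoeffs B M x) = contractMk B M x := by
  induction x using MonoidAlgebra.induction_linear with
  | zero => simp
  | add f g hf hg => simp [hf, hg]
  | single m b =>
    induction b using plus_induction with
    | zero => simp
    | of b =>
      rw [plusOfCoeffs_single, plusMap_toPlus, ← map_mul, ← monomial_eq, plusToContract_toPlus]
    | add x y hx hy => rw [MonoidAlgebra.single_add, map_add, map_add, map_add, hx, hy]

theorem plusOfCoeffs_surjective : Function.Surjective (plusOfCoeffs B M) := by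
  intro x
  induction x using plus_induction with
  | zero => exact ⟨0, map_zero _⟩
  | of z =>
    obtain ⟨b, k, rfl⟩ := exists_monomial z
    exact ⟨MonoidAlgebra.single k (B.toPlus b), by
      rw [plusOfCoeffs_single, plusMap_toPlus, ← map_mul, ← monomial_eq]⟩
  | add x y hx hy =>
    obtain ⟨x, rfl⟩ := hx
    obtain ⟨y, rfl⟩ := hy
    exact ⟨x + y, map_add _ _ _⟩

/-- `B[M]⁺` is `B⁺[M]` modulo the coefficient at `0`: `plusOfCoeffs` is onto, and `plusToContract`
recovers all other coefficients. -/
theorem monoidBlueprint_plus_ext {x y : (monoidBlueprint B M).Plus}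
    (h : ∀ (n : M) (hn : n ≠ 0), plusCoeff n hn x = plusCoeff n hn y) : x = y := by
  obtain ⟨x, rfl⟩ := plusOfCoeffs_surjective x
  obtain ⟨y, rfl⟩ := plusOfCoeffs_surjective y
  refine plusOfCoeffs_congr fun n hn => ?_
  have := h n hn
  rwa [plusCoeff_apply, plusCoeff_apply, plusToContract_plusOfCoeffs,
    plusToContract_plusOfCoeffs] at this

/-- The coefficient at `1` is a retraction; it exists because `1 ≠ 0` in `M`. -/
theorem plusMap_toMonoidBlueprint_injective [Nontrivial M] :
    Function.Injective (plusMap (toMonoidBlueprint B M)) := by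
  intro x y h
  have key : ∀ x : B.Plus,
      plusCoeff (1 : M) one_ne_zero (plusMap (toMonoidBlueprint B M) x) = x := by
    intro x
    induction x using plus_induction with
    | zero => simp
    | of b => rw [plusMap_toPlus, toMonoidBlueprint_apply, plusCoeff_monomial, if_pos rfl]
    | add x y hx hy => rw [map_add, map_add, hx, hy]
  rw [← key x, h, key]

/-! #### Prime ideals -/

/-- The prime ideal of `B[M]` given by a prime ideal of `B` and the complement `T` of a prime
ideal of `M`. -/
def smashPrime (P : Spectrum B) (T : Submonoid M) (h0 : (0 : M) ∉ T)
    (hT : ∀ m n : M, m * n ∈ T → m ∈ T ∧ n ∈ T) : Spectrum (monoidBlueprint B M) :=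
  -- An element has several representations `a ∧ m` only if it is zero, and each of those satisfies
  -- the condition because `0 ∈ P` and `0 ∉ T`.
  have hmem : ∀ (a : B) (m : M), monomial a m ∈
      {x | ∀ (a : B) (m : M), x = monomial a m → a ∈ P.ideal ∨ m ∉ T} ↔ (a ∈ P.ideal ∨ m ∉ T) := by
    intro a m
    refine ⟨fun h => h a m rfl, fun h b n e => ?_⟩
    rcases monomial_eq_iff.1 e with ⟨rfl, rfl⟩ | ⟨-, rfl | rfl⟩
    · exact h
    · exact .inl P.zero_mem
    · exact .inr h0
  Spectrum.ofPlus {x | ∀ (a : B) (m : M), x = monomial a m → a ∈ P.ideal ∨ m ∉ T}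
    (fun x y hy => by
      obtain ⟨a, m, rfl⟩ := exists_monomial x
      obtain ⟨b, n, rfl⟩ := exists_monomial y
      rw [← monomial_mul, hmem]
      rw [hmem] at hy
      exact hy.imp (P.mul_mem _ _) fun h h' => h (hT _ _ h').2)
    (fun x y c hx hy h => by
      classical
      -- At an exponent in `T`, a sum of elements of the ideal has its coefficient in the sums of
      -- elements of `P`. This reduces the additive condition to that of `P`.
      have aux : ∀ (n : M) (hn : n ≠ 0), n ∈ T → ∀ x, x ∈ formalSums
          {x : monoidBlueprint B M | ∀ (a : B) (m : M), x = monomial a m → a ∈ P.ideal ∨ m ∉ T} →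
          plusCoeff n hn x ∈ formalSums P.ideal := by
        intro n hn hnT x hx
        induction hx using AddSubmonoid.closure_induction with
        | mem x hx =>
          obtain ⟨z, hz, rfl⟩ := hx
          obtain ⟨a, m, rfl⟩ := exists_monomial z
          rw [plusCoeff_monomial]
          split_ifs with e
          · subst e
            exact toPlus_mem_formalSums (((hmem a m).1 hz).resolve_right fun h => h hnT)
          · exact AddSubmonoid.zero_mem _
        | zero => rw [map_zero]; exact AddSubmonoid.zero_mem _
        | add x y _ _ hx hy => rw [map_add]; exact add_mem hx hy
      obtain ⟨a, m, rfl⟩ := exists_monomial c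
      rw [hmem]
      by_cases hm : m ∈ T
      · have hm0 : m ≠ 0 := fun e => h0 (e ▸ hm)
        left
        refine P.mem_of_plus (aux m hm0 hm x hx) (aux m hm0 hm y hy) ?_
        rw [← h, map_add, plusCoeff_monomial, if_pos rfl]
      · exact .inr hm)
    (by
      rw [← monomial_one, hmem]
      exact fun h => h.elim P.one_notMem fun h => h T.one_mem)
    (fun x y h => by
      obtain ⟨a, m, rfl⟩ := exists_monomial x
      obtain ⟨b, n, rfl⟩ := exists_monomial y
      rw [← monomial_mul, hmem] at h
      rw [hmem, hmem]
      by_contra! hc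
      exact h.elim (fun h => (P.mem_or_mem a b h).elim hc.1.1 hc.2.1)
        fun h => h (T.mul_mem hc.1.2 hc.2.2))

theorem monomial_notMem_smashPrime (P : Spectrum B) (T : Submonoid M) (h0 : (0 : M) ∉ T)
    (hT : ∀ m n : M, m * n ∈ T → m ∈ T ∧ n ∈ T) (a : B) (m : M) :
    monomial a m ∉ (smashPrime P T h0 hT).ideal ↔ a ∉ P.ideal ∧ m ∈ T := by
  change ¬ (∀ (b : B) (n : M), monomial a m = monomial b n → b ∈ P.ideal ∨ n ∉ T) ↔ _
  constructor
  · intro h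
    push Not at h
    obtain ⟨b, n, e, h, h'⟩ := h
    rcases monomial_eq_iff.1 e with ⟨rfl, rfl⟩ | ⟨-, rfl | rfl⟩
    · exact ⟨h, h'⟩
    · exact absurd P.zero_mem h
    · exact absurd h' h0
  · rintro ⟨h, h'⟩ H
    exact (H a m rfl).elim h fun h => h h'

end MonoidBlueprint

/-! ### Blueprints with trivial relations -/

section Trivial

variable {D : Blueprint.{u}}

/-- All relations of the blueprint follow from `0` being the empty sum. -/
def HasTrivialRel (D : Blueprint.{u}) : Prop :=
  ∀ x y : MonoidAlgebra ℕ D, D.rel x y →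
    ∃ k l : ℕ, x + MonoidAlgebra.single 0 k = y + MonoidAlgebra.single 0 l

theorem mul_single_zero {A : Type*} [CommMonoidWithZero A] (x : MonoidAlgebra ℕ A) (k : ℕ) :
    ∃ l : ℕ, x * MonoidAlgebra.single 0 k = MonoidAlgebra.single 0 l := by
  induction x using MonoidAlgebra.induction_linear with
  | zero => exact ⟨0, by simp⟩
  | add f g hf hg =>
    obtain ⟨a, ha⟩ := hf
    obtain ⟨b, hb⟩ := hg
    exact ⟨a + b, by rw [add_mul, ha, hb, MonoidAlgebra.single_add]⟩
  | single a n => exact ⟨n * k, by rw [MonoidAlgebra.single_mul_single, mul_zero]⟩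

/-- The congruence generated by `0` being the empty sum. -/
def trivialCon (A : Type*) [CommMonoidWithZero A] : RingCon (MonoidAlgebra ℕ A) where
  r x y := ∃ k l : ℕ, x + MonoidAlgebra.single 0 k = y + MonoidAlgebra.single 0 l
  iseqv := ⟨fun _ => ⟨0, 0, rfl⟩, fun ⟨k, l, h⟩ => ⟨l, k, h.symm⟩,
    fun {x y z} ⟨k, l, h⟩ ⟨k', l', h'⟩ =>
    ⟨k + k', l + l', by
      rw [MonoidAlgebra.single_add, MonoidAlgebra.single_add, ← add_assoc, h, add_right_comm, h']
      abel⟩⟩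
  add' := by
    rintro w x y z ⟨k, l, h⟩ ⟨k', l', h'⟩
    refine ⟨k + k', l + l', ?_⟩
    rw [MonoidAlgebra.single_add, MonoidAlgebra.single_add, add_add_add_comm, h, h']
    abel
  mul' := by
    rintro w x y z ⟨k, l, h⟩ ⟨k', l', h'⟩
    obtain ⟨a, ha⟩ := mul_single_zero w k'
    obtain ⟨b, hb⟩ := mul_single_zero (y + MonoidAlgebra.single 0 k') k
    obtain ⟨c, hc⟩ := mul_single_zero x l'
    obtain ⟨d, hd⟩ := mul_single_zero (z + MonoidAlgebra.single 0 l') l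
    refine ⟨a + b, c + d, ?_⟩
    -- Multiplying the two padded equations adds only multiples of `0` on either side, as any
    -- product with a multiple of `0` is again one.
    have := congrArg₂ (· * ·) h h'
    simp only [add_mul, mul_add] at this hb hd
    rw [MonoidAlgebra.single_add, MonoidAlgebra.single_add, ← ha, ← hb, ← hc, ← hd]
    exact Eq.trans (by ring) (this.trans (by ring))

theorem exists_add_single_zero (x y : MonoidAlgebra ℕ (WithZero PUnit.{u + 1}))
    (h : MonoidAlgebra.lift ℕ ℕ (WithZero PUnit.{u + 1})
        (WithZero.lift' (1 : PUnit.{u + 1} →* ℕ) : WithZero PUnit.{u + 1} →* ℕ) x =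
      MonoidAlgebra.lift ℕ ℕ (WithZero PUnit.{u + 1})
        (WithZero.lift' (1 : PUnit.{u + 1} →* ℕ) : WithZero PUnit.{u + 1} →* ℕ) y) :
    ∃ k l : ℕ, x + MonoidAlgebra.single 0 k = y + MonoidAlgebra.single 0 l := by
  have key : ∀ x : MonoidAlgebra ℕ (WithZero PUnit.{u + 1}),
      ∃ k l, x = MonoidAlgebra.single 0 k + MonoidAlgebra.single 1 l := by
    intro x
    induction x using MonoidAlgebra.induction_linear with
    | zero => exact ⟨0, 0, by simp⟩
    | add f g hf hg =>
      obtain ⟨a, b, rfl⟩ := hf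
      obtain ⟨c, d, rfl⟩ := hg
      exact ⟨a + c, b + d, by
        rw [MonoidAlgebra.single_add, MonoidAlgebra.single_add, add_add_add_comm]⟩
    | single a n =>
      cases a with
      | zero => exact ⟨n, 0, by simp⟩
      | coe a => exact ⟨0, n, by simp; rfl⟩
  obtain ⟨a, b, rfl⟩ := key x
  obtain ⟨c, d, rfl⟩ := key y
  have e : b = d := by simpa using h
  -- The left sum contains `0` exactly `a` times and the right sum `c` times; exchanging these
  -- numbers balances them.
  refine ⟨c, a, ?_⟩
  rw [e]
  abel

theorem hasTrivialRel_F1 : HasTrivialRel F1.{u} := exists_add_single_zero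

/-- The relations of `B[M]` are generated by those of `B`, and `trivialCon` is a congruence that
contains these generators. -/
theorem hasTrivialRel_monoidBlueprint {B : Blueprint.{u}} (hB : B.HasTrivialRel) (M : Type u)
    [CommMonoidWithZero M] : (monoidBlueprint B M).HasTrivialRel := by
  have key : smashRel B M ≤ trivialCon (Smash B M) := by
    refine RingCon.ringConGen_le.2 ?_
    rintro _ _ ⟨v, w, hvw, rfl, rfl⟩
    obtain ⟨k, l, h⟩ := hB v w hvw
    refine ⟨k, l, ?_⟩
    have := congrArg (MonoidAlgebra.mapDomainRingHom ℕ (smashInl B M : B →* Smash B M)) h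
    rw [map_add, map_add, mapDomainRingHom_single, mapDomainRingHom_single] at this
    rwa [show (smashInl B M : B →* Smash B M) 0 = 0 from map_zero (smashInl B M)] at this
  exact fun x y h => key h

theorem F1_eq_zero_or_one (a : F1.{u}) : a = 0 ∨ a = 1 := by
  cases a
  · exact .inl rfl
  · exact .inr rfl

theorem F1_hom_ext {f g : F1.{u} ⟶ D} : f = g := by
  refine hom_ext fun a => ?_
  rcases F1_eq_zero_or_one a with rfl | rfl
  · rw [hom_zero, hom_zero]
  · rw [hom_one, hom_one]

/-- The monoid is `D` itself: every element of `𝔽₁[D]` has the form `1 ∧ d`, and a relation of `D`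
only says that zeros may be dropped, which also holds in `𝔽₁[D]`. -/
theorem HasTrivialRel.isMonoidBlueprint (hD : D.HasTrivialRel) (φ : F1.{u} ⟶ D) :
    IsMonoidBlueprint φ := by
  let f := monoidLift φ (MonoidWithZeroHom.id D)
  have hf : ∀ d : D, f (monomial 1 d) = d := fun d => by
    rw [monoidLift_monomial, hom_one, one_mul]
    rfl
  have hs : Function.Surjective fun a => f a := fun d => ⟨monomial 1 d, hf d⟩
  have hi : Function.Injective fun a => f a := by
    have aux : ∀ x : monoidBlueprint F1 D, x = monomial 1 (f x) := by
      intro x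
      obtain ⟨a, m, rfl⟩ := exists_monomial x
      rcases F1_eq_zero_or_one a with rfl | rfl
      · rw [monomial_zero_left, hom_zero, monomial_zero_right]
      · rw [hf]
    intro x y h
    rw [aux x, aux y]
    exact congrArg _ h
  have hp : Function.Injective (plusMap f) := by
    intro x y h
    obtain ⟨x, rfl⟩ := plusMk_surjective _ x
    obtain ⟨y, rfl⟩ := plusMk_surjective _ y
    rw [plusMap_plusMk, plusMap_plusMk, plusMk_eq_iff] at h
    obtain ⟨k, l, h⟩ := hD _ _ h
    have e : (0 : D) = (Hom.toFun f : monoidBlueprint F1 D →* D) 0 := (hom_zero f).symm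
    rw [e, ← mapDomainRingHom_single, ← mapDomainRingHom_single, ← map_add, ← map_add] at h
    have := MonoidAlgebra.mapDomain_injective hi h
    have := congrArg (plusMk _) this
    simpa only [map_add, plusMk_single, toPlus_zero, smul_zero, add_zero] using this
  have := isIso_of_surjective hs hp
  exact ⟨D, inferInstance, asIso f, F1_hom_ext⟩

end Trivial

/-! ### Elements of a blueprint as morphisms from the free blueprint on one generator -/

/-- The unique morphism from `𝔽₁`. -/
def fromF1 (D : Blueprint.{u}) : F1.{u} ⟶ D :=
  let χ : F1.{u} →*₀ D := (WithZero.lift' 1 : WithZero PUnit.{u + 1} →*₀ D)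
  Hom.mk χ fun x y h => by
    obtain ⟨k, l, h⟩ := hasTrivialRel_F1 x y h
    have := congrArg (fun z => D.plusMk (MonoidAlgebra.mapDomainRingHom ℕ
      (χ : F1.{u} →* D) z)) h
    simp only [map_add, mapDomainRingHom_single] at this
    have e : (χ : F1.{u} →* D) 0 = 0 := map_zero χ
    rw [e, plusMk_single, plusMk_single, toPlus_zero, smul_zero, smul_zero, add_zero,
      add_zero] at this
    exact (D.plusMk_eq_iff _ _).1 this

/-- The free blueprint on one element. -/
def free : Blueprint.{u} := monoidBlueprint F1 (WithZero (ULift.{u} (Multiplicative ℕ)))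

/-- The morphism from the free blueprint given by an element. -/
def freeLift {D : Blueprint.{u}} (d : D) : free ⟶ D :=
  monoidLift (fromF1 D)
    (WithZero.lift' ((powersHom D d).comp MulEquiv.ulift.toMonoidHom))

/-- The generator of the free blueprint. -/
def freeGen : free.{u} :=
  monomial 1 (WithZero.coe (ULift.up (Multiplicative.ofAdd 1)))

theorem freeLift_gen {D : Blueprint.{u}} (d : D) : freeLift d freeGen = d := by
  refine (monoidLift_monomial _ _ _ _).trans ?_
  rw [hom_one, one_mul, WithZero.lift'_coe]
  exact pow_one d

theorem free_hom_ext {D : Blueprint.{u}} {f g : free ⟶ D} (h : f freeGen = g freeGen) : f = g := by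
  refine monoidBlueprint_hom_ext (fun a => ?_) fun m => ?_
  · exact congrArg (fun χ : F1 ⟶ D => χ a) (F1_hom_ext (f := toMonoidBlueprint _ _ ≫ f)
      (g := toMonoidBlueprint _ _ ≫ g))
  · have key : ((Hom.toFun f).comp (monomialHom F1 _)) =
        ((Hom.toFun g).comp (monomialHom F1 _)) := by
      refine WithZero.monoidWithZeroHom_ext ?_
      have aux : ∀ (f : free ⟶ D) (n : ℕ),
          f (monomial 1 (WithZero.coe (ULift.up (Multiplicative.ofAdd n)))) = f freeGen ^ n := by
        intro f n
        refine Eq.trans (congrArg f ?_) (map_pow (Hom.toFun f) freeGen n)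
        have e : ULift.up (Multiplicative.ofAdd n) = ULift.up (Multiplicative.ofAdd 1) ^ n :=
          ULift.ext _ _ (by rw [ULift.pow_down, ← ofAdd_nsmul, nsmul_one]; rfl)
        rw [e, WithZero.coe_pow]
        exact map_pow (monomialHom F1 _) _ n
      ext ⟨n⟩
      exact (aux f n.toAdd).trans ((congrArg (· ^ n.toAdd) h).trans (aux g n.toAdd).symm)
    exact DFunLike.congr_fun key m

end Blueprint

open Blueprint

open AlgebraicGeometry (SheafedSpace PresheafedSpace)

/-! ### Sections of blueprinted spaces -/

section Sections

variable {X Y Z : BlueprintedSpace.{u}}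

/-- The blueprint `𝒪_Z(U)`. -/
abbrev sec (Z : BlueprintedSpace.{u}) (U : Opens Z) : Blueprint.{u} := Z.presheaf.obj (op U)

/-- The restriction map `𝒪_Z(U) → 𝒪_Z(V)`. -/
abbrev rs (Z : BlueprintedSpace.{u}) {U V : Opens Z} (h : V ≤ U) : sec Z U ⟶ sec Z V :=
  Z.presheaf.map (homOfLE h).op

theorem rs_comp {U V W : Opens Z} (h : V ≤ U) (h' : W ≤ V) :
    rs Z h ≫ rs Z h' = rs Z (h'.trans h) :=
  (Z.presheaf.map_comp _ _).symm

theorem rs_rs {U V W : Opens Z} (h : V ≤ U) (h' : W ≤ V) (s : sec Z U) :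
    rs Z h' (rs Z h s) = rs Z (h'.trans h) s := by
  rw [← Blueprint.comp_apply, rs_comp]

theorem plusMap_rs_rs {U V W : Opens Z} (h : V ≤ U) (h' : W ≤ V) (s : (sec Z U).Plus) :
    plusMap (rs Z h') (plusMap (rs Z h) s) = plusMap (rs Z (h'.trans h)) s := by
  rw [← plusMap_comp, rs_comp]

theorem rs_eq_id {U : Opens Z} (h : U ≤ U) : rs Z h = 𝟙 _ := Z.presheaf.map_id _

theorem rs_self {U : Opens Z} (h : U ≤ U) (s : sec Z U) : rs Z h s = s := by
  rw [rs_eq_id, id_apply]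

theorem existsUnique_glueHom {E : Blueprint.{u}} {ι : Type u} (V : ι → Opens Z)
    (s : ∀ i, E ⟶ sec Z (V i))
    (hs : ∀ i j, s i ≫ rs Z (inf_le_left : V i ⊓ V j ≤ V i) =
      s j ≫ rs Z (inf_le_right : V i ⊓ V j ≤ V j)) :
    ∃! t : E ⟶ sec Z (iSup V), ∀ i, t ≫ rs Z (le_iSup V i) = s i :=
  TopCat.Presheaf.IsSheaf.isSheafUniqueGluing_types
    ((isSheaf_iff_isSheaf_of_type _ _).2 (Z.IsSheaf E)) s hs

/-- The sheaf condition concerns the functors `Hom(E, 𝒪)`. For the free blueprint `E` on one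
generator such morphisms are sections. -/
theorem existsUnique_glue {ι : Type u} {U : Opens Z} (V : ι → Opens Z) (hV : ∀ i, V i ≤ U)
    (hU : ∀ z ∈ U, ∃ i, z ∈ V i) (s : ∀ i, sec Z (V i))
    (hs : ∀ i j, rs Z (inf_le_left : V i ⊓ V j ≤ V i) (s i) =
      rs Z (inf_le_right : V i ⊓ V j ≤ V j) (s j)) :
    ∃! t : sec Z U, ∀ i, rs Z (hV i) t = s i := by
  obtain rfl : U = iSup V := le_antisymm (fun z hz => Opens.mem_iSup.2 (hU z hz)) (iSup_le hV)
  obtain ⟨t, ht, ht'⟩ := existsUnique_glueHom V (fun i => freeLift (s i)) fun i j =>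
    free_hom_ext (by
      rw [Blueprint.comp_apply, Blueprint.comp_apply, freeLift_gen, freeLift_gen]
      exact hs i j)
  refine ⟨t freeGen, fun i => ?_, fun t' h' => ?_⟩
  · have := congrArg (fun f : free ⟶ sec Z (V i) => f freeGen) (ht i)
    exact this.trans (freeLift_gen _)
  · have := ht' (freeLift t') fun i => free_hom_ext (by
      rw [Blueprint.comp_apply, freeLift_gen, freeLift_gen]
      exact h' i)
    rw [← this, freeLift_gen]

theorem sec_ext {U : Opens Z} {s t : sec Z U}
    (h : ∀ z ∈ U, ∃ (V : Opens Z) (hV : V ≤ U), z ∈ V ∧ rs Z hV s = rs Z hV t) : s = t := by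
  choose V hV hz h using h
  refine (existsUnique_glue (fun z : U => V z.1 z.2) (fun z => hV _ _)
    (fun z hz' => ⟨⟨z, hz'⟩, hz _ _⟩) (fun z => rs Z (hV _ _) t) fun i j => ?_).unique
      (fun z => h _ _) (fun z => rfl)
  rw [rs_rs, rs_rs]

/-- Relations are local, not only sections. Let `E` be the monoid of sections over `U` with all
relations that hold on every member of the cover. The restrictions are morphisms out of `E` and glue
to a morphism `E ⟶ 𝒪(U)`, which is the identity on elements. So the relations of `E` already hold in
`𝒪(U)`. -/
theorem sec_plus_ext {U : Opens Z} {x y : (sec Z U).Plus}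
    (h : ∀ z ∈ U, ∃ (V : Opens Z) (hV : V ≤ U), z ∈ V ∧
      plusMap (rs Z hV) x = plusMap (rs Z hV) y) : x = y := by
  choose V hV hz h using h
  let W : U → Opens Z := fun z => V z.1 z.2
  have hW : iSup W = U := le_antisymm (iSup_le fun z => hV _ _) fun z hz' =>
    Opens.mem_iSup.2 ⟨⟨z, hz'⟩, hz _ _⟩
  have hWU : ∀ z, W z ≤ U := fun z => hV _ _
  let E : Blueprint.{u} :=
    { carrier := sec Z U
      rel := ⨅ z : U, (sec Z (W z)).rel.comap (MonoidAlgebra.mapDomainRingHom ℕ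
        (Hom.toFun (rs Z (hWU z)) : sec Z U →* sec Z (W z)))
      zero_rel := by
        simp only [RingCon.coe_iInf, iInf_apply, iInf_Prop_eq, RingCon.comap_rel]
        intro z
        rw [map_zero, mapDomainRingHom_single]
        simpa using (sec Z (W z)).zero_rel
      proper := fun a b hab => by
        simp only [RingCon.coe_iInf, iInf_apply, iInf_Prop_eq, RingCon.comap_rel] at hab
        refine sec_ext fun z hz' => ⟨_, hV z hz', hz z hz', ?_⟩
        have := hab ⟨z, hz'⟩
        rw [mapDomainRingHom_single, mapDomainRingHom_single] at this
        exact (sec Z (W ⟨z, hz'⟩)).proper _ _ this }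
  have hE : ∀ x y : MonoidAlgebra ℕ (sec Z U), E.rel x y ↔ ∀ z : U,
      (sec Z (W z)).rel (MonoidAlgebra.mapDomainRingHom ℕ
        (Hom.toFun (rs Z (hWU z)) : sec Z U →* sec Z (W z)) x)
        (MonoidAlgebra.mapDomainRingHom ℕ
        (Hom.toFun (rs Z (hWU z)) : sec Z U →* sec Z (W z)) y) := by
    intro x y
    change (⨅ z : U, (sec Z (W z)).rel.comap (MonoidAlgebra.mapDomainRingHom ℕ
        (Hom.toFun (rs Z (hWU z)) : sec Z U →* sec Z (W z)))) x y ↔ _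
    simp only [RingCon.coe_iInf, iInf_apply, iInf_Prop_eq, RingCon.comap_rel]
  let φ : ∀ z : U, E ⟶ sec Z (W z) := fun z =>
    Hom.mk (show sec Z U →*₀ sec Z (W z) from Hom.toFun (rs Z (hWU z)))
      fun x y hxy => (hE x y).1 hxy z
  obtain ⟨t, ht, -⟩ := existsUnique_glueHom W φ fun i j => hom_ext fun a => by
    exact (rs_rs (hWU i) inf_le_left a).trans (rs_rs (hWU j) inf_le_right a).symm
  let t' : E ⟶ sec Z U := t ≫ rs Z hW.ge
  have ht' : ∀ a : sec Z U, t' a = a := fun a => sec_ext fun z hz' =>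
    ⟨_, hV z hz', hz z hz', by
      have := congrArg (fun f : E ⟶ sec Z (W ⟨z, hz'⟩) => f a) (ht ⟨z, hz'⟩)
      refine Eq.trans ?_ this
      exact rs_rs _ _ _⟩
  obtain ⟨x, rfl⟩ := plusMk_surjective _ x
  obtain ⟨y, rfl⟩ := plusMk_surjective _ y
  have hxy : E.rel x y := (hE x y).2 fun z => by
    have := h z.1 z.2
    rwa [plusMap_plusMk, plusMap_plusMk, plusMk_eq_iff] at this
  have := Hom.map_rel t' x y hxy
  have e : (Hom.toFun t' : sec Z U →* sec Z U) = MonoidHom.id _ := MonoidHom.ext ht'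
  rw [plusMk_eq_iff]
  have e' : ∀ x : MonoidAlgebra ℕ (sec Z U), MonoidAlgebra.mapDomainRingHom ℕ
      (Hom.toFun t' : sec Z U →* sec Z U) x = x := fun x => by
    rw [e, MonoidAlgebra.mapDomainRingHom_id]; rfl
  rw [← e' x, ← e' y]
  exact this

theorem le_map (f : Y ⟶ Z) {V : Opens Z} {W : Opens Y} (h : ∀ y ∈ W, f.hom.base y ∈ V) :
    W ≤ (Opens.map f.hom.base).obj V := h

/-- The pullback of sections along a morphism, followed by restriction. -/
def pb (f : Y ⟶ Z) {V : Opens Z} {W : Opens Y} (h : ∀ y ∈ W, f.hom.base y ∈ V) :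
    sec Z V ⟶ sec Y W :=
  f.hom.c.app (op V) ≫ rs Y (le_map f h)

theorem pb_comp_rs (f : Y ⟶ Z) {V : Opens Z} {W W' : Opens Y} (h : ∀ y ∈ W, f.hom.base y ∈ V)
    (h' : W' ≤ W) : pb f h ≫ rs Y h' = pb f fun y hy => h y (h' hy) := by
  rw [pb, pb, Category.assoc, rs_comp]

theorem rs_comp_pb (f : Y ⟶ Z) {V V' : Opens Z} {W : Opens Y} (h' : V' ≤ V)
    (h : ∀ y ∈ W, f.hom.base y ∈ V') : rs Z h' ≫ pb f h = pb f fun y hy => h' (h y hy) := by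
  rw [pb, pb, ← Category.assoc]
  have := f.hom.c.naturality (homOfLE h').op
  refine (congrArg (· ≫ _) this).trans ?_
  rw [Category.assoc]
  exact congrArg _ (rs_comp _ _)

theorem pb_comp (f : X ⟶ Y) (g : Y ⟶ Z) {U : Opens Z} {V : Opens Y} {W : Opens X}
    (h : ∀ y ∈ V, g.hom.base y ∈ U) (h' : ∀ x ∈ W, f.hom.base x ∈ V)
    (h'' : ∀ x ∈ W, (f ≫ g).hom.base x ∈ U) : pb (f ≫ g) h'' = pb g h ≫ pb f h' := by
  have e : pb g h ≫ pb f h' = g.hom.c.app (op U) ≫ (rs Y (le_map g h) ≫ pb f h') :=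
    Category.assoc _ _ _
  rw [e]
  refine Eq.trans (Category.assoc (g.hom.c.app (op U)) _ _) ?_
  exact congrArg _ (rs_comp_pb f (le_map g h) h').symm

theorem pb_id {V W : Opens Z} (h : W ≤ V) : pb (𝟙 Z) h = rs Z h := by
  exact Category.id_comp _

theorem rs_pb_apply (f : Y ⟶ Z) {V : Opens Z} {W W' : Opens Y} (h : ∀ y ∈ W, f.hom.base y ∈ V)
    (h' : W' ≤ W) (s : sec Z V) : rs Y h' (pb f h s) = pb f (fun y hy => h y (h' hy)) s := by
  rw [← pb_comp_rs f h h', Blueprint.comp_apply]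

theorem pb_rs_apply (f : Y ⟶ Z) {V V' : Opens Z} {W : Opens Y} (h' : V' ≤ V)
    (h : ∀ y ∈ W, f.hom.base y ∈ V') (s : sec Z V) :
    pb f h (rs Z h' s) = pb f (fun y hy => h' (h y hy)) s := by
  rw [← rs_comp_pb f h' h, Blueprint.comp_apply]

theorem pb_comp_apply (f : X ⟶ Y) (g : Y ⟶ Z) {U : Opens Z} {V : Opens Y} {W : Opens X}
    (h : ∀ y ∈ V, g.hom.base y ∈ U) (h' : ∀ x ∈ W, f.hom.base x ∈ V)
    (h'' : ∀ x ∈ W, (f ≫ g).hom.base x ∈ U) (s : sec Z U) :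
    pb (f ≫ g) h'' s = pb f h' (pb g h s) := by
  rw [pb_comp f g h h', Blueprint.comp_apply]

/-- Two morphisms are equal if they agree on points and locally on sections. -/
theorem space_hom_ext {f g : Y ⟶ Z} (h : ∀ y, f.hom.base y = g.hom.base y)
    (h' : ∀ (V : Opens Z) (s : sec Z V) (y : Y) (_ : f.hom.base y ∈ V),
      ∃ (W : Opens Y) (hf : ∀ y ∈ W, f.hom.base y ∈ V) (hg : ∀ y ∈ W, g.hom.base y ∈ V),
        y ∈ W ∧ pb f hf s = pb g hg s) : f = g := by
  obtain ⟨⟨fb, fc⟩⟩ := f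
  obtain ⟨⟨gb, gc⟩⟩ := g
  obtain rfl : fb = gb := by ext y; exact h y
  have : fc = gc := by
    refine NatTrans.ext (funext fun V => ?_)
    induction V using Opposite.rec with | op V =>
    refine hom_ext fun s => sec_ext (Z := Y) fun y hy => ?_
    obtain ⟨W, hf, hg, hyW, e⟩ := h' V s y hy
    exact ⟨W, hf, hyW, e⟩
  subst this
  rfl

end Sections

section Local

variable {X Y Z : BlueprintedSpace.{u}}

/-! ### Germs -/

/-- The section `s` is invertible in a neighbourhood of `z`. -/
def UnitAt {U : Opens Z} (z : Z) (s : sec Z U) : Prop :=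
  ∃ (W : Opens Z) (h : W ≤ U), z ∈ W ∧ IsUnit (rs Z h s)

/-- The elements `x` and `y` agree in a neighbourhood of `z`. -/
def EqAt {U : Opens Z} (z : Z) (x y : (sec Z U).Plus) : Prop :=
  ∃ (W : Opens Z) (h : W ≤ U), z ∈ W ∧ plusMap (rs Z h) x = plusMap (rs Z h) y

variable {U V W : Opens Z} {z : Z}

theorem unitAt_of_isUnit (hz : z ∈ U) {s : sec Z U} (h : IsUnit s) : UnitAt z s :=
  ⟨U, le_rfl, hz, isUnit_map _ h⟩

theorem unitAt_one (hz : z ∈ U) : UnitAt z (1 : sec Z U) := unitAt_of_isUnit hz isUnit_one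

theorem UnitAt.mem {s : sec Z U} (h : UnitAt z s) : z ∈ U := by
  obtain ⟨W, hW, hz, -⟩ := h
  exact hW hz

theorem isUnit_rs_of_le {s : sec Z U} {hV : V ≤ U} (h : IsUnit (rs Z hV s)) (hW : W ≤ V) :
    IsUnit (rs Z (hW.trans hV) s) := by
  rw [← rs_rs hV hW]
  exact isUnit_map _ h

theorem unitAt_mul_iff {s t : sec Z U} : UnitAt z (s * t) ↔ UnitAt z s ∧ UnitAt z t := by
  constructor
  · rintro ⟨W, h, hz, hu⟩
    rw [hom_mul] at hu
    exact ⟨⟨W, h, hz, (IsUnit.mul_iff.1 hu).1⟩, ⟨W, h, hz, (IsUnit.mul_iff.1 hu).2⟩⟩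
  · rintro ⟨⟨W, h, hz, hu⟩, ⟨W', h', hz', hu'⟩⟩
    refine ⟨W ⊓ W', inf_le_left.trans h, ⟨hz, hz'⟩, ?_⟩
    rw [hom_mul]
    exact (isUnit_rs_of_le hu inf_le_left).mul (isUnit_rs_of_le hu' inf_le_right)

theorem unitAt_rs_iff (h : V ≤ U) (hz : z ∈ V) {s : sec Z U} :
    UnitAt z (rs Z h s) ↔ UnitAt z s := by
  constructor
  · rintro ⟨W, h', hz', hu⟩
    exact ⟨W, h'.trans h, hz', by rwa [rs_rs] at hu⟩
  · rintro ⟨W, h', hz', hu⟩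
    refine ⟨W ⊓ V, inf_le_right, ⟨hz', hz⟩, ?_⟩
    rw [rs_rs]
    exact isUnit_rs_of_le hu inf_le_left

/-- The open set of points at which `s` is invertible. -/
def unitLocus (s : sec Z U) : Opens Z where
  carrier := {z | UnitAt z s}
  is_open' := isOpen_iff_forall_mem_open.2 fun _ ⟨W, h, hz, hu⟩ =>
    ⟨W, fun _ hw => ⟨W, h, hw, hu⟩, W.2, hz⟩

theorem unitLocus_le (s : sec Z U) : unitLocus s ≤ U := fun _ h => UnitAt.mem h

/-- Local inverses are unique and therefore glue. -/
theorem isUnit_of_unitAt {s : sec Z U} (h : ∀ z ∈ U, UnitAt z s) : IsUnit s := by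
  choose W hW hz hu using h
  choose t ht using fun z hz => (hu z hz).exists_right_inv
  obtain ⟨r, hr, -⟩ := existsUnique_glue (fun z : U => W z.1 z.2) (fun z => hW _ _)
    (fun z hz' => ⟨⟨z, hz'⟩, hz _ _⟩) (fun z => t z.1 z.2) fun i j => by
      have hi := congrArg (rs Z (inf_le_left : W i.1 i.2 ⊓ W j.1 j.2 ≤ _)) (ht i.1 i.2)
      have hj := congrArg (rs Z (inf_le_right : W i.1 i.2 ⊓ W j.1 j.2 ≤ _)) (ht j.1 j.2)
      rw [hom_mul, hom_one, rs_rs] at hi hj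
      exact left_inv_eq_right_inv ((mul_comm _ _).trans hi) hj
  refine IsUnit.of_mul_eq_one r (sec_ext fun z hz' => ⟨W z hz', hW _ _, hz _ _, ?_⟩)
  rw [hom_mul, hom_one, hr ⟨z, hz'⟩]
  exact ht z hz'

theorem isUnit_rs_of_unitAt {s : sec Z U} (hV : V ≤ U) (h : ∀ z ∈ V, UnitAt z s) :
    IsUnit (rs Z hV s) :=
  isUnit_of_unitAt fun z hz => (unitAt_rs_iff hV hz).2 (h z hz)

theorem EqAt.mem {x y : (sec Z U).Plus} (h : EqAt z x y) : z ∈ U := by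
  obtain ⟨W, hW, hz, -⟩ := h
  exact hW hz

theorem plusMap_rs_congr {x y : (sec Z U).Plus} {hV : V ≤ U}
    (h : plusMap (rs Z hV) x = plusMap (rs Z hV) y) (hW : W ≤ V) :
    plusMap (rs Z (hW.trans hV)) x = plusMap (rs Z (hW.trans hV)) y := by
  rw [← plusMap_rs_rs hV hW, h, plusMap_rs_rs]

theorem EqAt.of_eq (hz : z ∈ U) {x y : (sec Z U).Plus} (h : x = y) : EqAt z x y :=
  ⟨U, le_rfl, hz, by rw [h]⟩

theorem EqAt.symm {x y : (sec Z U).Plus} (h : EqAt z x y) : EqAt z y x := by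
  obtain ⟨W, hW, hz, e⟩ := h
  exact ⟨W, hW, hz, e.symm⟩

theorem EqAt.trans {x y w : (sec Z U).Plus} (h : EqAt z x y) (h' : EqAt z y w) : EqAt z x w := by
  obtain ⟨W, hW, hz, e⟩ := h
  obtain ⟨W', hW', hz', e'⟩ := h'
  exact ⟨W ⊓ W', inf_le_left.trans hW, ⟨hz, hz'⟩,
    (plusMap_rs_congr e inf_le_left).trans (plusMap_rs_congr e' inf_le_right)⟩

theorem EqAt.add {x y x' y' : (sec Z U).Plus} (h : EqAt z x y) (h' : EqAt z x' y') :
    EqAt z (x + x') (y + y') := by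
  obtain ⟨W, hW, hz, e⟩ := h
  obtain ⟨W', hW', hz', e'⟩ := h'
  refine ⟨W ⊓ W', inf_le_left.trans hW, ⟨hz, hz'⟩, ?_⟩
  rw [map_add, map_add]
  exact congrArg₂ _ (plusMap_rs_congr e inf_le_left) (plusMap_rs_congr e' inf_le_right)

theorem EqAt.mul {x y x' y' : (sec Z U).Plus} (h : EqAt z x y) (h' : EqAt z x' y') :
    EqAt z (x * x') (y * y') := by
  obtain ⟨W, hW, hz, e⟩ := h
  obtain ⟨W', hW', hz', e'⟩ := h'
  refine ⟨W ⊓ W', inf_le_left.trans hW, ⟨hz, hz'⟩, ?_⟩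
  rw [map_mul, map_mul]
  exact congrArg₂ _ (plusMap_rs_congr e inf_le_left) (plusMap_rs_congr e' inf_le_right)

theorem EqAt.mul_left {x y : (sec Z U).Plus} (h : EqAt z x y) (w : (sec Z U).Plus) :
    EqAt z (w * x) (w * y) := (EqAt.of_eq h.mem rfl).mul h

theorem eqAt_rs_iff (h : V ≤ U) (hz : z ∈ V) {x y : (sec Z U).Plus} :
    EqAt z (plusMap (rs Z h) x) (plusMap (rs Z h) y) ↔ EqAt z x y := by
  constructor
  · rintro ⟨W, h', hz', hu⟩
    exact ⟨W, h'.trans h, hz', by rwa [plusMap_rs_rs, plusMap_rs_rs] at hu⟩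
  · rintro ⟨W, h', hz', hu⟩
    refine ⟨W ⊓ V, inf_le_right, ⟨hz', hz⟩, ?_⟩
    rw [plusMap_rs_rs, plusMap_rs_rs]
    exact plusMap_rs_congr hu inf_le_left

theorem eq_of_eqAt {x y : (sec Z U).Plus} (h : ∀ z ∈ U, EqAt z x y) : x = y :=
  sec_plus_ext h

theorem eqAt_toPlus_iff {s t : sec Z U} : EqAt z ((sec Z U).toPlus s) ((sec Z U).toPlus t) ↔
    ∃ (W : Opens Z) (h : W ≤ U), z ∈ W ∧ rs Z h s = rs Z h t := by
  simp only [EqAt, plusMap_toPlus, toPlus_eq_iff]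

theorem UnitAt.congr {s t : sec Z U} (h : UnitAt z s)
    (e : EqAt z ((sec Z U).toPlus s) ((sec Z U).toPlus t)) : UnitAt z t := by
  obtain ⟨W, hW, hz, e⟩ := eqAt_toPlus_iff.1 e
  rw [← unitAt_rs_iff hW hz] at h ⊢
  rwa [← e]

theorem EqAt.cancel {s : sec Z U} (hs : UnitAt z s) {x y : (sec Z U).Plus}
    (h : EqAt z ((sec Z U).toPlus s * x) ((sec Z U).toPlus s * y)) : EqAt z x y := by
  obtain ⟨W, hW, hz, hu⟩ := hs
  rw [← eqAt_rs_iff hW hz] at h ⊢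
  rw [map_mul, map_mul, plusMap_toPlus] at h
  obtain ⟨r, hr⟩ := hu.exists_left_inv
  have := h.mul_left ((sec Z W).toPlus r)
  rwa [← mul_assoc, ← mul_assoc, ← map_mul, hr, map_one, one_mul, one_mul] at this

/-! ### Charts -/

variable {C : Blueprint.{u}}

/-- A morphism `α : C ⟶ 𝒪_Z(U)` is a chart if it identifies `U` with the spectrum of `C`: the
points of `U` correspond to the prime ideals of `C`, the loci of invertibility of elements of `C`
form a basis of the topology, sections are locally fractions of elements of `C`, and
relations between elements of `C` hold locally on `U` only if they hold up to a denominator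
in `C`. -/
structure IsChart (α : C ⟶ sec Z U) : Prop where
  exists_prime : ∀ z ∈ U, ∃ P : Spectrum C, ∀ c, c ∉ P.ideal ↔ UnitAt z (α c)
  exists_point : ∀ P : Spectrum C, ∃ z ∈ U, ∀ c, c ∉ P.ideal ↔ UnitAt z (α c)
  point_unique : ∀ z ∈ U, ∀ z' ∈ U, (∀ c, UnitAt z (α c) ↔ UnitAt z' (α c)) → z = z'
  exists_basic : ∀ z ∈ U, ∀ W : Opens Z, z ∈ W →
    ∃ c, UnitAt z (α c) ∧ ∀ z', UnitAt z' (α c) → z' ∈ W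
  exists_frac : ∀ z, ∀ (W : Opens Z) (h : W ≤ U), z ∈ W → ∀ s : sec Z W,
    ∃ a f, UnitAt z (α f) ∧
      EqAt z ((sec Z W).toPlus (rs Z h (α f) * s)) ((sec Z W).toPlus (rs Z h (α a)))
  exists_eq : ∀ z, ∀ x y : C.Plus, EqAt z (plusMap α x) (plusMap α y) →
    ∃ f, UnitAt z (α f) ∧ C.toPlus f * x = C.toPlus f * y

/-- Extends `exists_frac` to formal sums by a common denominator. The sets `I` and `J` record that
sums from an ideal of sections have numerators that are sums from an ideal of `C`. -/
theorem IsChart.exists_frac_plus {α : C ⟶ sec Z U} (hα : IsChart α) (h : W ≤ U) (hz : z ∈ W)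
    {I : Set (sec Z W)} {J : Set C} (hJ : ∀ a b : C, b ∈ J → a * b ∈ J)
    (hIJ : ∀ s ∈ I, ∀ a f, UnitAt z (α f) →
      EqAt z ((sec Z W).toPlus (rs Z h (α f) * s)) ((sec Z W).toPlus (rs Z h (α a))) → a ∈ J)
    {x : (sec Z W).Plus} (hx : x ∈ formalSums I) :
    ∃ y ∈ formalSums J, ∃ f, UnitAt z (α f) ∧
      EqAt z ((sec Z W).toPlus (rs Z h (α f)) * x) (plusMap (rs Z h) (plusMap α y)) := by
  induction hx using AddSubmonoid.closure_induction with
  | mem x hx =>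
    obtain ⟨s, hs, rfl⟩ := hx
    obtain ⟨a, f, hf, e⟩ := hα.exists_frac z W h hz s
    refine ⟨C.toPlus a, toPlus_mem_formalSums (hIJ s hs a f hf e), f, hf, ?_⟩
    rwa [← map_mul, plusMap_toPlus, plusMap_toPlus]
  | zero =>
    refine ⟨0, AddSubmonoid.zero_mem _, 1, ?_, .of_eq hz (by simp)⟩
    rw [hom_one]
    exact unitAt_one (h hz)
  | add x y _ _ hx hy =>
    obtain ⟨x', hx', f, hf, ef⟩ := hx
    obtain ⟨y', hy', g, hg, eg⟩ := hy
    refine ⟨C.toPlus g * x' + C.toPlus f * y', add_mem (mul_mem_formalSums hJ _ hx')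
      (mul_mem_formalSums hJ _ hy'), f * g, ?_, ?_⟩
    · rw [hom_mul]
      exact unitAt_mul_iff.2 ⟨hf, hg⟩
    · have := (ef.mul_left ((sec Z W).toPlus (rs Z h (α g)))).add
        (eg.mul_left ((sec Z W).toPlus (rs Z h (α f))))
      simp only [map_add, map_mul, plusMap_toPlus]
      refine EqAt.trans (.of_eq hz ?_) this
      ring

theorem IsChart.exists_frac_plus_univ {α : C ⟶ sec Z U} (hα : IsChart α) (h : W ≤ U) (hz : z ∈ W)
    (x : (sec Z W).Plus) :
    ∃ y, ∃ f, UnitAt z (α f) ∧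
      EqAt z ((sec Z W).toPlus (rs Z h (α f)) * x) (plusMap (rs Z h) (plusMap α y)) := by
  obtain ⟨y, -, h⟩ := hα.exists_frac_plus h hz (J := Set.univ) (fun _ _ _ => trivial)
    (fun _ _ _ _ _ _ => trivial) (mem_formalSums_univ x)
  exact ⟨y, h⟩

/-- The blueprinted space is locally blueprinted at `z`: the non-invertible germs form a prime
ideal. -/
def LocalAt (z : Z) : Prop :=
  ∀ W : Opens Z, z ∈ W → ∃ P : Spectrum (sec Z W), ∀ s, s ∉ P.ideal ↔ UnitAt z s

theorem LocalAt.of_le (h : ∀ W : Opens Z, z ∈ W → W ≤ U → ∃ P : Spectrum (sec Z W),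
    ∀ s, s ∉ P.ideal ↔ UnitAt z s) (hz : z ∈ U) : LocalAt z := by
  intro W hW
  obtain ⟨P, hP⟩ := h (W ⊓ U) ⟨hW, hz⟩ inf_le_right
  refine ⟨P.comap (rs Z inf_le_left), fun s => (hP _).trans
    (unitAt_rs_iff inf_le_left (show z ∈ W ⊓ U from ⟨hW, hz⟩))⟩

/-- A fraction with invertible denominator is invertible at `z` exactly if its numerator lies
outside the prime ideal `P` of `C` at `z`. Clearing denominators turns an additive relation between
germs into one in `C⁺`, where `P` is an ideal. -/
theorem IsChart.localAt {α : C ⟶ sec Z U} (hα : IsChart α) (hz : z ∈ U) : LocalAt z := by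
  refine LocalAt.of_le (U := U) (fun W hW hWU => ?_) hz
  obtain ⟨P, hP⟩ := hα.exists_prime z hz
  refine ⟨Spectrum.ofPlus {s | ¬ UnitAt z s} (fun a b hb h => hb (unitAt_mul_iff.1 h).2)
    (fun x y c hx hy e => ?_) (fun h => h (unitAt_one hW)) (fun a b h => ?_), fun s => not_not⟩
  · have aux : ∀ s ∈ {s : sec Z W | ¬ UnitAt z s}, ∀ a f, UnitAt z (α f) →
        EqAt z ((sec Z W).toPlus (rs Z hWU (α f) * s)) ((sec Z W).toPlus (rs Z hWU (α a))) →
          a ∈ P.ideal := by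
      intro s hs a f hf e
      by_contra ha
      refine hs (unitAt_mul_iff.1 (UnitAt.congr ?_ e.symm)).2
      exact (unitAt_rs_iff hWU hW).2 ((hP a).1 ha)
    obtain ⟨x', hx', f, hf, ex⟩ := hα.exists_frac_plus hWU hW P.mul_mem aux hx
    obtain ⟨y', hy', g, hg, ey⟩ := hα.exists_frac_plus hWU hW P.mul_mem aux hy
    obtain ⟨c', k, hk, ec⟩ := hα.exists_frac z W hWU hW c
    intro hc
    have hc' : c' ∉ P.ideal := by
      rw [hP, ← unitAt_rs_iff hWU hW]
      refine UnitAt.congr (unitAt_mul_iff.2 ⟨(unitAt_rs_iff hWU hW).2 hk, hc⟩) ec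
    -- The relation `x + c = y` with `x = x' / f`, `y = y' / g`, `c = c' / k`, multiplied by `f * g
    -- * k`.
    have key : EqAt z (plusMap α (C.toPlus (g * k) * x' + C.toPlus (f * g * c')))
        (plusMap α (C.toPlus (f * k) * y')) := by
      rw [← eqAt_rs_iff hWU hW]
      simp only [map_add, map_mul, plusMap_toPlus] at ec ⊢
      refine (EqAt.add (ex.symm.mul_left _) (ec.symm.mul_left _)).trans
        (EqAt.trans (.of_eq hW ?_) (ey.mul_left _))
      rw [← e]
      ring
    obtain ⟨t, ht, e⟩ := hα.exists_eq z _ _ key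
    rw [mul_add, ← map_mul] at e
    have := P.mem_of_plus (mul_mem_formalSums P.mul_mem _ (mul_mem_formalSums P.mul_mem _ hx'))
      (mul_mem_formalSums P.mul_mem _ (mul_mem_formalSums P.mul_mem _ hy')) e
    refine absurd this ?_
    simp only [P.mul_notMem_iff, hP]
    exact ⟨ht, ⟨hf, hg⟩, (hP _).1 hc'⟩
  · by_contra hc
    rw [not_or] at hc
    exact h (unitAt_mul_iff.2 ⟨not_not.1 hc.1, not_not.1 hc.2⟩)

end Local

/-! ### The spectrum -/

section Spec

variable {C : Blueprint.{u}}

/-- The open set `{p | c ∉ p}`. -/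
def basicOpen (c : C) : Opens (Spectrum C) where
  carrier := {p | c ∉ p.ideal}
  is_open' := TopologicalSpace.isOpen_generateFrom_of_mem ⟨c, rfl⟩

theorem exists_basicOpen_le (W : Opens (Spectrum C)) (p : Spectrum C) (hp : p ∈ W) :
    ∃ c : C, p ∈ basicOpen c ∧ basicOpen c ≤ W := by
  obtain ⟨W, hW⟩ := W
  change p ∈ W at hp
  have key : ∃ c : C, p ∈ basicOpen c ∧ ∀ q ∈ basicOpen c, q ∈ W := by
    induction hW with
    | basic s hs =>
      obtain ⟨c, rfl⟩ := hs
      exact ⟨c, hp, fun q hq => hq⟩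
    | univ => exact ⟨1, p.one_notMem, fun _ _ => trivial⟩
    | inter s t _ _ hs ht =>
      obtain ⟨c, hc, h⟩ := hs hp.1
      obtain ⟨d, hd, h'⟩ := ht hp.2
      exact ⟨c * d, p.mul_notMem_iff.2 ⟨hc, hd⟩, fun q hq =>
        ⟨h q (q.mul_notMem_iff.1 hq).1, h' q (q.mul_notMem_iff.1 hq).2⟩⟩
    | sUnion S _ hS =>
      obtain ⟨s, hs, hps⟩ := hp
      obtain ⟨c, hc, h⟩ := hS s hs hps
      exact ⟨c, hc, fun q hq => ⟨s, hs, h q hq⟩⟩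
  exact key

theorem frac_eq_iff (p : Spectrum C) {a b f g : C} (hf : f ∉ p.ideal) (hg : g ∉ p.ideal) :
    frac p a f hf = frac p b g hg ↔ ∃ k, k ∉ p.ideal ∧ k * (g * a) = k * (f * b) := by
  refine Iff.trans Localization.mk_eq_mk_iff (Localization.r_iff_exists.trans ?_)
  exact ⟨fun ⟨k, h⟩ => ⟨k.1, k.2, h⟩, fun ⟨k, hk, h⟩ => ⟨⟨k, hk⟩, h⟩⟩

theorem isUnit_frac_iff (p : Spectrum C) {a f : C} (hf : f ∉ p.ideal) :
    IsUnit (frac p a f hf) ↔ a ∉ p.ideal := by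
  constructor
  · intro h
    obtain ⟨y, hy⟩ := h.exists_right_inv
    induction y using Localization.induction_on with | H y =>
    obtain ⟨b, g, hg⟩ := y
    have e := (frac_mul C p a b f g hf hg).symm.trans (hy.trans (frac_one C p).symm)
    obtain ⟨k, hk, e⟩ := (frac_eq_iff p _ _).1 e
    rw [one_mul, mul_one] at e
    have : k * (f * g) ∉ p.ideal := p.compl.mul_mem hk (p.compl.mul_mem hf hg)
    rw [← e, p.mul_notMem_iff, p.mul_notMem_iff] at this
    exact this.2.1
  · intro ha
    refine IsUnit.of_mul_eq_one (frac p f a ha) ?_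
    refine (frac_mul C p a f f a hf ha).trans (Eq.trans ?_ (frac_one C p))
    exact (frac_eq_iff p _ _).2 ⟨1, p.one_notMem, by simp [mul_comm]⟩

theorem spec_unitAt_iff {U : Opens (Spectrum C)} (s : sec (specSpace C) U) (p : Spectrum C)
    (hp : p ∈ U) : UnitAt (Z := specSpace C) (U := U) p s ↔ IsUnit (eval C U ⟨p, hp⟩ s) := by
  constructor
  · rintro ⟨W, h, hz, hu⟩
    exact isUnit_map (eval C W ⟨p, hz⟩) hu
  · intro h
    obtain ⟨V, hV, a, f, hs⟩ := s.2 ⟨p, hp⟩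
    obtain ⟨hf, e⟩ := hs ⟨p, hp⟩ hV
    have ha : a ∉ p.ideal := (isUnit_frac_iff p hf).1 (by
      have h' : IsUnit (s.1 ⟨p, hp⟩ : C.atPrime p) := h
      exact e ▸ h')
    -- On this neighbourhood `s = a / f`, and `f / a` is a section inverse to it.
    let W : Opens (Spectrum C) := V ⊓ U ⊓ basicOpen a
    have hWU : W ≤ U := fun q hq => hq.1.2
    refine ⟨W, hWU, ⟨⟨hV, hp⟩, ha⟩, IsUnit.of_mul_eq_one
      (⟨fun q => frac q.1 f a q.2.2, fun q => ⟨⊤, trivial, f, a, fun r _ => ⟨r.2.2, rfl⟩⟩⟩ :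
        Sections C W) (section_ext C fun q => ?_)⟩
    refine (hom_mul (eval C W q) _ _).trans (Eq.trans ?_ (hom_one (eval C W q)).symm)
    obtain ⟨hf', e'⟩ := hs ⟨q.1, q.2.1.2⟩ q.2.1.1
    refine (congrArg (· * _) e').trans ?_
    refine (frac_mul C q.1 _ _ _ _ _ q.2.2).trans ?_
    refine Eq.trans ?_ (frac_one C q.1)
    exact (frac_eq_iff q.1 _ _).2 ⟨1, q.1.one_notMem, by simp [mul_comm]⟩

theorem spec_unitAt_toGlobal (c : C) (p : Spectrum C) :
    UnitAt (Z := specSpace C) p (toGlobal C c) ↔ c ∉ p.ideal :=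
  (spec_unitAt_iff (U := ⊤) _ p trivial).trans (isUnit_frac_iff p p.one_notMem)

theorem spec_isChart (C : Blueprint.{u}) : IsChart (Z := specSpace C) (U := ⊤) (toGlobal C) where
  exists_prime p _ := ⟨p, fun c => (spec_unitAt_toGlobal c p).symm⟩
  exists_point p := ⟨p, trivial, fun c => (spec_unitAt_toGlobal c p).symm⟩
  point_unique p _ q _ h := by
    refine Spectrum.ext (Set.ext fun c => ?_)
    exact not_iff_not.1 ((spec_unitAt_toGlobal c p).symm.trans
      ((h c).trans (spec_unitAt_toGlobal c q)))
  exists_basic p _ W hp := by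
    obtain ⟨c, hc, h⟩ := exists_basicOpen_le W p hp
    exact ⟨c, (spec_unitAt_toGlobal c p).2 hc, fun q hq => h ((spec_unitAt_toGlobal c q).1 hq)⟩
  exists_frac p W h hp s := by
    obtain ⟨V, hV, a, f, hs⟩ := s.2 ⟨p, hp⟩
    refine ⟨a, f, (spec_unitAt_toGlobal f p).2 (hs ⟨p, hp⟩ hV).1, ?_⟩
    rw [eqAt_toPlus_iff]
    let V' : Opens (specSpace C) := V
    have hVW : V' ⊓ W ≤ W := inf_le_right
    refine ⟨V' ⊓ W, hVW, ⟨hV, hp⟩, section_ext C fun q => ?_⟩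
    refine (hom_mul (eval C W ⟨q.1, hVW q.2⟩) _ _).trans ?_
    obtain ⟨hf, e⟩ := hs ⟨q.1, hVW q.2⟩ q.2.1
    refine (congrArg (_ * ·) e).trans ?_
    refine (frac_mul C q.1 _ _ _ _ q.1.one_notMem hf).trans ?_
    refine (frac_eq_iff q.1 _ q.1.one_notMem).2 ⟨1, q.1.one_notMem, by simp [mul_comm]⟩
  exists_eq p x y h := by
    obtain ⟨W, hW, hp, e⟩ := h
    have := congrArg (plusMap (eval C W ⟨p, hp⟩)) e
    have aux : ∀ x, plusMap (eval C W ⟨p, hp⟩) (plusMap (rs (specSpace C) hW)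
        (plusMap (toGlobal C) x)) = plusMap (C.toLocalization p.compl) x := fun x =>
      (plusMap_comp _ _ _).symm.trans (plusMap_comp _ _ _).symm
    obtain ⟨s, hs, h⟩ := (plusMap_toLocalization_eq_iff C p.compl x y).1
      ((aux x).symm.trans (this.trans (aux y)))
    exact ⟨s, (spec_unitAt_toGlobal s p).2 hs, h⟩

end Spec

/-! ### Local morphisms and open immersions -/

section Transfer

variable {X Y Z : BlueprintedSpace.{u}} {C : Blueprint.{u}}

theorem UnitAt.pb (f : Y ⟶ Z) {U : Opens Z} {W : Opens Y} (h : ∀ y ∈ W, f.hom.base y ∈ U)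
    {y : Y} (hy : y ∈ W) {s : sec Z U} (hs : UnitAt (f.hom.base y) s) :
    UnitAt y (pb f h s) := by
  obtain ⟨V, hV, hz, hu⟩ := hs
  refine ⟨W ⊓ (Opens.map f.hom.base).obj V, inf_le_left, ⟨hy, hz⟩, ?_⟩
  rw [rs_pb_apply, ← pb_rs_apply (W := W ⊓ (Opens.map f.hom.base).obj V) f hV fun y hy => hy.2]
  exact isUnit_map _ hu

theorem EqAt.pb (f : Y ⟶ Z) {U : Opens Z} {W : Opens Y} (h : ∀ y ∈ W, f.hom.base y ∈ U)
    {y : Y} (hy : y ∈ W) {s t : (sec Z U).Plus} (hs : EqAt (f.hom.base y) s t) :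
    EqAt y (plusMap (pb f h) s) (plusMap (pb f h) t) := by
  obtain ⟨V, hV, hz, hu⟩ := hs
  refine ⟨W ⊓ (Opens.map f.hom.base).obj V, inf_le_left, ⟨hy, hz⟩, ?_⟩
  rw [← plusMap_comp, ← plusMap_comp, pb_comp_rs,
    ← rs_comp_pb (W := W ⊓ (Opens.map f.hom.base).obj V) f hV fun y hy => hy.2,
    plusMap_comp, hu, plusMap_comp]

theorem isLocalMorphism_iff (f : Y ⟶ Z) : IsLocalMorphism f ↔
    ∀ (U : Opens Z) (s : sec Z U) (W : Opens Y) (h : ∀ y ∈ W, f.hom.base y ∈ U) (y : Y),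
      y ∈ W → (UnitAt y (pb f h s) ↔ UnitAt (f.hom.base y) s) := by
  constructor
  · intro hf U s W h y hy
    refine ⟨fun hs => ?_, fun hs => hs.pb f h hy⟩
    obtain ⟨V, hV, hyV, hu⟩ := hs
    have hVU : V ≤ (Opens.map f.hom.base).obj U := fun y hy => h y (hV hy)
    obtain ⟨V', j, hV', hu'⟩ := hf U s y (h y hy) ⟨V, homOfLE hVU, hyV, by
      rw [rs_pb_apply] at hu
      exact hu⟩
    exact ⟨V', j.le, hV', hu'⟩
  · intro hf U s y hy ⟨W, i, hyW, hu⟩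
    have : UnitAt y (pb f (V := U) (W := W) i.le s) := unitAt_of_isUnit hyW hu
    obtain ⟨V, hV, hz, hu⟩ := (hf U s W i.le y hyW).1 this
    exact ⟨V, homOfLE hV, hz, hu⟩

theorem IsLocalMorphism.unitAt_iff {f : Y ⟶ Z} (hf : IsLocalMorphism f) {U : Opens Z}
    {W : Opens Y} {h : ∀ y ∈ W, f.hom.base y ∈ U} {y : Y} (hy : y ∈ W) {s : sec Z U} :
    UnitAt y (pb f h s) ↔ UnitAt (f.hom.base y) s :=
  (isLocalMorphism_iff f).1 hf U s W h y hy

theorem isIso_pb (j : Y ⟶ Z) [SheafedSpace.IsOpenImmersion j] {U : Opens Z} {W : Opens Y}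
    (h : ∀ y ∈ W, j.hom.base y ∈ U) (h' : ∀ z ∈ U, ∃ y ∈ W, j.hom.base y = z) :
    IsIso (pb j h) := by
  have hj : PresheafedSpace.IsOpenImmersion j.hom := inferInstance
  have e : W = (Opens.map j.hom.base).obj U := by
    refine le_antisymm h fun y hy => ?_
    obtain ⟨y', hy', e⟩ := h' _ hy
    rwa [← hj.base_open.injective e]
  have e' : U = hj.base_open.functor.obj W := by
    ext z
    exact ⟨fun hz => h' z hz, fun ⟨y, hy, e⟩ => e ▸ h y hy⟩
  have h1 : IsIso (j.hom.c.app (op U)) := by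
    rw [e']
    infer_instance
  subst e
  have h2 : rs Y (le_map j h) = 𝟙 _ := rs_eq_id _
  rw [pb, h2]
  exact IsIso.comp_isIso' h1 (IsIso.id _)

theorem isUnit_iff_of_isIso {A B : Blueprint.{u}} (f : A ⟶ B) [IsIso f] {a : A} :
    IsUnit (f a) ↔ IsUnit a := by
  refine ⟨fun h => ?_, fun h => isUnit_map f h⟩
  have := isUnit_map (inv f) h
  rwa [← Blueprint.comp_apply, IsIso.hom_inv_id, Blueprint.id_apply] at this

/-- The image of an open set under an open immersion. -/
def imageOpen (j : Y ⟶ Z) [SheafedSpace.IsOpenImmersion j] (W : Opens Y) : Opens Z :=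
  (PresheafedSpace.IsOpenImmersion.base_open (f := j.hom)).functor.obj W

theorem base_injective (j : Y ⟶ Z) [SheafedSpace.IsOpenImmersion j] :
    Function.Injective j.hom.base :=
  (PresheafedSpace.IsOpenImmersion.base_open (f := j.hom)).injective

theorem unitAt_pb_iff (j : Y ⟶ Z) [SheafedSpace.IsOpenImmersion j] {U : Opens Z} {W : Opens Y}
    {h : ∀ y ∈ W, j.hom.base y ∈ U} {y : Y} (hy : y ∈ W) {s : sec Z U} :
    UnitAt y (pb j h s) ↔ UnitAt (j.hom.base y) s := by
  refine ⟨fun ⟨V, hV, hyV, hu⟩ => ?_, fun hs => hs.pb j h hy⟩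
  have hVU : imageOpen j V ≤ U := by
    rintro _ ⟨y, hy, rfl⟩
    exact h y (hV hy)
  have hVV : ∀ y ∈ V, j.hom.base y ∈ imageOpen j V := fun y hy => ⟨y, hy, rfl⟩
  have := isIso_pb j hVV fun z hz => hz
  refine ⟨imageOpen j V, hVU, hVV y hyV, ?_⟩
  rw [← isUnit_iff_of_isIso (pb j hVV), pb_rs_apply]
  rwa [rs_pb_apply] at hu

theorem isLocalMorphism_of_isOpenImmersion (j : Y ⟶ Z) [SheafedSpace.IsOpenImmersion j] :
    IsLocalMorphism j :=
  (isLocalMorphism_iff j).2 fun _ _ _ _ _ hy => unitAt_pb_iff j hy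

theorem eqAt_pb_iff (j : Y ⟶ Z) [SheafedSpace.IsOpenImmersion j] {U : Opens Z} {W : Opens Y}
    {h : ∀ y ∈ W, j.hom.base y ∈ U} {y : Y} (hy : y ∈ W) {s t : (sec Z U).Plus} :
    EqAt y (plusMap (pb j h) s) (plusMap (pb j h) t) ↔ EqAt (j.hom.base y) s t := by
  refine ⟨fun ⟨V, hV, hyV, hu⟩ => ?_, fun hs => hs.pb j h hy⟩
  have hVU : imageOpen j V ≤ U := by
    rintro _ ⟨y, hy, rfl⟩
    exact h y (hV hy)
  have hVV : ∀ y ∈ V, j.hom.base y ∈ imageOpen j V := fun y hy => ⟨y, hy, rfl⟩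
  have := isIso_pb j hVV fun z hz => hz
  refine ⟨imageOpen j V, hVU, hVV y hyV, plusMap_injective_of_isIso (pb j hVV) ?_⟩
  rw [← plusMap_comp, ← plusMap_comp, rs_comp_pb]
  rwa [← plusMap_comp, ← plusMap_comp, pb_comp_rs] at hu

/-- All conditions of a chart are expressed by `UnitAt` and `EqAt`, which an open immersion
preserves and reflects. -/
theorem isChart_comp_pb_iff (j : Y ⟶ Z) [SheafedSpace.IsOpenImmersion j] {U : Opens Z}
    {V : Opens Y} (hV : ∀ y ∈ V, j.hom.base y ∈ U) (hU : ∀ z ∈ U, ∃ y ∈ V, j.hom.base y = z)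
    (α : C ⟶ sec Z U) : IsChart (α ≫ pb j hV) ↔ IsChart α := by
  have hu : ∀ y ∈ V, ∀ c, UnitAt y ((α ≫ pb j hV) c) ↔ UnitAt (j.hom.base y) (α c) :=
    fun y hy c => unitAt_pb_iff j (h := hV) hy
  constructor
  · intro h
    refine ⟨fun z hz => ?_, fun P => ?_, fun z hz z' hz' e => ?_, fun z hz W hzW => ?_,
      fun z W hWU hz s => ?_, fun z x y e => ?_⟩
    · obtain ⟨y, hy, rfl⟩ := hU z hz
      obtain ⟨P, hP⟩ := h.exists_prime y hy
      exact ⟨P, fun c => (hP c).trans (hu y hy c)⟩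
    · obtain ⟨y, hy, hP⟩ := h.exists_point P
      exact ⟨_, hV y hy, fun c => (hP c).trans (hu y hy c)⟩
    · obtain ⟨y, hy, rfl⟩ := hU z hz
      obtain ⟨y', hy', rfl⟩ := hU z' hz'
      rw [h.point_unique y hy y' hy' fun c => (hu y hy c).trans ((e c).trans (hu y' hy' c).symm)]
    · obtain ⟨y, hy, rfl⟩ := hU z hz
      obtain ⟨c, hc, h⟩ := h.exists_basic y hy ((Opens.map j.hom.base).obj W) hzW
      refine ⟨c, (hu y hy c).1 hc, fun z' hz' => ?_⟩
      obtain ⟨y', hy', rfl⟩ := hU z' hz'.mem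
      exact h y' ((hu y' hy' c).2 hz')
    · obtain ⟨y, hy, rfl⟩ := hU z (hWU hz)
      let W' := (Opens.map j.hom.base).obj W
      have hW'V : W' ≤ V := fun y' hy' => by
        obtain ⟨y'', hy'', e⟩ := hU _ (hWU hy')
        rwa [← base_injective j e]
      obtain ⟨a, f, hf, e⟩ := h.exists_frac y W' hW'V hz (pb j (fun _ h => h) s)
      refine ⟨a, f, (hu y hy f).1 hf, ?_⟩
      have hWW : ∀ y ∈ W', j.hom.base y ∈ W := fun _ h => h
      rw [← eqAt_pb_iff j (W := W') (h := hWW) hz, plusMap_toPlus, plusMap_toPlus, hom_mul,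
        pb_rs_apply, pb_rs_apply]
      rwa [Blueprint.comp_apply, Blueprint.comp_apply, rs_pb_apply, rs_pb_apply] at e
    · obtain ⟨z, hz, rfl⟩ := hU z e.mem
      rw [← eqAt_pb_iff j (h := hV) hz, ← plusMap_comp, ← plusMap_comp] at e
      obtain ⟨f, hf, e⟩ := h.exists_eq z x y e
      exact ⟨f, (hu z hz f).1 hf, e⟩
  · intro h
    refine ⟨fun z hz => ?_, fun P => ?_, fun z hz z' hz' e => ?_, fun z hz W hzW => ?_,
      fun z W hWU hz s => ?_, fun z x y e => ?_⟩
    · obtain ⟨P, hP⟩ := h.exists_prime _ (hV z hz)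
      exact ⟨P, fun c => (hP c).trans (hu z hz c).symm⟩
    · obtain ⟨z, hz, hP⟩ := h.exists_point P
      obtain ⟨y, hy, rfl⟩ := hU z hz
      exact ⟨_, hy, fun c => (hP c).trans (hu y hy c).symm⟩
    · exact base_injective j (h.point_unique _ (hV z hz) _ (hV z' hz') fun c =>
        (hu z hz c).symm.trans ((e c).trans (hu z' hz' c)))
    · obtain ⟨c, hc, h⟩ := h.exists_basic _ (hV z hz) (imageOpen j W) ⟨z, hzW, rfl⟩
      refine ⟨c, (hu z hz c).2 hc, fun z' hz' => ?_⟩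
      obtain ⟨y, hy, e⟩ := h _ ((hu z' hz'.mem c).1 hz')
      rwa [← base_injective j e]
    · have hWW : ∀ y ∈ W, j.hom.base y ∈ imageOpen j W := fun y hy => ⟨y, hy, rfl⟩
      have := isIso_pb j hWW fun z hz => hz
      obtain ⟨s, rfl⟩ := surjective_of_isIso (pb j hWW) s
      have hWU' : imageOpen j W ≤ U := by
        rintro _ ⟨y, hy, rfl⟩
        exact hV y (hWU hy)
      obtain ⟨a, f, hf, e⟩ := h.exists_frac _ _ hWU' (hWW z hz) s
      refine ⟨a, f, (hu z (hWU hz) f).2 hf, ?_⟩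
      rw [← eqAt_pb_iff j (h := hWW) hz, plusMap_toPlus, plusMap_toPlus, hom_mul,
        pb_rs_apply, pb_rs_apply] at e
      rwa [Blueprint.comp_apply, Blueprint.comp_apply, rs_pb_apply, rs_pb_apply]
    · have hz : z ∈ V := e.mem
      rw [plusMap_comp, plusMap_comp, eqAt_pb_iff j hz] at e
      obtain ⟨f, hf, e⟩ := h.exists_eq _ x y e
      exact ⟨f, (hu z hz f).2 hf, e⟩

/-- A morphism into a chart is determined by its values on the blueprint of the chart. -/
theorem IsChart.hom_ext {U : Opens Z} {α : C ⟶ sec Z U} (hα : IsChart α) {f g : Y ⟶ Z}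
    (hf : IsLocalMorphism f) (hg : IsLocalMorphism g) (hfU : ∀ y ∈ (⊤ : Opens Y), f.hom.base y ∈ U)
    (hgU : ∀ y ∈ (⊤ : Opens Y), g.hom.base y ∈ U) (h : ∀ c, pb f hfU (α c) = pb g hgU (α c)) :
    f = g := by
  have hb : ∀ y, f.hom.base y = g.hom.base y := fun y =>
    hα.point_unique _ (hfU y trivial) _ (hgU y trivial) fun c => by
      rw [← hf.unitAt_iff (h := hfU) (y := y) trivial, h, hg.unitAt_iff (h := hgU) (y := y) trivial]
  refine space_hom_ext hb fun V s y hy => ?_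
  have hVU : V ⊓ U ≤ U := inf_le_right
  have hVV : V ⊓ U ≤ V := inf_le_left
  -- The section is locally `a / k`. Both morphisms agree on `a` and `k`, and the pullback of `k` is
  -- invertible near `y`, so it can be cancelled.
  obtain ⟨a, k, hk, e⟩ := hα.exists_frac (f.hom.base y) (V ⊓ U) hVU ⟨hy, hfU y trivial⟩ (rs Z hVV s)
  let W := (Opens.map f.hom.base).obj (V ⊓ U)
  have hfW : ∀ y ∈ W, f.hom.base y ∈ V ⊓ U := fun _ h => h
  have hgW : ∀ y ∈ W, g.hom.base y ∈ V ⊓ U := fun y h => hb y ▸ hfW y h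
  have hyW : y ∈ W := ⟨hy, hfU y trivial⟩
  have ef := e.pb f hfW hyW
  rw [hb] at e
  have eg := e.pb g hgW hyW
  simp only [plusMap_toPlus, map_mul, pb_rs_apply] at ef eg
  have key : ∀ c, pb f (fun y hy => hVU (hfW y hy)) (α c) =
      pb g (fun y hy => hVU (hgW y hy)) (α c) := fun c => by
    have := congrArg (rs Y (le_top : W ≤ ⊤)) (h c)
    rwa [rs_pb_apply, rs_pb_apply] at this
  rw [key, key] at ef
  have := (ef.trans eg.symm).cancel (by
    rw [← key]
    exact (hk.pb f (fun y hy => hVU (hfW y hy)) hyW))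
  rw [eqAt_toPlus_iff] at this
  obtain ⟨W', hW', hy', e⟩ := this
  refine ⟨W', fun y hy => hVV (hfW y (hW' hy)), fun y hy => hVV (hgW y (hW' hy)), hy', ?_⟩
  rwa [rs_pb_apply, rs_pb_apply] at e

end Transfer

/-! ### Morphisms into a chart -/

section Adjunction

variable {Y Z : BlueprintedSpace.{u}} {C : Blueprint.{u}} {V : Opens Y}

/-- The elements `x` and `t` of the semirings of sections of `Y` and `Z` are, locally at `b z` and
at `z`, represented by the same fraction of elements of `C`. -/
def SameFrac (α : C ⟶ sec Y V) (β : C ⟶ sec Z ⊤) (b : Z → Y) (z : Z) {W : Opens Y} {N : Opens Z}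
    (x : (sec Y W).Plus) (t : (sec Z N).Plus) : Prop :=
  ∃ (a : C.Plus) (g : C), UnitAt (b z) (α g) ∧
    EqAt (b z) ((sec Y (W ⊓ V)).toPlus (rs Y inf_le_right (α g)) * plusMap (rs Y inf_le_left) x)
      (plusMap (rs Y inf_le_right) (plusMap α a)) ∧
    EqAt z ((sec Z N).toPlus (rs Z le_top (β g)) * t) (plusMap (rs Z le_top) (plusMap β a))

variable {α : C ⟶ sec Y V} {β : C ⟶ sec Z ⊤} {b : Z → Y} {z : Z} {W : Opens Y} {N : Opens Z}
  {x x' : (sec Y W).Plus} {t t' : (sec Z N).Plus}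

/-- Uniqueness of transport: if `a / g` and `a' / g'` represent the same `x`, then `f * g' * a = f *
g * a'` in `C⁺` for some `f` invertible at `b z`. Applying `β` makes `f`, `g` and `g'` invertible at
`z`. -/
theorem SameFrac.eqAt (hα : IsChart α) (hb : ∀ z c, UnitAt (b z) (α c) ↔ UnitAt z (β c))
    (h : SameFrac α β b z x t) (h' : SameFrac α β b z x t') : EqAt z t t' := by
  obtain ⟨a, g, hg, e, ez⟩ := h
  obtain ⟨a', g', hg', e', ez'⟩ := h'
  have hz : b z ∈ W ⊓ V := e.mem
  have hN : z ∈ N := ez.mem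
  have key : EqAt (b z) (plusMap α (C.toPlus g' * a)) (plusMap α (C.toPlus g * a')) := by
    rw [← eqAt_rs_iff (V := W ⊓ V) inf_le_right hz]
    simp only [map_mul, plusMap_toPlus]
    refine (e.symm.mul_left _).trans (.trans (.of_eq hz ?_) (e'.mul_left _))
    ring
  obtain ⟨f, hf, k⟩ := hα.exists_eq _ _ _ key
  have hu : UnitAt z (rs Z (le_top : N ≤ ⊤) (β (f * g' * g))) := by
    rw [unitAt_rs_iff le_top hN, ← hb, hom_mul, hom_mul, unitAt_mul_iff, unitAt_mul_iff]
    exact ⟨⟨hf, hg'⟩, hg⟩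
  refine EqAt.cancel hu ?_
  have k' := congrArg (fun x => plusMap (rs Z (le_top : N ≤ ⊤)) (plusMap β x)) k
  simp only [map_mul, plusMap_toPlus] at k' ⊢
  refine EqAt.trans (.of_eq hN (mul_assoc _ _ _)) ((ez.mul_left _).trans
    (.trans (.of_eq hN ?_) ((ez'.symm.mul_left ((sec Z N).toPlus (rs Z le_top (β f)) *
      (sec Z N).toPlus (rs Z le_top (β g)))).trans (.of_eq hN ?_))))
  · rw [mul_assoc, k', mul_assoc]
  · ring

theorem SameFrac.mul (h : SameFrac α β b z x t) (h' : SameFrac α β b z x' t') :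
    SameFrac α β b z (x * x') (t * t') := by
  obtain ⟨a, g, hg, e, ez⟩ := h
  obtain ⟨a', g', hg', e', ez'⟩ := h'
  refine ⟨a * a', g * g', ?_, ?_, ?_⟩
  · rw [hom_mul, unitAt_mul_iff]
    exact ⟨hg, hg'⟩
  · simp only [map_mul]
    exact .trans (.of_eq e.mem (by ring)) (e.mul e')
  · simp only [map_mul]
    exact .trans (.of_eq ez.mem (by ring)) (ez.mul ez')

theorem SameFrac.add (h : SameFrac α β b z x t) (h' : SameFrac α β b z x' t') :
    SameFrac α β b z (x + x') (t + t') := by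
  obtain ⟨a, g, hg, e, ez⟩ := h
  obtain ⟨a', g', hg', e', ez'⟩ := h'
  refine ⟨C.toPlus g' * a + C.toPlus g * a', g * g', ?_, ?_, ?_⟩
  · rw [hom_mul, unitAt_mul_iff]
    exact ⟨hg, hg'⟩
  · simp only [map_mul, map_add, plusMap_toPlus]
    exact .trans (.of_eq e.mem (by ring)) ((e.mul_left _).add (e'.mul_left _))
  · simp only [map_mul, map_add, plusMap_toPlus]
    exact .trans (.of_eq ez.mem (by ring)) ((ez.mul_left _).add (ez'.mul_left _))

theorem SameFrac.of_image (hz : b z ∈ W) (hV : b z ∈ V) (hN : z ∈ N) (hW : W ≤ V) (a : C.Plus) :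
    SameFrac α β b z (plusMap (rs Y hW) (plusMap α a)) (plusMap (rs Z (le_top : N ≤ ⊤))
      (plusMap β a)) := by
  refine ⟨a, 1, ?_, .of_eq (show b z ∈ W ⊓ V from ⟨hz, hV⟩) ?_, .of_eq hN ?_⟩
  · rw [hom_one]
    exact unitAt_one hV
  · simp only [map_one, one_mul]
    rw [plusMap_rs_rs]
  · simp only [map_one, one_mul]

theorem SameFrac.one (hz : b z ∈ W) (hV : b z ∈ V) (hN : z ∈ N) :
    SameFrac α β b z (1 : (sec Y W).Plus) (1 : (sec Z N).Plus) :=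
  ⟨1, 1, by rw [hom_one]; exact unitAt_one hV,
    .of_eq (show b z ∈ W ⊓ V from ⟨hz, hV⟩) (by simp), .of_eq hN (by simp)⟩

theorem SameFrac.zero (hz : b z ∈ W) (hV : b z ∈ V) (hN : z ∈ N) :
    SameFrac α β b z (0 : (sec Y W).Plus) (0 : (sec Z N).Plus) :=
  ⟨0, 1, by rw [hom_one]; exact unitAt_one hV,
    .of_eq (show b z ∈ W ⊓ V from ⟨hz, hV⟩) (by simp), .of_eq hN (by simp)⟩

theorem sameFrac_rs_iff {W' : Opens Y} {N' : Opens Z} (hW : W' ≤ W) (hN : N' ≤ N)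
    (hz : b z ∈ W') (hV : b z ∈ V) (hz' : z ∈ N') :
    SameFrac α β b z (plusMap (rs Y hW) x) (plusMap (rs Z hN) t) ↔ SameFrac α β b z x t := by
  unfold SameFrac
  refine exists_congr fun a => exists_congr fun g => and_congr_right' (and_congr ?_ ?_)
  · have h : W' ⊓ V ≤ W ⊓ V := inf_le_inf_right _ hW
    rw [← eqAt_rs_iff h ⟨hz, hV⟩]
    simp only [map_mul, plusMap_toPlus, plusMap_rs_rs, rs_rs]
  · rw [← eqAt_rs_iff hN hz']
    simp only [map_mul, plusMap_toPlus, plusMap_rs_rs, rs_rs]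

/-- Sections over a chart can be transported along a map that is compatible with the loci of
invertibility. -/
theorem exists_sameFrac (hα : IsChart α) (hb : ∀ z c, UnitAt (b z) (α c) ↔ UnitAt z (β c))
    (hV : ∀ z, b z ∈ V) (hc : Continuous b) (hN : ∀ z ∈ N, b z ∈ W) (s : sec Y W) :
    ∃ t : sec Z N, ∀ z ∈ N, SameFrac α β b z ((sec Y W).toPlus s) ((sec Z N).toPlus t) := by
  have loc : ∀ z ∈ N, ∃ (N' : Opens Z) (_ : N' ≤ N) (t : sec Z N'), z ∈ N' ∧
      ∀ z ∈ N', SameFrac α β b z ((sec Y W).toPlus s) ((sec Z N').toPlus t) := by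
    intro z hz
    obtain ⟨a, g, hg, e⟩ := hα.exists_frac (b z) (W ⊓ V) inf_le_right ⟨hN z hz, hV z⟩
      (rs Y inf_le_left s)
    rw [eqAt_toPlus_iff] at e
    obtain ⟨W', hW', hz', e⟩ := e
    -- Here `s = a / g` holds at the image points and `β g` is invertible, so the transported
    -- section is `β a / β g`.
    let N' : Opens Z := ⟨b ⁻¹' W', W'.2.preimage hc⟩ ⊓ unitLocus (β g)
    have hu : IsUnit (rs Z (le_top : N' ≤ ⊤) (β g)) := isUnit_rs_of_unitAt le_top fun z hz => hz.2
    have hN' : N' ≤ ⟨b ⁻¹' W, W.2.preimage hc⟩ := fun z hz => (hW' hz.1).1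
    obtain ⟨r, hr⟩ := hu.exists_right_inv
    have hbN : N' ⊓ N ≤ N' := inf_le_left
    refine ⟨N' ⊓ N, inf_le_right, rs Z hbN (r * rs Z le_top (β a)), ⟨⟨hz', (hb z g).1 hg⟩, hz⟩,
      fun z hz => ⟨C.toPlus a, g, (hb z g).2 hz.1.2, ?_, .of_eq hz ?_⟩⟩
    · rw [plusMap_toPlus, plusMap_toPlus, plusMap_toPlus, ← map_mul, eqAt_toPlus_iff]
      exact ⟨W', hW', hz.1.1, e⟩
    · rw [plusMap_toPlus, plusMap_toPlus, ← map_mul, hom_mul, ← mul_assoc, rs_rs]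
      have := congrArg (rs Z hbN) hr
      rw [hom_mul, hom_one, rs_rs] at this
      rw [this, one_mul]
  choose N' hN' t hz ht using loc
  obtain ⟨T, hT, -⟩ := existsUnique_glue (fun z : N => N' z.1 z.2) (fun z => hN' _ _)
    (fun z hz' => ⟨⟨z, hz'⟩, hz _ _⟩) (fun z => t z.1 z.2) fun i j => by
      rw [← toPlus_eq_iff]
      refine eq_of_eqAt fun z hz => ?_
      have hi : z ∈ N' i.1 i.2 := hz.1
      have hj : z ∈ N' j.1 j.2 := hz.2
      have hz' : z ∈ N' i.1 i.2 ⊓ N' j.1 j.2 := hz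
      have h1 := ht i.1 i.2 z hi
      have h2 := ht j.1 j.2 z hj
      rw [← sameFrac_rs_iff (le_refl W) inf_le_left (hN z (hN' _ _ hi)) (hV z) hz'] at h1
      rw [← sameFrac_rs_iff (le_refl W) inf_le_right (hN z (hN' _ _ hi)) (hV z) hz'] at h2
      rw [← plusMap_toPlus, ← plusMap_toPlus]
      exact h1.eqAt hα hb h2
  refine ⟨T, fun z hz' => ?_⟩
  have h1 := ht z hz' z (hz z hz')
  rw [← sameFrac_rs_iff (le_refl W) (hN' z hz') (hN z hz') (hV z) (hz z hz'), plusMap_toPlus,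
    plusMap_toPlus, hT ⟨z, hz'⟩, rs_self]
  exact h1

/-- Morphisms from a locally blueprinted space to a chart can be given on the blueprint of the
chart. -/
theorem IsChart.exists_hom (hα : IsChart α) (hZ : ∀ z : Z, LocalAt z) (β : C ⟶ sec Z ⊤) :
    ∃ f : Z ⟶ Y, IsLocalMorphism f ∧ ∃ h : ∀ z ∈ (⊤ : Opens Z), f.hom.base z ∈ V,
      ∀ c, pb f h (α c) = β c := by
  have hpt : ∀ z : Z, ∃ y ∈ V, ∀ c, UnitAt y (α c) ↔ UnitAt z (β c) := fun z => by
    -- The image of `z` is the point of the chart whose prime ideal is the inverse image under `β`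
    -- of the sections not invertible at `z`.
    obtain ⟨P, hP⟩ := hZ z ⊤ trivial
    obtain ⟨y, hy, h⟩ := hα.exists_point (P.comap β)
    exact ⟨y, hy, fun c => (h c).symm.trans (hP _)⟩
  choose b hV hb using hpt
  have hc : Continuous b := continuous_iff_continuousAt.2 fun z => by
    rw [ContinuousAt, tendsto_nhds]
    intro W hW hz
    obtain ⟨c, hc, h⟩ := hα.exists_basic (b z) (hV z) ⟨W, hW⟩ hz
    refine Filter.mem_of_superset ((unitLocus (β c)).2.mem_nhds ((hb z c).1 hc)) fun z' hz' => ?_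
    exact h _ ((hb z' c).2 hz')
  let pre : Opens Y → Opens Z := fun W => ⟨b ⁻¹' W, W.2.preimage hc⟩
  have hpre : ∀ W, ∀ z ∈ pre W, b z ∈ W := fun W z hz => hz
  choose φ hφ using fun (W : Opens Y) (s : sec Y W) =>
    exists_sameFrac (N := pre W) hα hb hV hc (hpre W) s
  have uniq : ∀ (W : Opens Y) (N : Opens Z) (x : (sec Y W).Plus) (t t' : (sec Z N).Plus),
      (∀ z ∈ N, SameFrac α β b z x t) → (∀ z ∈ N, SameFrac α β b z x t') → t = t' :=
    fun W N x t t' h h' => eq_of_eqAt fun z hz => (h z hz).eqAt hα hb (h' z hz)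
  have uniq' : ∀ (W : Opens Y) (N : Opens Z) (x : (sec Y W).Plus) (t t' : sec Z N),
      (∀ z ∈ N, SameFrac α β b z x ((sec Z N).toPlus t)) →
      (∀ z ∈ N, SameFrac α β b z x ((sec Z N).toPlus t')) → t = t' :=
    fun W N x t t' h h' => (toPlus_eq_iff _ _ _).1 (uniq W N x _ _ h h')
  let ψ : ∀ W : Opens Y, sec Y W →*₀ sec Z (pre W) := fun W =>
    { toFun := φ W
      map_zero' := uniq' W _ 0 _ _ (fun z hz => by rw [← toPlus_zero]; exact hφ W 0 z hz)
        fun z hz => by rw [toPlus_zero]; exact .zero hz (hV z) hz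
      map_one' := uniq' W _ 1 _ _ (fun z hz => by
          rw [← map_one (sec Y W).toPlus]; exact hφ W 1 z hz)
        fun z hz => by rw [map_one]; exact .one hz (hV z) hz
      map_mul' := fun s s' => uniq' W _ _ _ _ (hφ W (s * s')) fun z hz => by
        rw [map_mul, map_mul]
        exact (hφ W s z hz).mul (hφ W s' z hz) }
  have hψ : ∀ (W : Opens Y) (x : MonoidAlgebra ℕ (sec Y W)), ∀ z ∈ pre W,
      SameFrac α β b z ((sec Y W).plusMk x) ((sec Z (pre W)).plusMk
        (MonoidAlgebra.mapDomainRingHom ℕ (ψ W : sec Y W →* sec Z (pre W)) x)) := by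
    intro W x z hz
    induction x using MonoidAlgebra.induction_linear with
    | zero =>
      rw [map_zero, map_zero, map_zero]
      exact .zero hz (hV z) hz
    | add x y hx hy =>
      rw [map_add, map_add, map_add]
      exact hx.add hy
    | single s n =>
      rw [mapDomainRingHom_single, plusMk_single, plusMk_single]
      induction n with
      | zero =>
        rw [zero_smul, zero_smul]
        exact .zero hz (hV z) hz
      | succ n ih =>
        rw [succ_nsmul, succ_nsmul]
        exact ih.add (hφ W s z hz)
  -- Related sums have the same class in `𝒪_Y(W)⁺`. Their images are both transports of this class,
  -- hence equal.
  let χ : ∀ W : Opens Y, sec Y W ⟶ sec Z (pre W) := fun W => Hom.mk (ψ W) fun x y hxy => by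
    rw [← plusMk_eq_iff] at hxy ⊢
    refine uniq W _ _ _ _ (hψ W x) fun z hz => ?_
    rw [hxy]
    exact hψ W y z hz
  have hχ : ∀ (W : Opens Y) (s : sec Y W), ∀ z ∈ pre W,
      SameFrac α β b z ((sec Y W).toPlus s) ((sec Z (pre W)).toPlus (χ W s)) := hφ
  have hnat : ∀ (W W' : Opens Y) (h : W' ≤ W) (s : sec Y W),
      χ W' (rs Y h s) = rs Z (show pre W' ≤ pre W from fun z hz => h hz) (χ W s) := by
    intro W W' h s
    refine uniq' W' _ _ _ _ (hχ W' _) fun z hz => ?_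
    rw [← plusMap_toPlus, ← plusMap_toPlus]
    exact (sameFrac_rs_iff h _ hz (hV z) hz).2 (hχ W s z (h hz))
  let f : Z ⟶ Y := InducedCategory.homMk
    { base := TopCat.ofHom ⟨b, hc⟩
      c :=
        { app := fun W => χ W.unop
          naturality := fun W W' i => Blueprint.hom_ext fun s => hnat W.unop W'.unop i.unop.le s } }
  have hf : ∀ (W : Opens Y) (N : Opens Z) (h : ∀ z ∈ N, f.hom.base z ∈ W) (s : sec Y W), ∀ z ∈ N,
      SameFrac α β b z ((sec Y W).toPlus s) ((sec Z N).toPlus (pb f h s)) := by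
    intro W N h s z hz
    have h' : N ≤ pre W := h
    have : pb f h s = rs Z h' (χ W s) := rfl
    rw [this, ← plusMap_toPlus, ← rs_self (le_refl W) s, ← plusMap_toPlus]
    refine (sameFrac_rs_iff le_rfl h' (h z hz) (hV z) hz).2 ?_
    rw [rs_self]
    exact hχ W s z (h z hz)
  have hfV : ∀ z ∈ (⊤ : Opens Z), f.hom.base z ∈ V := fun z _ => hV z
  have hfβ : ∀ c, pb f hfV (α c) = β c := fun c => by
    refine uniq' V _ _ _ _ (hf V ⊤ hfV (α c)) fun z hz => ?_
    have := SameFrac.of_image (α := α) (β := β) (b := b) (N := ⊤) (hV z) (hV z) hz le_rfl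
      (C.toPlus c)
    rwa [plusMap_toPlus, plusMap_toPlus, plusMap_toPlus, plusMap_toPlus, rs_self, rs_self] at this
  refine ⟨f, (isLocalMorphism_iff f).2 fun W s N h z hz => ⟨fun hu => ?_, fun hu => hu.pb f h hz⟩,
    hfV, hfβ⟩
  have hWV : W ⊓ V ≤ V := inf_le_right
  have hWW : W ⊓ V ≤ W := inf_le_left
  have hfN : ∀ z ∈ N, f.hom.base z ∈ W ⊓ V := fun z hz => ⟨h z hz, hV z⟩
  -- With `s = a / g` near `b z`, invertibility of the pullback of `s` makes `β a` invertible at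
  -- `z`; hence `α a`, and with it `s`, is invertible at `b z`.
  obtain ⟨a, g, hg, e⟩ := hα.exists_frac (b z) (W ⊓ V) hWV (hfN z hz) (rs Y hWW s)
  have key : ∀ c, pb f hfN (rs Y hWV (α c)) = rs Z le_top (β c) := fun c => by
    rw [← hfβ, rs_pb_apply, pb_rs_apply]
  have e' := EqAt.pb f hfN hz e
  rw [plusMap_toPlus, plusMap_toPlus, key, hom_mul, key, pb_rs_apply] at e'
  have ha : UnitAt (b z) (α a) := by
    rw [hb, ← unitAt_rs_iff le_top hz]
    refine UnitAt.congr (unitAt_mul_iff.2 ⟨?_, hu⟩) e'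
    rwa [unitAt_rs_iff le_top hz, ← hb]
  have := UnitAt.congr ((unitAt_rs_iff hWV (hfN z hz)).2 ha) e.symm
  exact (unitAt_rs_iff hWW (hfN z hz)).1 (unitAt_mul_iff.1 this).2

end Adjunction

/-! ### Charts as open immersions of spectra, affine open sets, localized charts -/

section Charts

variable {X Y Z : BlueprintedSpace.{u}} {C D : Blueprint.{u}} {U : Opens Z}

/-- A local morphism that identifies a chart with a chart is an open immersion. -/
theorem IsChart.isOpenImmersion {V : Opens Y} {α : C ⟶ sec Y V} (hα : IsChart α)
    {β : C ⟶ sec Z ⊤} (hβ : IsChart β) {f : Z ⟶ Y} (hf : IsLocalMorphism f)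
    (h : ∀ z ∈ (⊤ : Opens Z), f.hom.base z ∈ V) (hfβ : ∀ c, pb f h (α c) = β c) :
    SheafedSpace.IsOpenImmersion f ∧ ∀ y ∈ V, ∃ z, f.hom.base z = y := by
  have hb : ∀ z c, UnitAt (f.hom.base z) (α c) ↔ UnitAt z (β c) := fun z c => by
    rw [← hf.unitAt_iff (h := h) (y := z) trivial, hfβ]
  have hinj : Function.Injective f.hom.base := fun z z' e =>
    hβ.point_unique z trivial z' trivial fun c => by rw [← hb, ← hb, e]
  have hsurj : ∀ y ∈ V, ∃ z, f.hom.base z = y := fun y hy => by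
    obtain ⟨P, hP⟩ := hα.exists_prime y hy
    obtain ⟨z, -, hz⟩ := hβ.exists_point P
    exact ⟨z, hα.point_unique _ (h z trivial) y hy fun c =>
      (hb z c).trans ((hz c).symm.trans (hP c))⟩
  have hcont : Continuous f.hom.base := f.hom.base.hom.continuous
  -- The image of the invertibility locus of `β c` is that of `α c`, and these loci form bases.
  have hopen : IsOpenMap f.hom.base := fun W hW => by
    refine isOpen_iff_forall_mem_open.2 ?_
    rintro _ ⟨z, hz, rfl⟩
    obtain ⟨c, hc, h'⟩ := hβ.exists_basic z trivial ⟨W, hW⟩ hz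
    refine ⟨unitLocus (α c), fun y hy => ?_, (unitLocus (α c)).2, (hb z c).2 hc⟩
    obtain ⟨z', rfl⟩ := hsurj y (unitLocus_le _ hy)
    exact ⟨z', h' z' ((hb z' c).1 hy), rfl⟩
  have hemb : Topology.IsOpenEmbedding f.hom.base :=
      .of_continuous_injective_isOpenMap hcont hinj hopen
  refine ⟨⟨hemb, fun W => ?_⟩, hsurj⟩
  have hβ' : ∀ (W : Opens Y) (N : Opens Z) (hN : ∀ z ∈ N, f.hom.base z ∈ W) (hW : W ≤ V) (c : C),
      pb f hN (rs Y hW (α c)) = rs Z le_top (β c) := fun W N hN hW c => by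
    rw [← hfβ, rs_pb_apply, pb_rs_apply]
  -- Write `x` and `y` as fractions of elements of `C⁺`. Equality of the pullbacks gives an equation
  -- in `C⁺` up to a denominator, because `β` is a chart, and `α` carries this equation back to `Y`.
  have hEq : ∀ (W : Opens Y) (N : Opens Z) (hN : ∀ z ∈ N, f.hom.base z ∈ W) (hW : W ≤ V)
      (x y : (sec Y W).Plus) (z : Z), z ∈ N → EqAt z (plusMap (pb f hN) x) (plusMap (pb f hN) y) →
        EqAt (f.hom.base z) x y := by
    intro W N hN hW x y z hz e
    obtain ⟨a, g, hg, ea⟩ := hα.exists_frac_plus_univ hW (hN z hz) x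
    obtain ⟨a', g', hg', ea'⟩ := hα.exists_frac_plus_univ hW (hN z hz) y
    have key : ∀ x : C.Plus, plusMap (pb f hN) (plusMap (rs Y hW) (plusMap α x)) =
        plusMap (rs Z le_top) (plusMap β x) := fun x => by
      rw [← plusMap_comp, ← plusMap_comp, ← plusMap_comp]
      exact congrArg (fun χ => plusMap χ x) (Blueprint.hom_ext fun c => hβ' W N hN hW c)
    have h1 := EqAt.pb f hN hz ea
    have h2 := EqAt.pb f hN hz ea'
    rw [key, map_mul, plusMap_toPlus, hβ'] at h1 h2
    have h3 : EqAt z (plusMap β (C.toPlus g' * a)) (plusMap β (C.toPlus g * a')) := by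
      rw [← eqAt_rs_iff (le_top : N ≤ ⊤) hz]
      simp only [map_mul, plusMap_toPlus]
      refine (h1.symm.mul_left _).trans (.trans (.of_eq hz (mul_left_comm _ _ _)) (.trans ?_
        (h2.mul_left _)))
      exact (e.mul_left _).mul_left _
    obtain ⟨k, hk, e'⟩ := hβ.exists_eq _ _ _ h3
    have hu : UnitAt (f.hom.base z) (rs Y hW (α (k * g' * g))) := by
      rw [unitAt_rs_iff hW (hN z hz), hom_mul, hom_mul, unitAt_mul_iff, unitAt_mul_iff]
      exact ⟨⟨(hb z k).2 hk, hg'⟩, hg⟩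
    refine EqAt.cancel hu ?_
    have e'' := congrArg (fun x => plusMap (rs Y hW) (plusMap α x)) e'
    simp only [map_mul, plusMap_toPlus] at e'' ⊢
    have hz' := hN z hz
    refine EqAt.trans (.of_eq hz' (mul_assoc _ _ _)) ((ea.mul_left _).trans
      (.trans (.of_eq hz' ?_) ((ea'.symm.mul_left ((sec Y W).toPlus (rs Y hW (α k)) *
        (sec Y W).toPlus (rs Y hW (α g)))).trans (.of_eq hz' ?_))))
    · rw [mul_assoc, e'', mul_assoc]
    · ring
  have hinj' : ∀ (W : Opens Y) (N : Opens Z) (hN : ∀ z ∈ N, f.hom.base z ∈ W),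
      W ≤ V → (∀ y ∈ W, ∃ z ∈ N, f.hom.base z = y) → Function.Injective (plusMap (pb f hN)) := by
    intro W N hN hW hNW x y e
    refine eq_of_eqAt fun y hy => ?_
    obtain ⟨z, hz, rfl⟩ := hNW y hy
    exact hEq W N hN hW _ _ z hz (.of_eq hz e)
  have hI : ∀ (W : Opens Y) (N : Opens Z) (hN : ∀ z ∈ N, f.hom.base z ∈ W),
      W ≤ V → (∀ y ∈ W, ∃ z ∈ N, f.hom.base z = y) → IsIso (pb f hN) := by
    intro W N hN hW hNW
    refine Blueprint.isIso_of_surjective (fun t => ?_) (hinj' W N hN hW hNW)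
    -- Locally `t = β a / β g`, and `α a / α g` is a preimage. By injectivity these preimages glue.
    have loc : ∀ y ∈ W, ∃ (W' : Opens Y) (_ : W' ≤ W) (s : sec Y W') (N' : Opens Z)
        (hN' : ∀ z ∈ N', f.hom.base z ∈ W') (hN'N : N' ≤ N), y ∈ W' ∧
          (∀ y ∈ W', ∃ z ∈ N', f.hom.base z = y) ∧ pb f hN' s = rs Z hN'N t := by
      intro y hy
      obtain ⟨z, hz, rfl⟩ := hNW y hy
      obtain ⟨a, g, hg, e⟩ := hβ.exists_frac z N le_top hz t
      rw [eqAt_toPlus_iff] at e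
      obtain ⟨N₁, hN₁, hz₁, e⟩ := e
      let N' : Opens Z := N₁ ⊓ unitLocus (β g)
      let W' : Opens Y := ⟨_, hopen N' N'.2⟩
      have hN'N₁ : N' ≤ N₁ := inf_le_left
      have hW'W : W' ≤ W := by
        rintro _ ⟨z, hz, rfl⟩
        exact hN z (hN₁ hz.1)
      have hN' : ∀ z ∈ N', f.hom.base z ∈ W' := fun z hz => ⟨z, hz, rfl⟩
      have hW' : W' ≤ V := hW'W.trans hW
      have hu : IsUnit (rs Y hW' (α g)) := isUnit_rs_of_unitAt hW' (by
        rintro _ ⟨z, hz, rfl⟩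
        exact (hb z g).2 hz.2)
      obtain ⟨r, hr⟩ := hu.exists_left_inv
      refine ⟨W', hW'W, r * rs Y hW' (α a), N', hN', hN'N₁.trans hN₁, ⟨z, ⟨hz₁, hg⟩, rfl⟩,
        fun y hy => hy, ?_⟩
      have e' := congrArg (rs Z hN'N₁) e
      rw [rs_rs, rs_rs, hom_mul, rs_rs, rs_rs] at e'
      have hr' := congrArg (pb f hN') hr
      rw [hom_mul, hom_one, hβ'] at hr'
      rw [hom_mul, hβ', ← e', ← mul_assoc, hr', one_mul]
    choose W' hW' s N' hN' hN'N hy hN'W' hs using loc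
    obtain ⟨S, hS, -⟩ := existsUnique_glue (fun y : W => W' y.1 y.2) (fun y => hW' _ _)
      (fun y hy' => ⟨⟨y, hy'⟩, hy _ _⟩) (fun y => s y.1 y.2) fun i j => by
        have hij : ∀ y ∈ W' i.1 i.2 ⊓ W' j.1 j.2, ∃ z ∈ N' i.1 i.2 ⊓ N' j.1 j.2,
            f.hom.base z = y := fun y hy => by
          obtain ⟨z, hz, e⟩ := hN'W' i.1 i.2 y hy.1
          obtain ⟨z', hz', e'⟩ := hN'W' j.1 j.2 y hy.2
          obtain rfl := hinj (e.trans e'.symm)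
          exact ⟨z, ⟨hz, hz'⟩, e⟩
        have hN'' : ∀ z ∈ N' i.1 i.2 ⊓ N' j.1 j.2, f.hom.base z ∈ W' i.1 i.2 ⊓ W' j.1 j.2 :=
          fun z hz => ⟨hN' _ _ z hz.1, hN' _ _ z hz.2⟩
        rw [← toPlus_eq_iff]
        refine hinj' _ _ hN'' (inf_le_left.trans ((hW' _ _).trans hW)) hij ?_
        have h1 := congrArg (rs Z (inf_le_left : N' i.1 i.2 ⊓ N' j.1 j.2 ≤ _)) (hs i.1 i.2)
        have h2 := congrArg (rs Z (inf_le_right : N' i.1 i.2 ⊓ N' j.1 j.2 ≤ _)) (hs j.1 j.2)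
        rw [rs_pb_apply, rs_rs] at h1 h2
        rw [plusMap_toPlus, plusMap_toPlus, pb_rs_apply, pb_rs_apply, h1, h2]
    refine ⟨S, sec_ext fun z hz => ⟨N' _ (hN z hz), hN'N _ _, ?_, ?_⟩⟩
    · obtain ⟨z', hz', e⟩ := hN'W' _ (hN z hz) _ (hy _ (hN z hz))
      exact (hinj e) ▸ hz'
    · rw [rs_pb_apply, ← hs, ← hS ⟨_, hN z hz⟩, pb_rs_apply]
  have e : (Opens.map f.hom.base).obj (hemb.functor.obj W) = W := by
    ext z
    exact ⟨fun ⟨z', hz', e⟩ => hinj e ▸ hz', fun hz => ⟨z, hz, rfl⟩⟩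
  have h0 : hemb.functor.obj W ≤ V := by
    rintro _ ⟨z, hz, rfl⟩
    exact h z trivial
  have h1 : IsIso (pb f (V := hemb.functor.obj W) (W := (Opens.map f.hom.base).obj
      (hemb.functor.obj W)) fun z hz => hz) := hI _ _ _ h0 (by
    rintro _ ⟨z, hz, rfl⟩
    exact ⟨z, ⟨z, hz, rfl⟩, rfl⟩)
  have h2 : pb f (V := hemb.functor.obj W) (W := (Opens.map f.hom.base).obj
      (hemb.functor.obj W)) (fun z hz => hz) = f.hom.c.app (op (hemb.functor.obj W)) :=
    (congrArg (f.hom.c.app (op (hemb.functor.obj W)) ≫ ·) (rs_eq_id le_rfl)).trans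
      (Category.comp_id _)
  rwa [h2] at h1

theorem IsChart.exists_immersion {α : C ⟶ sec Z U} (hα : IsChart α) :
    ∃ (j : specSpace C ⟶ Z) (_ : SheafedSpace.IsOpenImmersion j)
      (h : ∀ y ∈ (⊤ : Opens (specSpace C)), j.hom.base y ∈ U),
      (∀ z ∈ U, ∃ y, j.hom.base y = z) ∧ ∀ c, pb j h (α c) = toGlobal C c := by
  obtain ⟨j, hj, h, e⟩ := hα.exists_hom (fun z => (spec_isChart C).localAt (U := ⊤) trivial)
    (toGlobal C)
  obtain ⟨h1, h2⟩ := hα.isOpenImmersion (spec_isChart C) hj h e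
  exact ⟨j, h1, h, h2, e⟩

theorem isIso_of_openImmersion_surjective (j : Y ⟶ Z) [SheafedSpace.IsOpenImmersion j]
    (h : Function.Surjective j.hom.base) : IsIso j := by
  have : Epi j.hom.base := (TopCat.epi_iff_surjective _).2 h
  exact SheafedSpace.IsOpenImmersion.to_iso j

/-- The open subspace of a blueprinted space. -/
abbrev openSub (Z : BlueprintedSpace.{u}) (U : Opens Z) : BlueprintedSpace.{u} :=
  Z.restrict U.isOpenEmbedding

/-- The inclusion of an open subspace. -/
abbrev incl (Z : BlueprintedSpace.{u}) (U : Opens Z) : openSub Z U ⟶ Z :=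
  Z.ofRestrict U.isOpenEmbedding

theorem exists_incl {z : Z} (hz : z ∈ U) : ∃ y, (incl Z U).hom.base y = z := ⟨⟨z, hz⟩, rfl⟩

theorem exists_lift (j : Y ⟶ Z) [SheafedSpace.IsOpenImmersion j] (f : X ⟶ Z)
    (h : ∀ x, ∃ y, j.hom.base y = f.hom.base x) : ∃ g : X ⟶ Y, g ≫ j = f := by
  have H : Set.range f.hom.base ⊆ Set.range j.hom.base := by
    rintro _ ⟨x, rfl⟩
    exact h x
  exact ⟨InducedCategory.homMk (PresheafedSpace.IsOpenImmersion.lift j.hom f.hom H),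
    InducedCategory.hom_ext (PresheafedSpace.IsOpenImmersion.lift_fac j.hom f.hom H)⟩

theorem isLocalMorphism_of_comp {f : X ⟶ Y} (j : Y ⟶ Z) [SheafedSpace.IsOpenImmersion j]
    (h : IsLocalMorphism (f ≫ j)) : IsLocalMorphism f := by
  refine (isLocalMorphism_iff f).2 fun W s N hN x hx => ⟨fun hu => ?_, fun hu => hu.pb f hN hx⟩
  have hW : ∀ y ∈ W, j.hom.base y ∈ imageOpen j W := fun y hy => ⟨y, hy, rfl⟩
  have := isIso_pb j hW fun z hz => hz
  obtain ⟨s, rfl⟩ := surjective_of_isIso (pb j hW) s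
  have h'' : ∀ x ∈ N, (f ≫ j).hom.base x ∈ imageOpen j W := fun x hx => hW _ (hN x hx)
  have e : pb f hN (pb j hW s) = pb (f ≫ j) h'' s := (pb_comp_apply f j hW hN h'' s).symm
  have hu' : UnitAt x (pb (f ≫ j) h'' s) := e ▸ hu
  exact (unitAt_pb_iff j (h := hW) (hN x hx)).2 ((h.unitAt_iff hx).1 hu')

theorem IsChart.nonempty_iso {α : C ⟶ sec Z U} (hα : IsChart α) :
    Nonempty (openSub Z U ≅ specSpace C) := by
  obtain ⟨j, hj, h, hs, e⟩ := hα.exists_immersion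
  have H : Set.range j.hom.base = Set.range (incl Z U).hom.base := by
    ext z
    constructor
    · rintro ⟨y, rfl⟩
      exact exists_incl (h y trivial)
    · rintro ⟨y, rfl⟩
      exact hs _ y.2
  have h' : SheafedSpace.IsOpenImmersion (incl Z U) := inferInstance
  exact ⟨SheafedSpace.isoMk
    (PresheafedSpace.IsOpenImmersion.isoOfRangeEq j.hom (incl Z U).hom H).symm⟩

theorem IsChart.iso_comp {α : C ⟶ sec Z U} (hα : IsChart α) (e : D ⟶ C) [IsIso e] :
    IsChart (e ≫ α) := by
  have hs := surjective_of_isIso e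
  have hinv : ∀ c, e (inv e c) = c := fun c => by
    rw [← Blueprint.comp_apply, IsIso.inv_hom_id, Blueprint.id_apply]
  refine ⟨fun z hz => ?_, fun P => ?_, fun z hz z' hz' h => ?_, fun z hz W hW => ?_,
    fun z W hW hz s => ?_, fun z x y h => ?_⟩
  · obtain ⟨P, hP⟩ := hα.exists_prime z hz
    exact ⟨P.comap e, fun c => hP _⟩
  · obtain ⟨z, hz, h⟩ := hα.exists_point (P.comap (inv e))
    refine ⟨z, hz, fun c => Iff.trans ?_ (h _)⟩
    change _ ↔ inv e (e c) ∉ P.ideal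
    rw [← Blueprint.comp_apply, IsIso.hom_inv_id, Blueprint.id_apply]
  · refine hα.point_unique z hz z' hz' fun c => ?_
    obtain ⟨c, rfl⟩ := hs c
    exact h c
  · obtain ⟨c, hc, h⟩ := hα.exists_basic z hz W hW
    obtain ⟨c, rfl⟩ := hs c
    exact ⟨c, hc, h⟩
  · obtain ⟨a, f, hf, h⟩ := hα.exists_frac z W hW hz s
    obtain ⟨a, rfl⟩ := hs a
    obtain ⟨f, rfl⟩ := hs f
    exact ⟨a, f, hf, h⟩
  · rw [plusMap_comp, plusMap_comp] at h
    obtain ⟨f, hf, h⟩ := hα.exists_eq z _ _ h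
    obtain ⟨f, rfl⟩ := hs f
    refine ⟨f, hf, plusMap_injective_of_isIso e ?_⟩
    rwa [map_mul, map_mul, plusMap_toPlus]

theorem isChart_incl_iff {W : Opens Z} (hW : W ≤ U) (α : C ⟶ sec Z W) :
    IsChart (α ≫ pb (incl Z U) (W := (Opens.map (incl Z U).hom.base).obj W) fun _ h => h) ↔
      IsChart α :=
  isChart_comp_pb_iff _ _ (fun z hz => ⟨(⟨z, hW hz⟩ : U), hz, rfl⟩) α

theorem isChart_incl_top_iff (α : C ⟶ sec Z U) :
    IsChart (α ≫ pb (incl Z U) (W := ⊤) fun y _ => y.2) ↔ IsChart α :=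
  isChart_comp_pb_iff (incl Z U) (V := ⊤) (fun (y : openSub Z U) _ => y.2)
    (fun z hz => ⟨(⟨z, hz⟩ : U), trivial, rfl⟩) α

theorem exists_isChart_of_iso (e : openSub Z U ≅ specSpace C) : ∃ α : C ⟶ sec Z U, IsChart α := by
  have h1 : IsChart (toGlobal C ≫ pb e.hom (V := ⊤) (W := ⊤) fun _ _ => trivial) :=
    (isChart_comp_pb_iff e.hom (V := ⊤) _ (fun z _ => ⟨e.inv.hom.base z, trivial,
      congrArg (fun f : specSpace C ⟶ specSpace C => f.hom.base z) e.inv_hom_id⟩) _).2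
        (spec_isChart C)
  have h2 : IsIso (pb (incl Z U) (V := U) (W := ⊤) fun y _ => y.2) :=
    isIso_pb _ _ fun z hz => ⟨⟨z, hz⟩, trivial, rfl⟩
  refine ⟨(toGlobal C ≫ pb e.hom (V := ⊤) (W := ⊤) fun _ _ => trivial) ≫
    inv (pb (incl Z U) (V := U) (W := ⊤) fun y _ => y.2), ?_⟩
  rw [← isChart_incl_top_iff, Category.assoc, IsIso.inv_hom_id, Category.comp_id]
  exact h1

/-- The compatibility demanded in `IsAffine` says that the isomorphism carries the chart `toGlobal`
to the identity. Conversely, a chart of the whole space is an open immersion of a spectrum onto it.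
-/
theorem isAffine_iff : IsAffine Z ↔ IsChart (𝟙 (sec Z ⊤)) := by
  have hpb : ∀ {Y Z : BlueprintedSpace.{u}} (f : Y ⟶ Z), pb f (V := ⊤) (W := ⊤)
      (fun _ _ => trivial) = f.hom.c.app (op ⊤) := fun f =>
    (congrArg (f.hom.c.app (op ⊤) ≫ ·) (rs_eq_id le_rfl)).trans (Category.comp_id _)
  constructor
  · rintro ⟨φ, h⟩
    have h1 : IsChart (toGlobal (sec Z ⊤) ≫ pb φ.hom (V := ⊤) (W := ⊤) fun _ _ => trivial) :=
      (isChart_comp_pb_iff φ.hom (V := ⊤) _ (fun z _ => ⟨φ.inv.hom.base z, trivial,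
        congrArg (fun f : specSpace _ ⟶ specSpace _ => f.hom.base z) φ.inv_hom_id⟩) _).2
          (spec_isChart _)
    rw [hpb] at h1
    exact (congrArg (fun χ : sec Z ⊤ ⟶ sec Z ⊤ => IsChart χ) h).mp h1
  · intro h
    obtain ⟨j, hj, hjU, hs, e⟩ := h.exists_immersion
    have : IsIso j := isIso_of_openImmersion_surjective j fun z => hs z trivial
    refine ⟨(asIso j).symm, ?_⟩
    have e' : toGlobal (sec Z ⊤) = pb j hjU := Blueprint.hom_ext fun c => (e c).symm
    have h1 := pb_comp (asIso j).symm.hom j (U := ⊤) (V := ⊤) (W := ⊤) (fun _ _ => trivial)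
      (fun _ _ => trivial) (fun _ _ => trivial)
    rw [← hpb, e']
    refine h1.symm.trans ?_
    have h2 : (asIso j).symm.hom ≫ j = 𝟙 Z := IsIso.inv_hom_id j
    have h3 : ∀ f : Z ⟶ Z, f = 𝟙 Z → pb f (V := ⊤) (W := ⊤) (fun _ _ => trivial) = 𝟙 _ := by
      rintro _ rfl
      exact (pb_id le_rfl).trans (rs_eq_id le_rfl)
    exact h3 _ h2

theorem isAffine_openSub_iff : IsAffine (openSub Z U) ↔ IsChart (𝟙 (sec Z U)) := by
  have h2 : IsIso (pb (incl Z U) (V := U) (W := ⊤) fun y _ => y.2) :=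
    isIso_pb _ _ fun z hz => ⟨⟨z, hz⟩, trivial, rfl⟩
  rw [isAffine_iff, ← isChart_incl_top_iff (U := U) (𝟙 (sec Z U)), Category.id_comp]
  constructor
  · intro h
    have := h.iso_comp (pb (incl Z U) (V := U) (W := ⊤) fun y _ => y.2)
    exact (congrArg (fun χ => IsChart χ) (Category.comp_id _)).mp this
  · intro h
    have := h.iso_comp (inv (pb (incl Z U) (V := U) (W := ⊤) fun y _ => y.2))
    rwa [IsIso.inv_hom_id] at this

theorem IsChart.isAffine {α : C ⟶ sec Z U} (hα : IsChart α) [IsIso α] :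
    IsAffine (openSub Z U) := by
  rw [isAffine_openSub_iff]
  have := hα.iso_comp (inv α)
  rwa [IsIso.inv_hom_id] at this

theorem IsChart.of_isAffine (h : IsAffine (openSub Z U)) (α : C ⟶ sec Z U) [IsIso α] :
    IsChart α := by
  have := (isAffine_openSub_iff.1 h).iso_comp α
  rwa [Category.comp_id] at this

/-- The chart on the locus of invertibility of an element. -/
def locChart (α : C ⟶ sec Z U) (h : C) :
    C.localization (Submonoid.powers h) ⟶ sec Z (unitLocus (α h)) :=
  locLift _ (α ≫ rs Z (unitLocus_le _)) (by
    rintro _ ⟨n, rfl⟩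
    rw [map_pow (Hom.toFun (α ≫ rs Z (unitLocus_le (α h))))]
    exact (isUnit_rs_of_unitAt _ fun z hz => hz).pow n)

theorem locChart_toLocalization (α : C ⟶ sec Z U) (h c : C) :
    locChart α h (C.toLocalization _ c) = rs Z (unitLocus_le _) (α c) :=
  locLift_toLocalization _ _ _ _

/-- The prime ideals of `C[h⁻¹]` are those of `C` that do not contain `h`, and each element of
`C[h⁻¹]` is an element of `C` up to a unit; all conditions reduce to those for `α`. -/
theorem IsChart.locChart {α : C ⟶ sec Z U} (hα : IsChart α) (h : C) :
    IsChart (locChart α h) := by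
  let S := Submonoid.powers h
  have hu : ∀ z ∈ unitLocus (α h), ∀ c, UnitAt z (Blue.locChart α h (C.toLocalization S c)) ↔
      UnitAt z (α c) := fun z hz c => by
    rw [locChart_toLocalization, unitAt_rs_iff _ hz]
  have hS : ∀ s ∈ S, IsUnit (C.toLocalization S s) := fun s hs => isUnit_toLocalization C S hs
  have hfrac : ∀ w, ∃ a s, s ∈ S ∧ C.toLocalization S s * w = C.toLocalization S a := fun w => by
    obtain ⟨a, s, hs, e⟩ := exists_toLocalization C S w
    exact ⟨a, s, hs, e⟩
  refine ⟨fun z hz => ?_, fun P => ?_, fun z hz z' hz' h' => ?_, fun z hz W hW => ?_,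
    fun z W hW hz s => ?_, fun z x y e => ?_⟩
  · obtain ⟨P, hP⟩ := hα.localAt (unitLocus_le _ hz) (unitLocus (α h)) hz
    exact ⟨P.comap (Blue.locChart α h), fun c => hP _⟩
  · obtain ⟨z, hz, hP⟩ := hα.exists_point (P.comap (C.toLocalization S))
    have hunit : ∀ w, IsUnit w → w ∉ P.ideal := fun w hw hwP => by
      obtain ⟨r, hr⟩ := hw.exists_left_inv
      exact P.one_notMem (hr ▸ P.mul_mem r w hwP)
    have hz' : z ∈ unitLocus (α h) := (hP h).1 (hunit _ (hS h (Submonoid.mem_powers h)))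
    refine ⟨z, hz', fun w => ?_⟩
    obtain ⟨a, s, hs, e⟩ := hfrac w
    have h1 : w ∉ P.ideal ↔ C.toLocalization S a ∉ P.ideal := by
      rw [← e, P.mul_notMem_iff]
      exact (and_iff_right (hunit _ (hS s hs))).symm
    have h2 : UnitAt z (Blue.locChart α h w) ↔
        UnitAt z (Blue.locChart α h (C.toLocalization S a)) := by
      rw [← e, hom_mul, unitAt_mul_iff]
      exact (and_iff_right (unitAt_of_isUnit hz' (isUnit_map _ (hS s hs)))).symm
    rw [h1, h2, hu z hz']
    exact hP a
  · refine hα.point_unique z (unitLocus_le _ hz) z' (unitLocus_le _ hz') fun c => ?_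
    rw [← hu z hz, h', hu z' hz']
  · obtain ⟨c, hc, h'⟩ := hα.exists_basic z (unitLocus_le _ hz) W hW
    exact ⟨C.toLocalization S c, (hu z hz c).2 hc, fun z' hz' => h' z' ((hu z' hz'.mem c).1 hz')⟩
  · obtain ⟨a, f, hf, e⟩ := hα.exists_frac z W (hW.trans (unitLocus_le _)) hz s
    refine ⟨C.toLocalization S a, C.toLocalization S f, (hu z (hW hz) f).2 hf, ?_⟩
    rwa [locChart_toLocalization, locChart_toLocalization, rs_rs, rs_rs]
  · have hz := e.mem
    obtain ⟨x', s, hs, ex⟩ := exists_plusMap_toLocalization C S x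
    obtain ⟨y', t, ht, ey⟩ := exists_plusMap_toLocalization C S y
    have hcomp : ∀ x : C.Plus, plusMap (Blue.locChart α h) (plusMap (C.toLocalization S) x) =
        plusMap (rs Z (unitLocus_le _)) (plusMap α x) := fun x => by
      rw [← plusMap_comp, ← plusMap_comp]
      exact congrArg (fun χ => plusMap χ x)
        (Blueprint.hom_ext fun c => locChart_toLocalization _ _ _)
    have key : EqAt z (plusMap α (C.toPlus t * x')) (plusMap α (C.toPlus s * y')) := by
      rw [← eqAt_rs_iff (unitLocus_le _) hz, ← hcomp, ← hcomp,
        map_mul (plusMap (C.toLocalization S)),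
        map_mul (plusMap (C.toLocalization S)), ← ex, ← ey, plusMap_toPlus, plusMap_toPlus]
      simp only [map_mul]
      refine EqAt.trans (.of_eq hz (mul_left_comm _ _ _)) ((e.mul_left _).mul_left _)
    obtain ⟨f, hf, e'⟩ := hα.exists_eq z _ _ key
    refine ⟨C.toLocalization S (f * (t * s)), ?_, ?_⟩
    · rw [hu z hz, hom_mul, unitAt_mul_iff]
      refine ⟨hf, (hu z hz _).1 (unitAt_of_isUnit hz (isUnit_map _ (hS _ (S.mul_mem ht hs))))⟩
    · have := congrArg (plusMap (C.toLocalization S)) e'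
      simp only [map_mul, plusMap_toPlus] at this ⊢
      rw [← ex, ← ey] at this
      refine Eq.trans ?_ (this.trans ?_) <;> ring

end Charts

/-! ### Charts, stalks and open subschemes of blue schemes -/

namespace BlueScheme

theorem exists_isChart (X : BlueScheme.{u}) (x : X.toSpace) :
    ∃ (U : Opens X.toSpace) (_ : x ∈ U) (C : Blueprint.{u}) (α : C ⟶ sec X.toSpace U),
      IsChart α := by
  obtain ⟨U, hU, C, ⟨e⟩⟩ := X.exists_chart x
  obtain ⟨α, hα⟩ := exists_isChart_of_iso e
  exact ⟨U, hU, C, α, hα⟩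

theorem localAt (X : BlueScheme.{u}) (x : X.toSpace) : LocalAt x := by
  obtain ⟨U, hU, C, α, hα⟩ := X.exists_isChart x
  exact hα.localAt hU

/-- The open subscheme. -/
def openSubscheme (X : BlueScheme.{u}) (W : Opens X.toSpace) : BlueScheme.{u} where
  toSpace := openSub X.toSpace W
  exists_chart x := by
    obtain ⟨U, hU, C, α, hα⟩ := X.exists_isChart x.1
    obtain ⟨c, hc, h⟩ := hα.exists_basic x.1 hU W x.2
    have := (isChart_incl_iff (U := W) (W := unitLocus (α c)) (fun z hz => h z hz) _).2
      (hα.locChart c)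
    exact ⟨_, hc, _, this.nonempty_iso⟩

end BlueScheme

/-! ### Products with monoid blueprints -/

theorem pb_of_comp_eq {X Y Z : BlueprintedSpace.{u}} {f : X ⟶ Y} {g : Y ⟶ Z} {k : X ⟶ Z}
    (e : f ≫ g = k) {U : Opens Z} {V : Opens Y} {W : Opens X}
    (h : ∀ y ∈ V, g.hom.base y ∈ U) (h' : ∀ x ∈ W, f.hom.base x ∈ V)
    (h'' : ∀ x ∈ W, k.hom.base x ∈ U) (s : sec Z U) : pb k h'' s = pb f h' (pb g h s) := by
  subst e
  exact pb_comp_apply f g h h' h'' s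

theorem base_of_comp_eq {X Y Z : BlueprintedSpace.{u}} {f : X ⟶ Y} {g : Y ⟶ Z} {k : X ⟶ Z}
    (e : f ≫ g = k) (x : X) : k.hom.base x = g.hom.base (f.hom.base x) := by
  subst e
  rfl

namespace BlueScheme

theorem toHom_ext {X Y : BlueScheme.{u}} {f g : X ⟶ Y} (h : f.toHom = g.toHom) : f = g :=
  Hom.ext h

theorem comp_toHom {X Y Z : BlueScheme.{u}} (f : X ⟶ Y) (g : Y ⟶ Z) :
    f.toHom ≫ g.toHom = (f ≫ g).toHom := rfl

theorem hom_F1_ext {X : BlueScheme.{u}} (f g : X ⟶ Spec F1) : f = g :=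
  toHom_ext ((spec_isChart F1).hom_ext f.isLocal g.isLocal (fun _ _ => trivial)
    (fun _ _ => trivial) fun c => congrArg (fun χ : F1 ⟶ sec X.toSpace ⊤ => χ c)
      (F1_hom_ext (f := toGlobal F1 ≫ pb f.toHom (V := ⊤) (W := ⊤) fun _ _ => trivial)
        (g := toGlobal F1 ≫ pb g.toHom (V := ⊤) (W := ⊤) fun _ _ => trivial)))

variable {B : Blueprint.{u}} {M : Type u} [CommMonoidWithZero M]

/-- The functions on a product given by functions on the factors. -/
def prodChart {X Y Q : BlueScheme.{u}} (p : Q ⟶ X) (q : Q ⟶ Y) {U : Opens X.toSpace}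
    {V : Opens Y.toSpace} (α : monoidBlueprint F1 M ⟶ sec X.toSpace U) (β : B ⟶ sec Y.toSpace V)
    (W : Opens Q.toSpace) (hU : ∀ x ∈ W, p.toHom.hom.base x ∈ U)
    (hV : ∀ x ∈ W, q.toHom.hom.base x ∈ V) : monoidBlueprint B M ⟶ sec Q.toSpace W :=
  monoidLift (β ≫ pb q.toHom hV)
    ((Hom.toFun (α ≫ pb p.toHom hU)).comp (monomialHom F1 M))

theorem exists_openSubscheme (X : BlueScheme.{u}) (W : Opens X.toSpace) :
    ∃ (R : BlueScheme.{u}) (ι : R ⟶ X) (_ : SheafedSpace.IsOpenImmersion ι.toHom),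
      (∀ y ∈ (⊤ : Opens R.toSpace), ι.toHom.hom.base y ∈ W) ∧
        ∀ x ∈ W, ∃ y, ι.toHom.hom.base y = x :=
  have h : SheafedSpace.IsOpenImmersion (incl X.toSpace W) :=
    SheafedSpace.IsOpenImmersion.ofRestrict X.toSpace W.isOpenEmbedding
  ⟨X.openSubscheme W, ⟨incl X.toSpace W, @isLocalMorphism_of_isOpenImmersion _ _ _ h⟩, h,
    fun y _ => y.2, fun x hx => ⟨(⟨x, hx⟩ : W), rfl⟩⟩

/-- `B[M]` is the coproduct of `𝔽₁[M]` and `B`, so `Spec B[M]` has the universal property of the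
part of the fibre product over `U` and `V`. Morphisms into charts are determined by elements, which
yields mutually inverse morphisms between this part and `Spec B[M]`. -/
theorem isChart_prodChart {X Y Q : BlueScheme.{u}} {f : X ⟶ Spec F1} {g : Y ⟶ Spec F1}
    {p : Q ⟶ X} {q : Q ⟶ Y} (hQ : IsPullback p q f g) {U : Opens X.toSpace}
    {V : Opens Y.toSpace} {α : monoidBlueprint F1 M ⟶ sec X.toSpace U} {β : B ⟶ sec Y.toSpace V}
    (hα : IsChart α) (hβ : IsChart β) {W : Opens Q.toSpace}
    (hU : ∀ x ∈ W, p.toHom.hom.base x ∈ U) (hV : ∀ x ∈ W, q.toHom.hom.base x ∈ V)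
    (hW : ∀ x, p.toHom.hom.base x ∈ U → q.toHom.hom.base x ∈ V → x ∈ W) :
    IsChart (prodChart p q α β W hU hV) := by
  set γ := prodChart p q α β W hU hV with hγ
  let D := monoidBlueprint B M
  obtain ⟨S, σ, hσ⟩ : ∃ (S : BlueScheme.{u}) (σ : D ⟶ sec S.toSpace ⊤), IsChart σ :=
    ⟨Spec D, toGlobal D, spec_isChart D⟩
  obtain ⟨R, ι, hι, hιW, hιs⟩ := Q.exists_openSubscheme W
  obtain ⟨k, hk, hk', ek⟩ := hσ.exists_hom R.localAt (γ ≫ pb ι.toHom hιW)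
  let κ : R ⟶ S := ⟨k, hk⟩
  let ψ : monoidBlueprint F1 M ⟶ D := monoidLift (fromF1 D) (monomialHom B M)
  obtain ⟨a, ha, haU, ea⟩ := hα.exists_hom S.localAt (ψ ≫ σ)
  obtain ⟨b, hb, hbV, eb⟩ := hβ.exists_hom S.localAt (toMonoidBlueprint B M ≫ σ)
  let a' : S ⟶ X := ⟨a, ha⟩
  let b' : S ⟶ Y := ⟨b, hb⟩
  -- The pair of projections from `Spec B[M]`; it agrees over `Spec 𝔽₁` because morphisms to `Spec
  -- 𝔽₁` are unique.
  let θ : S ⟶ Q := hQ.lift a' b' (hom_F1_ext _ _)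
  have hθp : θ ≫ p = a' := hQ.lift_fst _ _ _
  have hθq : θ ≫ q = b' := hQ.lift_snd _ _ _
  have hθp' : θ.toHom ≫ p.toHom = a := congrArg Hom.toHom hθp
  have hθq' : θ.toHom ≫ q.toHom = b := congrArg Hom.toHom hθq
  have hθW : ∀ y ∈ (⊤ : Opens S.toSpace), θ.toHom.hom.base y ∈ W := fun y hy => by
    refine hW _ ?_ ?_
    · rw [← base_of_comp_eq hθp']
      exact haU y hy
    · rw [← base_of_comp_eq hθq']
      exact hbV y hy
  have hγα : ∀ m, γ (monomial 1 m) = pb p.toHom hU (α (monomial 1 m)) := fun m => by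
    rw [hγ, prodChart, monoidLift_monomial, hom_one, one_mul]
    rfl
  have hγβ : ∀ c, γ (toMonoidBlueprint B M c) = pb q.toHom hV (β c) := fun c =>
    congrArg (fun χ : B ⟶ sec Q.toSpace W => χ c) (toMonoidBlueprint_monoidLift _ _)
  have hψ : ∀ m, ψ (monomial 1 m) = monomial 1 m := fun m => by
    rw [monoidLift_monomial, hom_one, one_mul, monomialHom_apply]
  have hθγ : ∀ d, pb θ.toHom hθW (γ d) = σ d := by
    have : γ ≫ pb θ.toHom hθW = σ := monoidBlueprint_hom_ext (fun c => by
        rw [Blueprint.comp_apply, hγβ, ← pb_of_comp_eq hθq' hV hθW hbV]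
        exact eb c) fun m => by
      rw [Blueprint.comp_apply, hγα, ← pb_of_comp_eq hθp' hU hθW haU, ea, Blueprint.comp_apply, hψ]
    exact fun d => congrArg (fun χ : D ⟶ sec (S.toSpace) ⊤ => χ d) this
  have hκθ : κ ≫ θ = ι := by
    refine hQ.hom_ext ?_ ?_
    · rw [Category.assoc, hθp]
      have h1 : ∀ y ∈ (⊤ : Opens R.toSpace), (κ ≫ a').toHom.hom.base y ∈ U := fun y _ =>
        haU _ trivial
      have h2 : ∀ y ∈ (⊤ : Opens R.toSpace), (ι ≫ p).toHom.hom.base y ∈ U := fun y hy =>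
        hU _ (hιW y hy)
      refine toHom_ext (hα.hom_ext (κ ≫ a').isLocal (ι ≫ p).isLocal h1 h2 fun c => ?_)
      rw [pb_of_comp_eq (comp_toHom κ a') haU hk', pb_of_comp_eq (comp_toHom ι p) hU hιW, ea,
        Blueprint.comp_apply, ek, Blueprint.comp_apply]
      refine congrArg (pb ι.toHom hιW) ?_
      have : ψ ≫ γ = α ≫ pb p.toHom hU := monoidBlueprint_hom_ext (fun c => ?_) fun m => by
        rw [Blueprint.comp_apply, Blueprint.comp_apply, hψ, hγα]
      · exact congrArg (fun χ : _ ⟶ sec Q.toSpace W => χ c) this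
      · exact congrArg (fun χ : F1 ⟶ sec Q.toSpace W => χ c)
          (F1_hom_ext (f := toMonoidBlueprint F1 M ≫ ψ ≫ γ)
            (g := toMonoidBlueprint F1 M ≫ α ≫ pb p.toHom hU))
    · rw [Category.assoc, hθq]
      have h1 : ∀ y ∈ (⊤ : Opens R.toSpace), (κ ≫ b').toHom.hom.base y ∈ V := fun y _ =>
        hbV _ trivial
      have h2 : ∀ y ∈ (⊤ : Opens R.toSpace), (ι ≫ q).toHom.hom.base y ∈ V := fun y hy =>
        hV _ (hιW y hy)
      refine toHom_ext (hβ.hom_ext (κ ≫ b').isLocal (ι ≫ q).isLocal h1 h2 fun c => ?_)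
      rw [pb_of_comp_eq (comp_toHom κ b') hbV hk', pb_of_comp_eq (comp_toHom ι q) hV hιW, eb,
        Blueprint.comp_apply, ek, Blueprint.comp_apply, hγβ]
  -- `θ` has image in `W`; its factorization through `W` is the inverse of `k`.
  obtain ⟨θ', hθ'⟩ := exists_lift ι.toHom θ.toHom fun x => hιs _ (hθW x trivial)
  have hθ'l : IsLocalMorphism θ' := isLocalMorphism_of_comp ι.toHom (hθ' ▸ θ.isLocal)
  have h1 : k ≫ θ' = 𝟙 R.toSpace := by
    have : Mono ι.toHom := inferInstance
    rw [← cancel_mono ι.toHom, Category.assoc, hθ', Category.id_comp]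
    exact congrArg Hom.toHom hκθ
  have h2 : θ' ≫ k = 𝟙 (S.toSpace) := by
    refine hσ.hom_ext (isLocalMorphism_comp hθ'l hk) (isLocalMorphism_id _)
      (fun _ _ => trivial) (fun _ _ => trivial) fun d => ?_
    refine (pb_of_comp_eq rfl (V := ⊤) hk' (fun _ _ => trivial) _ _).trans ?_
    rw [ek, Blueprint.comp_apply, ← pb_of_comp_eq hθ' hιW (fun _ _ => trivial) hθW, hθγ]
    refine Eq.symm ((congrArg (fun χ : sec (S.toSpace) ⊤ ⟶ sec (S.toSpace) ⊤ =>
      χ (σ d)) (pb_id le_rfl)).trans (rs_self _ _))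
  have hiso : IsIso k := ⟨θ', h1, h2⟩
  have hc := (isChart_comp_pb_iff k (U := ⊤) (V := ⊤) hk' (fun z _ => ⟨θ'.hom.base z, trivial,
    congrArg (fun f : S.toSpace ⟶ S.toSpace => f.hom.base z) h2⟩) _).2 hσ
  have e : σ ≫ pb k hk' = γ ≫ pb ι.toHom hιW := Blueprint.hom_ext ek
  rw [e] at hc
  exact (isChart_comp_pb_iff ι.toHom hιW (fun z hz => by
    obtain ⟨y, hy⟩ := hιs z hz
    exact ⟨y, trivial, hy⟩) γ).1 hc

end BlueScheme

/-! ### Charts with trivial relations -/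

namespace Blueprint

variable {D : Blueprint.{u}}

/-- After clearing denominators a relation comes from `D`, where it only drops zeros. Dividing again
fixes `0`, so the numbers of zeros stay the same. -/
theorem HasTrivialRel.localization (hD : D.HasTrivialRel) (S : Submonoid D) :
    (D.localization S).HasTrivialRel := by
  let L := Hom.toFun (D.toLocalization S)
  let mL : MonoidAlgebra ℕ D →+* MonoidAlgebra ℕ (D.localization S) :=
    MonoidAlgebra.mapDomainRingHom ℕ (L : D →* D.localization S)
  have hmL : ∀ a n, mL (MonoidAlgebra.single a n) = MonoidAlgebra.single (L a) n := fun a n =>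
    mapDomainRingHom_single _ a n
  have hpmL : ∀ x, (D.localization S).plusMk (mL x) = plusMap (D.toLocalization S) (D.plusMk x) :=
    fun x => (plusMap_plusMk _ x).symm
  have key : ∀ x : MonoidAlgebra ℕ (D.localization S), ∃ (x' : MonoidAlgebra ℕ D), ∃ s ∈ S,
      mL (MonoidAlgebra.single s 1) * x = mL x' := by
    intro x
    induction x using MonoidAlgebra.induction_linear with
    | zero => exact ⟨0, 1, S.one_mem, by simp⟩
    | single z n =>
      obtain ⟨a, s, hs, h⟩ := exists_toLocalization D S z
      exact ⟨MonoidAlgebra.single a n, s, hs, by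
        rw [hmL, hmL, MonoidAlgebra.single_mul_single, one_mul]
        exact congrArg (MonoidAlgebra.single · n) h⟩
    | add x y hx hy =>
      obtain ⟨x', s, hs, hx⟩ := hx
      obtain ⟨y', t, ht, hy⟩ := hy
      refine ⟨MonoidAlgebra.single t 1 * x' + MonoidAlgebra.single s 1 * y', s * t,
        S.mul_mem hs ht, ?_⟩
      have e : (MonoidAlgebra.single (s * t) 1 : MonoidAlgebra ℕ D) =
        MonoidAlgebra.single s 1 * MonoidAlgebra.single t 1 := by
          rw [MonoidAlgebra.single_mul_single, one_mul]
      rw [e, map_mul, map_add, map_mul mL _ x', map_mul mL _ y', ← hx, ← hy]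
      ring
  intro x y hxy
  rw [← plusMk_eq_iff] at hxy
  obtain ⟨x', s, hs, hx⟩ := key x
  obtain ⟨y', t, ht, hy⟩ := key y
  have h1 : plusMap (D.toLocalization S) (D.plusMk (MonoidAlgebra.single t 1 * x')) =
      plusMap (D.toLocalization S) (D.plusMk (MonoidAlgebra.single s 1 * y')) := by
    rw [← hpmL, ← hpmL, map_mul mL, map_mul mL, ← hx, ← hy, map_mul, map_mul, map_mul, map_mul, hxy]
    exact mul_left_comm _ _ _
  obtain ⟨r, hr, e⟩ := (plusMap_toLocalization_eq_iff D S _ _).1 h1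
  rw [← plusMk_single_one, ← map_mul, ← map_mul, plusMk_eq_iff] at e
  obtain ⟨k, l, e⟩ := hD _ _ e
  obtain ⟨w, hw⟩ := (isUnit_toLocalization D S (S.mul_mem hr (S.mul_mem ht hs))).exists_left_inv
  have hL0 : L 0 = 0 := map_zero L
  have h2 := congrArg (fun z => MonoidAlgebra.single w 1 * mL z) e
  simp only [map_add, map_mul mL, ← hx, ← hy, hmL, mul_add, hL0, MonoidAlgebra.single_mul_single,
    one_mul, mul_zero, ← mul_assoc] at h2
  refine ⟨k, l, ?_⟩
  have h3 : w * L (r * t) * L s = 1 := by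
    rw [mul_assoc, ← map_mul, mul_assoc]
    exact hw
  have h4 : w * L (r * s) * L t = 1 := by
    rw [mul_assoc, ← map_mul, mul_assoc, mul_comm s]
    exact hw
  rw [h3, h4, ← MonoidAlgebra.one_def, one_mul, one_mul] at h2
  exact h2

/-- The prime ideal of all non-invertible elements. -/
def HasTrivialRel.nonunits (hD : D.HasTrivialRel) (h01 : (0 : D) ≠ 1) : Spectrum D where
  ideal := {c | ¬ IsUnit c}
  mul_mem a b hb h := hb (isUnit_of_mul_isUnit_right h)
  -- If `c` is a unit, it is nonzero and occurs neither in `x` nor in `y`. Then its coefficient is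
  -- `1` on one side and `0` on the other, and multiples of `0` do not change that.
  mem_of_rel x y c hx hy h hc := by
    have h0 : (0 : D) ≠ c := by
      rintro rfl
      exact h01 (isUnit_zero_iff.1 hc)
    obtain ⟨k, l, e⟩ := hD _ _ h
    have aux : ∀ x : MonoidAlgebra ℕ D, (x.coeff.support : Set D) ⊆ {c | ¬ IsUnit c} →
        x.coeff c = 0 := fun x hx => by
      by_contra hne
      exact hx (Finsupp.mem_support_iff.2 hne) hc
    have := congrArg (fun z => z.coeff c) e
    simp [aux x hx, aux y hy, h0] at this
  one_notMem h := h isUnit_one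
  mem_or_mem a b h := by
    by_contra hc
    rw [not_or] at hc
    exact h ((not_not.1 hc.1).mul (not_not.1 hc.2))

end Blueprint

section Charts

variable {Z : BlueprintedSpace.{u}} {D : Blueprint.{u}} {U : Opens Z}

/-- The point of the prime ideal of nonunits. A basic neighbourhood of it is the locus of an element
outside that ideal, that is, of a unit, so it is all of `U`. -/
theorem IsChart.exists_minimal_point {α : D ⟶ sec Z U} (hα : IsChart α) (hD : D.HasTrivialRel)
    (h01 : (0 : D) ≠ 1) : ∃ z ∈ U, (∀ c, UnitAt z (α c) ↔ IsUnit c) ∧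
      ∀ W : Opens Z, z ∈ W → U ≤ W := by
  obtain ⟨z, hz, h⟩ := hα.exists_point (hD.nonunits h01)
  have h' : ∀ c, UnitAt z (α c) ↔ IsUnit c := fun c => (h c).symm.trans not_not
  refine ⟨z, hz, h', fun W hW z' hz' => ?_⟩
  obtain ⟨c, hc, hcW⟩ := hα.exists_basic z hz W hW
  exact hcW z' (unitAt_of_isUnit hz' (isUnit_map α ((h' c).1 hc)))

theorem IsChart.zero_ne_one {α : D ⟶ sec Z U} (hα : IsChart α) {z : Z} (hz : z ∈ U) :
    (0 : D) ≠ 1 := by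
  obtain ⟨P, -⟩ := hα.exists_prime z hz
  exact fun h => P.one_notMem (h ▸ P.zero_mem)

theorem isIso_of_forall_notMem (hU : ∀ z, z ∉ U) (h01 : (0 : D) = 1) (α : D ⟶ sec Z U) :
    IsIso α := by
  refine Blueprint.isIso_of_surjective (fun s => ⟨0, sec_ext fun z hz => absurd hz (hU z)⟩)
    fun x y _ => ?_
  have h : (0 : D.Plus) = 1 := by rw [← toPlus_zero, h01, map_one]
  rw [← one_mul x, ← one_mul y, ← h, zero_mul, zero_mul]

/-- The sections over a chart with trivial relations are the elements of the chart. -/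
theorem IsChart.isIso_of_hasTrivialRel {α : D ⟶ sec Z U} (hα : IsChart α)
    (hD : D.HasTrivialRel) : IsIso α := by
  by_cases h01 : (0 : D) = 1
  · exact isIso_of_forall_notMem (fun z hz => hα.zero_ne_one hz h01) h01 α
  -- Every neighbourhood of `z` contains `U`, and only units of `D` are invertible at `z`. Hence
  -- fractions and relations at `z` are already elements and relations of `D`, valid on all of `U`.
  obtain ⟨z, hz, hu, hmin⟩ := hα.exists_minimal_point hD h01
  refine Blueprint.isIso_of_surjective (fun s => ?_) fun x y e => ?_
  · obtain ⟨a, f, hf, e⟩ := hα.exists_frac z U le_rfl hz s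
    rw [eqAt_toPlus_iff] at e
    obtain ⟨W, hW, hzW, e⟩ := e
    obtain rfl := le_antisymm hW (hmin W hzW)
    rw [rs_self, rs_self, rs_self, rs_self] at e
    obtain ⟨r, hr⟩ := ((hu f).1 hf).exists_left_inv
    refine ⟨r * a, ?_⟩
    change α (r * a) = s
    rw [hom_mul, ← e, ← mul_assoc, ← hom_mul, hr, hom_one, one_mul]
  · obtain ⟨f, hf, h⟩ := hα.exists_eq z x y (.of_eq hz e)
    exact (((hu f).1 hf).map D.toPlus).mul_left_cancel h

end Charts

namespace BlueScheme

/-! ### Charts over a base -/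

variable {B : Blueprint.{u}} {X Y : BlueScheme.{u}}

/-- The image of a point in the spectrum of the base. -/
def basePoint (π : Y ⟶ Spec B) (z : Y.toSpace) : Spectrum B := π.toHom.hom.base z

theorem unitAt_structureMap (π : Y ⟶ Spec B) {U : Y.OpenSubset} {z : Y.toSpace} (hz : z ∈ U)
    (b : B) : UnitAt z (structureMap π U b) ↔ b ∉ (basePoint π z).ideal :=
  (π.isLocal.unitAt_iff (U := ⊤) (h := fun _ _ => trivial) hz).trans (spec_unitAt_toGlobal b _)

/-- A chart is a chart over the base if it is compatible with the structure map. -/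
structure IsChartOver {M : Type u} [CommMonoidWithZero M] (π : Y ⟶ Spec B) {U : Y.OpenSubset}
    (γ : monoidBlueprint B M ⟶ sec Y.toSpace U) : Prop where
  isChart : IsChart γ
  comp : toMonoidBlueprint B M ≫ γ = structureMap π U

section

variable {M : Type u} [CommMonoidWithZero M] {π : Y ⟶ Spec B} {U : Y.OpenSubset}
  {γ : monoidBlueprint B M ⟶ sec Y.toSpace U}

theorem IsChartOver.apply_const (hγ : IsChartOver π γ) (b : B) :
    γ (monomial b 1) = structureMap π U b :=
  congrArg (fun χ : B ⟶ sec Y.toSpace U => χ b) hγ.comp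

theorem IsChartOver.unitAt_const (hγ : IsChartOver π γ) {z : Y.toSpace} (hz : z ∈ U) (b : B) :
    UnitAt z (γ (monomial b 1)) ↔ b ∉ (basePoint π z).ideal := by
  rw [hγ.apply_const, unitAt_structureMap π hz]

theorem IsChartOver.nontrivial (hγ : IsChartOver π γ) {z : Y.toSpace} (hz : z ∈ U) :
    Nontrivial M := by
  refine ⟨0, 1, fun h => hγ.isChart.zero_ne_one hz ?_⟩
  rw [← monomial_one, ← h, monomial_zero_right]

/-- In every nonempty chart there is a smallest point over every point of the base. -/
theorem IsChartOver.exists_generic [Nontrivial M] (hγ : IsChartOver π γ) (P : Spectrum B) :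
    ∃ z ∈ U, basePoint π z = P ∧
      (∀ b m, UnitAt z (γ (monomial b m)) ↔ b ∉ P.ideal ∧ IsUnit m) ∧
      ∀ W : Opens Y.toSpace, z ∈ W →
        ∃ b, b ∉ P.ideal ∧ ∀ z' ∈ U, b ∉ (basePoint π z').ideal → z' ∈ W := by
  have h0 : (0 : M) ∉ IsUnit.submonoid M := not_isUnit_zero
  have hT : ∀ m n : M, m * n ∈ IsUnit.submonoid M →
      m ∈ IsUnit.submonoid M ∧ n ∈ IsUnit.submonoid M := fun m n h => IsUnit.mul_iff.1 h
  -- The largest prime ideal over `P`: outside it lie only the `b ∧ m` with `b ∉ P` and `m` a unit.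
  obtain ⟨z, hz, h⟩ := hγ.isChart.exists_point (smashPrime P _ h0 hT)
  have h' : ∀ b m, UnitAt z (γ (monomial b m)) ↔ b ∉ P.ideal ∧ IsUnit m := fun b m =>
    (h _).symm.trans (monomial_notMem_smashPrime P _ h0 hT b m)
  refine ⟨z, hz, Spectrum.ext (Set.ext fun b => not_iff_not.1 ?_), h', fun W hW => ?_⟩
  · rw [← hγ.unitAt_const hz, h']
    exact and_iff_left isUnit_one
  -- Since `m` is a unit, the locus of `b ∧ m` is the full part of `U` over `{b ∉ P}`.
  · obtain ⟨c, hc, hcW⟩ := hγ.isChart.exists_basic z hz W hW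
    obtain ⟨b, m, rfl⟩ := exists_monomial c
    obtain ⟨hb, hm⟩ := (h' b m).1 hc
    refine ⟨b, hb, fun z' hz' hb' => hcW z' ?_⟩
    rw [monomial_eq, hom_mul, unitAt_mul_iff]
    refine ⟨(hγ.unitAt_const hz' b).2 hb', unitAt_of_isUnit hz' (isUnit_map γ ?_)⟩
    exact hm.map (monomialHom B M)

end

/-! ### The topology of a base extension -/

/-- A scheme over `𝔽₁` that is covered by spectra of monoids. -/
def IsLocallyMonoidal (X : BlueScheme.{u}) : Prop :=
  ∀ x : X.toSpace, ∃ (U : Opens X.toSpace) (_ : x ∈ U) (M : Type u) (_ : CommMonoidWithZero M)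
    (α : monoidBlueprint F1 M ⟶ sec X.toSpace U), IsChart α

theorem IsMonoidal.isLocallyMonoidal {f : X ⟶ Spec F1} (h : IsMonoidal f) :
    IsLocallyMonoidal X := by
  obtain ⟨I, U, M, inst, e, hU, haff, -⟩ := h
  intro x
  obtain ⟨i, hi⟩ := Opens.mem_iSup.1 (hU.ge (show x ∈ (⊤ : Opens X.toSpace) from trivial))
  exact ⟨U i, hi, M i, inst i, (e i).hom, .of_isAffine (haff i) _⟩

variable {f : X ⟶ Spec F1} {g : Spec B ⟶ Spec F1} {p : Y ⟶ X} {π : Y ⟶ Spec B}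

section

variable {M : Type u} [CommMonoidWithZero M] {U : Opens X.toSpace}
  {α : monoidBlueprint F1 M ⟶ sec X.toSpace U}

/-- The chart of a base extension given by a chart. -/
def baseChart (p : Y ⟶ X) (π : Y ⟶ Spec B) (α : monoidBlueprint F1 M ⟶ sec X.toSpace U) :
    monoidBlueprint B M ⟶ sec Y.toSpace (preimage p U) :=
  prodChart p π α (toGlobal B) (preimage p U) (fun _ h => h) fun _ _ => trivial

theorem isChartOver_baseChart (hY : IsPullback p π f g) (hα : IsChart α) :
    IsChartOver π (baseChart p π α) where
  isChart := isChart_prodChart hY hα (spec_isChart B) _ _ fun _ h _ => h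
  comp := toMonoidBlueprint_monoidLift _ _

theorem baseChart_monomial (m : M) : baseChart p π α (monomial 1 m) =
    pb p.toHom (fun _ h => h) (α (monomial 1 m)) := by
  refine (monoidLift_monomial _ _ _ _).trans ?_
  rw [hom_one, one_mul]
  rfl

theorem unitAt_baseChart (hY : IsPullback p π f g) (hα : IsChart α) {z : Y.toSpace}
    (hz : p.toHom.hom.base z ∈ U) (b : B) (m : M) :
    UnitAt z (baseChart p π α (monomial b m)) ↔
      b ∉ (basePoint π z).ideal ∧ UnitAt (p.toHom.hom.base z) (α (monomial 1 m)) := by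
  rw [monomial_eq, hom_mul, unitAt_mul_iff]
  refine and_congr ((isChartOver_baseChart hY hα).unitAt_const hz b) ?_
  refine Iff.trans ?_ (p.isLocal.unitAt_iff (W := preimage p U) (h := fun _ h => h) hz)
  rw [← baseChart_monomial (π := π)]

end

/-- The point belongs to the prime ideal of `B[M]` built from `P` and the submonoid `T` of elements
of `M` that are invertible at `x`. -/
theorem exists_point (hY : IsPullback p π f g) (hX : IsLocallyMonoidal X) (x : X.toSpace)
    (P : Spectrum B) : ∃ z, p.toHom.hom.base z = x ∧ basePoint π z = P := by
  obtain ⟨U, hx, M, _, α, hα⟩ := hX x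
  let T : Submonoid M :=
    { carrier := {m | UnitAt x (α (monomial 1 m))}
      one_mem' := unitAt_of_isUnit hx (isUnit_map α isUnit_one)
      mul_mem' := fun {m n} hm hn => by
        have : (monomial 1 (m * n) : monoidBlueprint F1 M) = monomial 1 m * monomial 1 n := by
          rw [← monomial_mul, one_mul]
        rw [Set.mem_ofPred_eq, this, hom_mul, unitAt_mul_iff]
        exact ⟨hm, hn⟩ }
  have hT : ∀ m n : M, m * n ∈ T → m ∈ T ∧ n ∈ T := fun m n h => by
    have e : (monomial 1 (m * n) : monoidBlueprint F1 M) = monomial 1 m * monomial 1 n := by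
      rw [← monomial_mul, one_mul]
    have h' : UnitAt x (α (monomial 1 (m * n))) := h
    rwa [e, hom_mul, unitAt_mul_iff] at h'
  have h0 : (0 : M) ∉ T := fun h => by
    obtain ⟨Q, hQ⟩ := hα.exists_prime x hx
    have h' : UnitAt x (α (monomial 1 0)) := h
    rw [← hQ, monomial_zero_right] at h'
    exact h' Q.zero_mem
  have hγ := isChartOver_baseChart (π := π) hY hα
  obtain ⟨z, hz, h⟩ := hγ.isChart.exists_point (smashPrime P T h0 hT)
  have h' : ∀ b m, b ∉ (basePoint π z).ideal ∧ UnitAt (p.toHom.hom.base z) (α (monomial 1 m)) ↔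
      b ∉ P.ideal ∧ UnitAt x (α (monomial 1 m)) := fun b m =>
    (unitAt_baseChart hY hα hz b m).symm.trans ((h _).symm.trans
      (monomial_notMem_smashPrime P T h0 hT b m))
  have h1 : ∀ m, UnitAt (p.toHom.hom.base z) (α (monomial 1 m)) ↔ UnitAt x (α (monomial 1 m)) :=
    fun m => (and_iff_right (basePoint π z).one_notMem).symm.trans
      ((h' 1 m).trans (and_iff_right P.one_notMem))
  have h2 : ∀ b, b ∉ (basePoint π z).ideal ↔ b ∉ P.ideal := fun b =>
    (and_iff_left ((h1 1).2 T.one_mem)).symm.trans ((h' b 1).trans (and_iff_left T.one_mem))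
  refine ⟨z, hα.point_unique _ hz x hx fun c => ?_, Spectrum.ext (Set.ext fun b =>
    not_iff_not.1 (h2 b))⟩
  obtain ⟨a, m, rfl⟩ := exists_monomial c
  rcases F1_eq_zero_or_one a with rfl | rfl
  · rw [monomial_zero_left, ← monomial_zero_right 1]
    exact h1 0
  · exact h1 m

/-- With `exists_point`, this identifies the set of points of the base extension with `X × Spec B`.
-/
theorem point_ext (hY : IsPullback p π f g) (hX : IsLocallyMonoidal X) {z z' : Y.toSpace}
    (h : p.toHom.hom.base z = p.toHom.hom.base z') (h' : basePoint π z = basePoint π z') :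
    z = z' := by
  obtain ⟨U, hx, M, _, α, hα⟩ := hX (p.toHom.hom.base z)
  refine (isChartOver_baseChart (π := π) hY hα).isChart.point_unique z hx z'
    (show p.toHom.hom.base z' ∈ U from h ▸ hx) fun c => ?_
  obtain ⟨b, m, rfl⟩ := exists_monomial c
  rw [unitAt_baseChart hY hα hx, unitAt_baseChart hY hα (h ▸ hx), h, h']

/-- The topology is the product topology: the locus of `b ∧ m` is a box, cut out by `b` on the base
and by `m` on `X`. -/
theorem exists_box (hY : IsPullback p π f g) (hX : IsLocallyMonoidal X) {z : Y.toSpace}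
    {W : Opens Y.toSpace} (hz : z ∈ W) : ∃ (V : Opens X.toSpace) (b : B),
      p.toHom.hom.base z ∈ V ∧ b ∉ (basePoint π z).ideal ∧
        ∀ z', p.toHom.hom.base z' ∈ V → b ∉ (basePoint π z').ideal → z' ∈ W := by
  obtain ⟨U, hx, M, _, α, hα⟩ := hX (p.toHom.hom.base z)
  obtain ⟨c, hc, h⟩ := (isChartOver_baseChart (π := π) hY hα).isChart.exists_basic z hx W hz
  obtain ⟨b, m, rfl⟩ := exists_monomial c
  obtain ⟨h1, h2⟩ := (unitAt_baseChart hY hα hx b m).1 hc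
  exact ⟨unitLocus (α (monomial 1 m)), b, h2, h1, fun z' hz' hb =>
    h z' ((unitAt_baseChart hY hα (UnitAt.mem hz') b m).2 ⟨hb, hz'⟩)⟩

/-- An open subset that is the spectrum of a monoid blueprint over a base with connected spectrum
is the inverse image of an open subset that has a smallest point. -/
theorem IsChartOver.exists_preimage [PreconnectedSpace B.Spectrum] (hY : IsPullback p π f g)
    (hX : IsLocallyMonoidal X) {M : Type u} [CommMonoidWithZero M] {U : Y.OpenSubset}
    {γ : monoidBlueprint B M ⟶ sec Y.toSpace U} (hγ : IsChartOver π γ) {z₀ : Y.toSpace}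
    (hz₀ : z₀ ∈ U) : ∃ (V : X.OpenSubset) (x₀ : X.toSpace), x₀ ∈ V ∧
      (∀ W : X.OpenSubset, x₀ ∈ W → V ≤ W) ∧ U = preimage p V := by
  have := hγ.nontrivial hz₀
  choose σ hσU hσP hσu hσ using fun P => hγ.exists_generic P
  choose pt hpt hptP using exists_point hY hX
  let F : Spectrum B → Set X.toSpace := fun P => {x | pt x P ∈ U}
  let t : Spectrum B → X.toSpace := fun P => p.toHom.hom.base (σ P)
  have hpt' : ∀ z, pt (p.toHom.hom.base z) (basePoint π z) = z := fun z =>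
    point_ext hY hX (hpt _ _) (hptP _ _)
  have hF : ∀ z, z ∈ U ↔ p.toHom.hom.base z ∈ F (basePoint π z) := fun z => by
    change z ∈ U ↔ pt _ _ ∈ U
    rw [hpt']
  have hFo : ∀ P, IsOpen (F P) := fun P => isOpen_iff_forall_mem_open.2 fun x hx => by
    obtain ⟨V, b, hV, hb, h⟩ := exists_box hY hX (W := U) hx
    rw [hpt] at hV
    rw [hptP] at hb
    exact ⟨V, fun x' hx' => h _ (by rwa [hpt]) (by rwa [hptP]), V.2, hV⟩
  have ht : ∀ P, t P ∈ F P := fun P => by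
    have := (hF (σ P)).1 (hσU P)
    rwa [hσP] at this
  have hmin : ∀ P (W : Opens X.toSpace), t P ∈ W → F P ⊆ W := fun P W hW x hx => by
    obtain ⟨b, hb, h⟩ := hσ P (preimage p W) hW
    have := h (pt x P) hx (by rwa [hptP])
    rw [← hpt x P]
    exact this
  -- For `Q` near `P`: `F Q ⊆ F P` because a neighbourhood of `σ P` contains all of `U` over a
  -- neighbourhood of `P`; and `t P ∈ F Q` because a box around `σ P` lies in `U`, so `F P ⊆ F Q` by
  -- minimality of `t P`.
  have hloc : IsLocallyConstant F := (IsLocallyConstant.iff_exists_open F).2 fun P => by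
    obtain ⟨b, hb, h⟩ := hσ P (preimage p ⟨F P, hFo P⟩) (ht P)
    obtain ⟨V, c, hV, hc, h'⟩ := exists_box hY hX (hσU P)
    rw [hσP] at hc
    refine ⟨basicOpen (b * c), (basicOpen (b * c)).2, P.mul_notMem_iff.2 ⟨hb, hc⟩,
      fun Q hQ => ?_⟩
    obtain ⟨hbQ, hcQ⟩ := Q.mul_notMem_iff.1 hQ
    refine Set.Subset.antisymm (fun x hx => ?_) ?_
    · have := h (pt x Q) hx (by rwa [hptP])
      rw [← hpt x Q]
      exact this
    · exact hmin P ⟨F Q, hFo Q⟩ (h' _ (by rw [hpt]; exact hV) (by rwa [hptP]))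
  let P₀ := basePoint π z₀
  refine ⟨⟨F P₀, hFo P₀⟩, t P₀, ht P₀, hmin P₀, Opens.ext (Set.ext fun z => (hF z).trans ?_)⟩
  rw [hloc.apply_eq_of_preconnectedSpace (basePoint π z) P₀]
  rfl

/-! ### Equality over neighbourhoods of points of the base -/

section EqOver

variable {B : Blueprint.{u}} {Y : BlueScheme.{u}} (π : Y ⟶ Spec B) {U V : Y.OpenSubset}

/-- The elements `x` and `y` agree over a neighbourhood of the point `P` of the base. -/
def EqOver (P : Spectrum B) (x y : (sec Y.toSpace U).Plus) : Prop :=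
  ∃ g, g ∉ P.ideal ∧ ∀ z ∈ U, g ∉ (basePoint π z).ideal → EqAt z x y

/-- The sections `s` and `t` agree over a neighbourhood of the point `P` of the base. -/
def SecEqOver (P : Spectrum B) (s t : sec Y.toSpace U) : Prop :=
  EqOver π P ((sec Y.toSpace U).toPlus s) ((sec Y.toSpace U).toPlus t)

variable {π} {P : Spectrum B} {x y w : (sec Y.toSpace U).Plus} {r s t : sec Y.toSpace U}

theorem EqOver.of_eq (h : x = y) : EqOver π P x y :=
  ⟨1, P.one_notMem, fun _ hz _ => .of_eq hz h⟩

theorem EqOver.symm (h : EqOver π P x y) : EqOver π P y x := by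
  obtain ⟨g, hg, h⟩ := h
  exact ⟨g, hg, fun z hz hgz => (h z hz hgz).symm⟩

theorem EqOver.trans (h : EqOver π P x y) (h' : EqOver π P y w) : EqOver π P x w := by
  obtain ⟨g, hg, h⟩ := h
  obtain ⟨g', hg', h'⟩ := h'
  refine ⟨g * g', P.mul_notMem_iff.2 ⟨hg, hg'⟩, fun z hz hgz => ?_⟩
  rw [Spectrum.mul_notMem_iff] at hgz
  exact (h z hz hgz.1).trans (h' z hz hgz.2)

theorem EqOver.mul_left (h : EqOver π P x y) (w : (sec Y.toSpace U).Plus) :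
    EqOver π P (w * x) (w * y) := by
  obtain ⟨g, hg, h⟩ := h
  exact ⟨g, hg, fun z hz hgz => (h z hz hgz).mul_left w⟩

theorem EqOver.near (h : EqOver π P x y) :
    ∃ g, g ∉ P.ideal ∧ ∀ Q : Spectrum B, g ∉ Q.ideal → EqOver π Q x y := by
  obtain ⟨g, hg, h⟩ := h
  exact ⟨g, hg, fun Q hQ => ⟨g, hQ, h⟩⟩

theorem EqOver.cancel {c : B} (hc : c ∉ P.ideal)
    (h : EqOver π P ((sec Y.toSpace U).toPlus (structureMap π U c) * x)
      ((sec Y.toSpace U).toPlus (structureMap π U c) * y)) : EqOver π P x y := by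
  obtain ⟨g, hg, h⟩ := h
  refine ⟨g * c, P.mul_notMem_iff.2 ⟨hg, hc⟩, fun z hz hgz => ?_⟩
  rw [Spectrum.mul_notMem_iff] at hgz
  exact (h z hz hgz.1).cancel ((unitAt_structureMap π hz c).2 hgz.2)

theorem eq_of_eqOver (h : ∀ P, EqOver π P x y) : x = y := by
  refine eq_of_eqAt fun z hz => ?_
  obtain ⟨g, hg, h⟩ := h (basePoint π z)
  exact h z hz hg

theorem SecEqOver.of_eq (h : s = t) : SecEqOver π P s t := EqOver.of_eq (by rw [h])

theorem SecEqOver.symm (h : SecEqOver π P s t) : SecEqOver π P t s := EqOver.symm h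

theorem SecEqOver.trans (h : SecEqOver π P s t) (h' : SecEqOver π P t r) : SecEqOver π P s r :=
  EqOver.trans h h'

theorem SecEqOver.mul_left (h : SecEqOver π P s t) (r : sec Y.toSpace U) :
    SecEqOver π P (r * s) (r * t) := by
  rw [SecEqOver, map_mul, map_mul]
  exact EqOver.mul_left h _

theorem SecEqOver.near (h : SecEqOver π P s t) :
    ∃ g, g ∉ P.ideal ∧ ∀ Q : Spectrum B, g ∉ Q.ideal → SecEqOver π Q s t := EqOver.near h

theorem SecEqOver.cancel {c : B} (hc : c ∉ P.ideal)
    (h : SecEqOver π P (structureMap π U c * s) (structureMap π U c * t)) :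
    SecEqOver π P s t := by
  rw [SecEqOver, map_mul, map_mul] at h
  exact EqOver.cancel hc h

theorem eq_of_secEqOver (h : ∀ P, SecEqOver π P s t) : s = t :=
  (toPlus_eq_iff _ _ _).1 (eq_of_eqOver h)

/-- Gluing along the cover of `U` by the inverse images of the sets `{g P ≠ 0}` of `Spec B`; they
cover because `g P ∉ P`. -/
theorem exists_glue_over (s : Spectrum B → sec Y.toSpace U) (g : Spectrum B → B)
    (hg : ∀ P, g P ∉ P.ideal)
    (h : ∀ P Q R : Spectrum B, g P ∉ R.ideal → g Q ∉ R.ideal → SecEqOver π R (s P) (s Q)) :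
    ∃ t : sec Y.toSpace U, ∀ P, SecEqOver π P t (s P) := by
  let V : Spectrum B → Y.OpenSubset := fun P => U ⊓
    ⟨{z | g P ∉ (basePoint π z).ideal},
      (basicOpen (g P)).2.preimage π.toHom.hom.base.hom.continuous⟩
  have hV : ∀ P, V P ≤ U := fun P => inf_le_left
  obtain ⟨t, ht, -⟩ := existsUnique_glue V hV (fun z hz => ⟨basePoint π z, hz, hg _⟩)
    (fun P => rs Y.toSpace (hV P) (s P)) fun P Q => by
      rw [← toPlus_eq_iff]
      refine eq_of_eqAt fun z hz => ?_
      obtain ⟨k, hk, e⟩ := h P Q (basePoint π z) hz.1.2 hz.2.2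
      rw [rs_rs, rs_rs, ← plusMap_toPlus, ← plusMap_toPlus]
      exact (eqAt_rs_iff _ hz).2 (e z hz.1.1 hk)
  refine ⟨t, fun P => ⟨g P, hg P, fun z hz hgz => ?_⟩⟩
  have hzV : z ∈ V P := ⟨hz, hgz⟩
  rw [← eqAt_rs_iff (hV P) hzV, plusMap_toPlus, plusMap_toPlus, ht]
  exact .of_eq hzV rfl

/-- The pullback of a section of the base is locally represented by the same fractions. -/
theorem secEqOver_pb (s : sec (specSpace B) ⊤) {a k : B}
    (h : EqAt (Z := specSpace B) P (toPlus _ (toGlobal B k * s)) (toPlus _ (toGlobal B a))) :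
    SecEqOver π P (structureMap π U k * pb π.toHom (V := ⊤) (W := U) (fun _ _ => trivial) s)
      (structureMap π U a) := by
  obtain ⟨W, hW, hP, e⟩ := h
  obtain ⟨g, hg, hgW⟩ := exists_basicOpen_le (C := B) W P hP
  refine ⟨g, hg, fun z hz hgz => ?_⟩
  have h1 : EqAt (Z := specSpace B) (π.toHom.hom.base z) (toPlus _ (toGlobal B k * s))
    (toPlus _ (toGlobal B a)) := ⟨W, hW, hgW hgz, e⟩
  have h2 := EqAt.pb π.toHom (U := ⊤) (W := U) (fun _ _ => trivial) hz h1
  have key : ∀ c : sec (specSpace B) ⊤,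
      plusMap (pb π.toHom (V := ⊤) (W := U) fun _ _ => trivial) (toPlus (sec (specSpace B) ⊤) c) =
        toPlus _ (pb π.toHom (V := ⊤) (W := U) (fun _ _ => trivial) c) := fun c =>
    plusMap_toPlus _ _
  have e1 : toPlus (sec Y.toSpace U) (structureMap π U k *
      pb π.toHom (V := ⊤) (W := U) (fun _ _ => trivial) s) =
      toPlus _ (pb π.toHom (V := ⊤) (W := U) (fun _ _ => trivial) (toGlobal B k * s)) :=
    congrArg (toPlus (sec Y.toSpace U)) (map_mul (Hom.toFun
      (pb π.toHom (V := ⊤) (W := U) fun _ _ => trivial)) (toGlobal B k) s).symm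
  exact EqAt.trans (.of_eq hz (e1.trans (key _).symm)) (h2.trans (.of_eq hz (key _)))

end EqOver

/-! ### Sections of a chart, locally over the base -/

section Chart

variable {B : Blueprint.{u}} {Y : BlueScheme.{u}} {π : Y ⟶ Spec B} {U : Y.OpenSubset}
  {M : Type u} [CommMonoidWithZero M] {γ : monoidBlueprint B M ⟶ sec Y.toSpace U}

theorem IsChartOver.mul_apply (hγ : IsChartOver π γ) (c a : B) (m : M) :
    structureMap π U c * γ (monomial a m) = γ (monomial (c * a) m) := by
  rw [← hγ.apply_const, ← hom_mul, ← monomial_mul, one_mul]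

/-- At the generic point over `P` a denominator `k ∧ n` has `n` invertible, so `n⁻¹` moves into the
numerator and the denominator comes from `B`. A neighbourhood of that point contains all of `U` over
a neighbourhood of `P`. -/
theorem IsChartOver.exists_frac [Nontrivial M] (hγ : IsChartOver π γ) (P : Spectrum B)
    (s : sec Y.toSpace U) : ∃ (a k : B) (m : M), k ∉ P.ideal ∧
      SecEqOver π P (structureMap π U k * s) (γ (monomial a m)) := by
  obtain ⟨z, hz, -, hu, hW⟩ := hγ.exists_generic P
  obtain ⟨a, k, hk, e⟩ := hγ.isChart.exists_frac z U le_rfl hz s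
  obtain ⟨a, m, rfl⟩ := exists_monomial a
  obtain ⟨k, n, rfl⟩ := exists_monomial k
  obtain ⟨hkP, hn⟩ := (hu k n).1 hk
  obtain ⟨v, hv⟩ := hn.exists_left_inv
  obtain ⟨W, hWU, hzW, e⟩ := e
  obtain ⟨b, hb, hbW⟩ := hW W hzW
  refine ⟨a, k, v * m, hkP, b, hb, fun z' hz' hbz => ?_⟩
  have e' : EqAt z' (toPlus _ (γ (monomial k n) * s)) (toPlus _ (γ (monomial a m))) := by
    rw [rs_self, rs_self] at e
    exact ⟨W, hWU, hbW z' hz' hbz, e⟩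
  have := e'.mul_left (toPlus _ (γ (monomial 1 v)))
  rwa [← map_mul, ← map_mul, ← mul_assoc, ← hom_mul, ← hom_mul, ← monomial_mul, ← monomial_mul,
    one_mul, one_mul, hv, hγ.apply_const] at this

/-- Evaluated at the generic point over `P`, where a denominator `c ∧ n` has `n` invertible and can
be replaced by `c ∧ 1`. -/
theorem IsChartOver.exists_eq [Nontrivial M] (hγ : IsChartOver π γ) {P : Spectrum B}
    {x y : (monoidBlueprint B M).Plus} (h : EqOver π P (plusMap γ x) (plusMap γ y)) :
    ∃ c, c ∉ P.ideal ∧ toPlus (monoidBlueprint B M) (monomial c 1) * x =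
      toPlus (monoidBlueprint B M) (monomial c 1) * y := by
  obtain ⟨z, hz, hzP, hu, -⟩ := hγ.exists_generic P
  obtain ⟨g, hg, h⟩ := h
  obtain ⟨k, hk, e⟩ := hγ.isChart.exists_eq z x y (h z hz (hzP ▸ hg))
  obtain ⟨c, n, rfl⟩ := exists_monomial k
  obtain ⟨hc, hn⟩ := (hu c n).1 hk
  obtain ⟨v, hv⟩ := hn.exists_left_inv
  refine ⟨c, hc, ?_⟩
  have : (monomial c 1 : monoidBlueprint B M) = monomial 1 v * monomial c n := by
    rw [← monomial_mul, one_mul, hv]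
  rw [this, map_mul, mul_assoc, mul_assoc, e]

theorem IsChartOver.secEqOver_iff [Nontrivial M] (hγ : IsChartOver π γ) {P : Spectrum B}
    {a b : B} {m n : M} : SecEqOver π P (γ (monomial a m)) (γ (monomial b n)) ↔
      ∃ c, c ∉ P.ideal ∧ (monomial (c * a) m : monoidBlueprint B M) = monomial (c * b) n := by
  constructor
  · intro h
    rw [SecEqOver, ← plusMap_toPlus, ← plusMap_toPlus] at h
    obtain ⟨c, hc, e⟩ := hγ.exists_eq h
    refine ⟨c, hc, ?_⟩
    rw [← map_mul, ← map_mul, ← monomial_mul, ← monomial_mul, one_mul, one_mul] at e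
    exact toPlus_injective _ e
  · rintro ⟨c, hc, e⟩
    refine SecEqOver.cancel hc ?_
    rw [hγ.mul_apply, hγ.mul_apply, e]
    exact .of_eq rfl

theorem IsChartOver.secEqOver_zero_iff [Nontrivial M] (hγ : IsChartOver π γ) {P : Spectrum B}
    {a : B} {m : M} (hm : m ≠ 0) : SecEqOver π P (γ (monomial a m)) 0 ↔
      ∃ c, c ∉ P.ideal ∧ c * a = 0 := by
  have : (0 : sec Y.toSpace U) = γ (monomial 0 m) := by rw [monomial_zero_left, hom_zero]
  rw [this, hγ.secEqOver_iff]
  refine exists_congr fun c => and_congr_right fun _ => ?_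
  rw [mul_zero, monomial_zero_left, monomial_eq_zero_iff, or_iff_left hm]

variable [IsIso γ] [Nontrivial M]

/-- `B⁺` embeds into `B[M]⁺`, which is `𝒪(U)⁺` since `γ` is an isomorphism, and equality there is
local over the base. -/
theorem IsChartOver.plus_ext (hγ : IsChartOver π γ) {x y : B.Plus}
    (h : ∀ P : Spectrum B, ∃ c, c ∉ P.ideal ∧ B.toPlus c * x = B.toPlus c * y) : x = y := by
  have e : plusMap (structureMap π U) x = plusMap (structureMap π U) y := by
    refine eq_of_eqOver (π := π) fun P => ?_
    obtain ⟨c, hc, e⟩ := h P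
    refine EqOver.cancel hc (.of_eq ?_)
    have := congrArg (plusMap (structureMap π U)) e
    rwa [map_mul, map_mul, plusMap_toPlus] at this
  rw [← hγ.comp, plusMap_comp, plusMap_comp] at e
  exact plusMap_toMonoidBlueprint_injective (plusMap_injective_of_isIso γ e)

theorem IsChartOver.base_ext (hγ : IsChartOver π γ) {a b : B}
    (h : ∀ P : Spectrum B, ∃ c, c ∉ P.ideal ∧ c * a = c * b) : a = b := by
  refine toPlus_injective _ (hγ.plus_ext fun P => ?_)
  obtain ⟨c, hc, e⟩ := h P
  exact ⟨c, hc, by rw [← map_mul, ← map_mul, e]⟩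

/-- If the sections over some nonempty chart are the elements of the chart, then all global
sections of the spectrum of the base are elements of the base. -/
theorem IsChartOver.toGlobal_surjective (hγ : IsChartOver π γ) (s : sec (specSpace B) ⊤) :
    ∃ b, toGlobal B b = s := by
  choose a k hk e using fun P : Spectrum B =>
    (spec_isChart B).exists_frac P ⊤ le_rfl trivial s
  have hk' : ∀ P : Spectrum B, k P ∉ P.ideal := fun P => (spec_unitAt_toGlobal _ _).1 (hk P)
  have e' : ∀ P : Spectrum B, EqAt (Z := specSpace B) P (toPlus _ (toGlobal B (k P) * s))
      (toPlus _ (toGlobal B (a P))) := fun P => by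
    have := e P
    have h1 : ∀ c, rs (specSpace B) (le_refl ⊤) (toGlobal B c) = toGlobal B c := fun c =>
      rs_self _ _
    rwa [h1, h1] at this
  have h0 : ∀ (b : B) (P : Spectrum B), (∃ c, c ∉ P.ideal ∧ c * (k P * b) = c * a P) →
      EqAt (Z := specSpace B) P (toPlus _ (toGlobal B b)) (toPlus _ s) := fun b P ⟨c, hc, h⟩ => by
    have hP : P ∈ (⊤ : Opens (specSpace B)) := trivial
    have hu : UnitAt (Z := specSpace B) P (toGlobal B (c * k P)) :=
      (spec_unitAt_toGlobal _ _).2 (P.mul_notMem_iff.2 ⟨hc, hk' P⟩)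
    refine EqAt.cancel hu ?_
    have h2 := (e' P).symm.mul_left (toPlus _ (toGlobal B c))
    have e1 : toPlus (sec (specSpace B) ⊤) (toGlobal B (c * k P)) * toPlus _ (toGlobal B b) =
        toPlus _ (toGlobal B c) * toPlus _ (toGlobal B (a P)) := by
      rw [← map_mul (toPlus (sec (specSpace B) ⊤)), ← map_mul (toPlus (sec (specSpace B) ⊤))]
      refine congrArg _ ?_
      exact (hom_mul _ _ _).symm.trans ((congrArg (fun x => toGlobal B x)
        ((mul_assoc _ _ _).trans h)).trans (hom_mul _ _ _))
    have e2 : toPlus (sec (specSpace B) ⊤) (toGlobal B c) * toPlus _ (toGlobal B (k P) * s) =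
        toPlus _ (toGlobal B (c * k P)) * toPlus _ s := by
      rw [← map_mul (toPlus (sec (specSpace B) ⊤)), ← map_mul (toPlus (sec (specSpace B) ⊤))]
      refine congrArg _ ?_
      exact (mul_assoc _ _ _).symm.trans (congrArg (· * s) (hom_mul _ _ _).symm)
    exact EqAt.trans (.of_eq hP e1) (h2.trans (.of_eq hP e2))
  have h1 : ∀ b : B, (∀ P : Spectrum B, ∃ c, c ∉ P.ideal ∧ c * (k P * b) = c * a P) →
      toGlobal B b = s := fun b h =>
    toPlus_injective _ (eq_of_eqAt fun P _ => h0 b P (h P))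
  -- The pullback of `s` to `U` is a single `b ∧ m`, which locally equals `(a P / k P) ∧ 1`.
  obtain ⟨d, hd⟩ := surjective_of_isIso γ (pb π.toHom (V := ⊤) (W := U) (fun _ _ => trivial) s)
  obtain ⟨b, m, rfl⟩ := exists_monomial d
  have h2 : ∀ P : Spectrum B, ∃ c, c ∉ P.ideal ∧
      (monomial (c * (k P * b)) m : monoidBlueprint B M) = monomial (c * a P) 1 := fun P => by
    refine hγ.secEqOver_iff.1 ?_
    rw [hγ.apply_const, ← hγ.mul_apply]
    have := secEqOver_pb (π := π) (U := U) s (e' P)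
    exact (congrArg (fun t => SecEqOver π P (structureMap π U (k P) * t)
      (structureMap π U (a P))) hd).mpr this
  -- For `m = 1` the coefficients at `1` show that `s` is the image of `b`. For `m ≠ 1` they force
  -- every `a P` to vanish locally, so `s` is the image of `0`.
  by_cases hm : m = 1
  · refine ⟨b, h1 b fun P => ?_⟩
    obtain ⟨c, hc, h⟩ := h2 P
    refine ⟨c, hc, ?_⟩
    rcases monomial_eq_iff.1 h with ⟨h, -⟩ | ⟨h, h'⟩
    · exact h
    · rw [h.resolve_right (hm ▸ one_ne_zero), h'.resolve_right one_ne_zero]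
  · refine ⟨0, h1 0 fun P => ?_⟩
    obtain ⟨c, hc, h⟩ := h2 P
    refine ⟨c, hc, ?_⟩
    rcases monomial_eq_iff.1 h with ⟨-, h⟩ | ⟨-, h⟩
    · exact absurd h hm
    · rw [h.resolve_right one_ne_zero, mul_zero, mul_zero]

end Chart

end BlueScheme

/-! ### Monomials and their coefficients -/

theorem Blueprint.Spectrum.ne_zero {B : Blueprint.{u}} (P : Spectrum B) {b : B}
    (h : b ∉ P.ideal) : b ≠ 0 := by
  rintro rfl
  exact h P.zero_mem

open Classical in
theorem Blueprint.monomial_ext {B : Blueprint.{u}} {M : Type u} [CommMonoidWithZero M]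
    {a b : B} {m n : M} (h : ∀ k, k ≠ 0 → (if m = k then a else 0) = if n = k then b else 0) :
    monomial a m = monomial b n := by
  rw [monomial_eq_iff]
  by_cases hmn : m = n
  · subst hmn
    by_cases hm : m = 0
    · exact .inr ⟨.inr hm, .inr hm⟩
    · have := h m hm
      rw [if_pos rfl, if_pos rfl] at this
      exact .inl ⟨this, rfl⟩
  · refine .inr ⟨or_iff_not_imp_right.2 fun hm => ?_, or_iff_not_imp_right.2 fun hn => ?_⟩
    · have := h m hm
      rwa [if_pos rfl, if_neg (Ne.symm hmn)] at this
    · have := h n hn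
      rw [if_neg hmn, if_pos rfl] at this
      exact this.symm

open Classical in
theorem Blueprint.coeff_eq_of_monomial_eq {B : Blueprint.{u}} {M : Type u}
    [CommMonoidWithZero M] {a b : B} {m n : M} (h : monomial a m = monomial b n) {k : M}
    (hk : k ≠ 0) : (if m = k then a else 0) = if n = k then b else 0 := by
  rcases monomial_eq_iff.1 h with ⟨rfl, rfl⟩ | ⟨h1, h2⟩
  · rfl
  · have e1 : (if m = k then a else 0) = 0 := by
      split_ifs with e
      · exact h1.resolve_right (e ▸ hk)
      · rfl
    have e2 : (if n = k then b else 0) = 0 := by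
      split_ifs with e
      · exact h2.resolve_right (e ▸ hk)
      · rfl
    rw [e1, e2]

theorem Blueprint.monomial_right_injective {B : Blueprint.{u}} {M : Type u}
    [CommMonoidWithZero M] {a b : B} {m n : M} (h : monomial a m = monomial b n) (ha : a ≠ 0)
    (hm : m ≠ 0) : a = b ∧ m = n := by
  rcases monomial_eq_iff.1 h with h | ⟨h, -⟩
  · exact h
  · exact absurd h (not_or.2 ⟨ha, hm⟩)

namespace BlueScheme

/-! ### Comparison of two charts over the base -/

section Compare

variable {B : Blueprint.{u}} {Y : BlueScheme.{u}} {π : Y ⟶ Spec B} {U : Y.OpenSubset}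
  {M N : Type u} [CommMonoidWithZero M] [CommMonoidWithZero N]
  {γ : monoidBlueprint B M ⟶ sec Y.toSpace U} {β : monoidBlueprint B N ⟶ sec Y.toSpace U}

theorem IsChartOver.mul_monomial {c a b : B} {m : M} {n : N} {P : Spectrum B}
    (hγ : IsChartOver π γ) (hβ : IsChartOver π β)
    (h : SecEqOver π P (γ (monomial a m)) (β (monomial b n))) :
    SecEqOver π P (γ (monomial (c * a) m)) (β (monomial (c * b) n)) := by
  rw [← hγ.mul_apply, ← hβ.mul_apply]
  exact h.mul_left _

variable [Nontrivial N]

/-- Cross-multiplication gives `f b ∧ x = c e ∧ n` up to a factor outside `P`; as `b` does not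
vanish near `P`, the exponents agree. -/
theorem IsChartOver.compare_unique (hβ : IsChartOver π β) (hγ : IsChartOver π γ)
    {b c e f : B} {m : M} {n x : N} {P : Spectrum B} (hf : f ∉ P.ideal)
    (h : SecEqOver π P (γ (monomial f m)) (β (monomial e n)))
    (h' : SecEqOver π P (γ (monomial c m)) (β (monomial b x)))
    (hb : ∀ k, k ∉ P.ideal → k * b ≠ 0) (hx : x ≠ 0) : x = n := by
  have h1 := hγ.mul_monomial (c := c) hβ h
  have h2 := hγ.mul_monomial (c := f) hβ h'
  rw [mul_comm] at h2
  obtain ⟨d, hd, h3⟩ := hβ.secEqOver_iff.1 (h2.symm.trans h1)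
  refine (monomial_right_injective h3 ?_ hx).2
  rw [← mul_assoc]
  exact hb _ (P.mul_notMem_iff.2 ⟨hd, hf⟩)

variable [Nontrivial M]

/-- Near `P`, `m` becomes `(e / f) n` in the second chart, and `n` becomes `(e' / f') m'` in the
first. Going back and forth yields `c f' f = c e e'` with the left side outside `P`, so `e ∉ P`. -/
theorem IsChartOver.exists_compare_at (hγ : IsChartOver π γ) (hβ : IsChartOver π β) {m : M}
    (hm : m ≠ 0) (P : Spectrum B) : ∃ (n : N) (e f : B), n ≠ 0 ∧ e ∉ P.ideal ∧ f ∉ P.ideal ∧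
      SecEqOver π P (γ (monomial f m)) (β (monomial e n)) := by
  obtain ⟨e, f, n, hf, h⟩ := hβ.exists_frac P (γ (monomial 1 m))
  obtain ⟨e', f', m', hf', h'⟩ := hγ.exists_frac P (β (monomial 1 n))
  rw [hγ.mul_apply, mul_one] at h
  rw [hβ.mul_apply, mul_one] at h'
  have h1 := hγ.mul_monomial (c := f') hβ h
  have h2 := hβ.mul_monomial (c := e) hγ h'
  rw [mul_comm e f'] at h2
  obtain ⟨c, hc, h3⟩ := hγ.secEqOver_iff.1 (h1.trans h2)
  have hcf : c * (f' * f) ∉ P.ideal := P.mul_notMem_iff.2 ⟨hc, P.mul_notMem_iff.2 ⟨hf', hf⟩⟩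
  have h4 := (monomial_right_injective h3 (P.ne_zero hcf) hm).1
  rw [h4, P.mul_notMem_iff, P.mul_notMem_iff] at hcf
  refine ⟨n, e, f, ?_, hcf.2.1, hf, h⟩
  rintro rfl
  rw [monomial_zero_right, hom_zero] at h
  obtain ⟨d, hd, h5⟩ := (hγ.secEqOver_zero_iff hm).1 h
  exact P.ne_zero (P.mul_notMem_iff.2 ⟨hd, hf⟩) h5

/-- Over a base with connected spectrum, the element `m` of the monoid of a chart is an element
`n` of the monoid of any other chart, up to units that come locally from the base. -/
theorem IsChartOver.exists_compare [PreconnectedSpace B.Spectrum] (hγ : IsChartOver π γ)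
    (hβ : IsChartOver π β) {m : M} (hm : m ≠ 0) : ∃ n : N, ∀ P : Spectrum B,
      ∃ e f : B, e ∉ P.ideal ∧ f ∉ P.ideal ∧
        SecEqOver π P (γ (monomial f m)) (β (monomial e n)) := by
  choose n e f hn he hf h using hγ.exists_compare_at hβ hm
  -- The comparison at `P` stays valid at nearby `Q`; set against the comparison at `Q`, it forces
  -- `n P = n Q`.
  have hloc : IsLocallyConstant n := (IsLocallyConstant.iff_exists_open n).2 fun P => by
    obtain ⟨g, hg, h'⟩ := (h P).near
    refine ⟨basicOpen (g * (e P * f P)), (basicOpen _).2,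
      P.mul_notMem_iff.2 ⟨hg, P.mul_notMem_iff.2 ⟨he P, hf P⟩⟩, fun Q hQ => ?_⟩
    obtain ⟨hgQ, hQ⟩ := Q.mul_notMem_iff.1 hQ
    obtain ⟨heQ, hfQ⟩ := Q.mul_notMem_iff.1 hQ
    have h1 := hγ.mul_monomial (c := f Q) hβ (h' Q hgQ)
    have h2 := hγ.mul_monomial (c := f P) hβ (h Q)
    rw [mul_comm] at h2
    obtain ⟨c, hc, h3⟩ := hβ.secEqOver_iff.1 (h1.symm.trans h2)
    exact (monomial_right_injective h3 (Q.ne_zero (Q.mul_notMem_iff.2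
      ⟨hc, Q.mul_notMem_iff.2 ⟨hf Q, heQ⟩⟩)) (hn P)).2.symm
  by_cases hS : Nonempty (Spectrum B)
  · obtain ⟨P₀⟩ := hS
    refine ⟨n P₀, fun P => ⟨e P, f P, he P, hf P, ?_⟩⟩
    rw [hloc.apply_eq_of_preconnectedSpace P₀ P]
    exact h P
  · exact ⟨1, fun P => (hS ⟨P⟩).elim⟩

end Compare

/-! ### Gluing coefficients, and charts that are isomorphisms -/

section Glue

variable {B : Blueprint.{u}} {Y : BlueScheme.{u}} {π : Y ⟶ Spec B} {U₁ : Y.OpenSubset}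
  {M₁ : Type u} [CommMonoidWithZero M₁] [Nontrivial M₁]
  {γ₁ : monoidBlueprint B M₁ ⟶ sec Y.toSpace U₁} [IsIso γ₁]

/-- If the sections over some nonempty chart are the elements of the chart, then elements of the
base can be glued from fractions. -/
theorem IsChartOver.exists_glue_frac (hγ₁ : IsChartOver π γ₁) (r f : Spectrum B → B)
    (hf : ∀ P, f P ∉ P.ideal)
    (h : ∀ P, ∃ g, g ∉ P.ideal ∧ ∀ Q : Spectrum B, g ∉ Q.ideal →
      ∃ c, c ∉ Q.ideal ∧ c * (f Q * r P) = c * (f P * r Q)) :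
    ∃ b : B, ∀ P : Spectrum B, ∃ c, c ∉ P.ideal ∧ c * (f P * b) = c * r P := by
  -- The fractions `r P / f P` form a global section of `Spec B`, which comes from `B` by
  -- `toGlobal_surjective`.
  let s : Sections B ⊤ := ⟨fun P => frac P.1 (r P.1) (f P.1) (hf P.1), fun P => by
    obtain ⟨g, hg, h⟩ := h P.1
    refine ⟨basicOpen (g * f P.1), P.1.mul_notMem_iff.2 ⟨hg, hf P.1⟩, r P.1, f P.1,
      fun Q hQ => ?_⟩
    obtain ⟨hgQ, hfQ⟩ := Q.1.mul_notMem_iff.1 hQ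
    obtain ⟨c, hc, e⟩ := h Q.1 hgQ
    exact ⟨hfQ, (frac_eq_iff Q.1 _ _).2 ⟨c, hc, e.symm⟩⟩⟩
  obtain ⟨b, hb⟩ := hγ₁.toGlobal_surjective s
  refine ⟨b, fun P => ?_⟩
  have : frac P b 1 P.one_notMem = frac P (r P) (f P) (hf P) :=
    congrArg (fun t => eval B ⊤ ⟨P, trivial⟩ t) hb
  obtain ⟨c, hc, e⟩ := (frac_eq_iff P _ _).1 this
  rw [one_mul] at e
  exact ⟨c, hc, e⟩

variable {U : Y.OpenSubset} {N : Type u} [CommMonoidWithZero N] [Nontrivial N]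
  {γ : monoidBlueprint B N ⟶ sec Y.toSpace U}

open Classical in
/-- The coefficients of a section over a chart. -/
theorem IsChartOver.exists_coeffs (hγ₁ : IsChartOver π γ₁) (hγ : IsChartOver π γ)
    (s : sec Y.toSpace U) : ∃ b : N → B, ∀ P : Spectrum B, ∃ (a f : B) (m : N), f ∉ P.ideal ∧
      SecEqOver π P (structureMap π U f * s) (γ (monomial a m)) ∧
      ∀ n, n ≠ 0 → ∃ c, c ∉ P.ideal ∧ c * (f * b n) = c * if m = n then a else 0 := by
  choose a f m hf h using fun P => hγ.exists_frac P s
  have hb : ∀ n : N, ∃ b : B, n ≠ 0 → ∀ P : Spectrum B,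
      ∃ c, c ∉ P.ideal ∧ c * (f P * b) = c * if m P = n then a P else 0 := fun n => by
    by_cases hn : n = 0
    · exact ⟨0, fun h => absurd hn h⟩
    -- Near `P` the section is `(a P / f P) ∧ m P`, so its coefficient at `n` is this fraction or
    -- `0`.
    obtain ⟨b, hb⟩ := hγ₁.exists_glue_frac (fun P => if m P = n then a P else 0) f hf fun P => by
      obtain ⟨g, hg, h'⟩ := (h P).near
      refine ⟨g, hg, fun Q hQ => ?_⟩
      have h1 := (h' Q hQ).mul_left (structureMap π U (f Q))
      have h2 := (h Q).mul_left (structureMap π U (f P))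
      rw [hγ.mul_apply] at h1 h2
      rw [mul_left_comm] at h2
      obtain ⟨c, hc, e⟩ := hγ.secEqOver_iff.1 (h1.symm.trans h2)
      have := coeff_eq_of_monomial_eq e hn
      refine ⟨c, hc, ?_⟩
      rw [mul_ite, mul_ite, mul_ite, mul_ite]
      simpa only [mul_zero] using this
    exact ⟨b, fun _ => hb⟩
  choose b hb using hb
  exact ⟨b, fun P => ⟨a P, f P, m P, hf P, h P, fun n hn => hb n hn P⟩⟩

variable {N₁ : Type u} [CommMonoidWithZero N₁] [Nontrivial N₁]
  {β : monoidBlueprint B N₁ ⟶ sec Y.toSpace U₁}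

/-- Two sections of the form `b n` and `b' n'` with `n ≠ n'` and `b` and `b'` of disjoint support
cannot exist at the same time. -/
theorem IsChartOver.eq_zero_or_eq_zero [PreconnectedSpace B.Spectrum] (hγ₁ : IsChartOver π γ₁)
    (hβ : IsChartOver π β) (hγ : IsChartOver π γ) (hU : U ≤ U₁) {b b' : B} {n n' : N}
    (hn : n ≠ 0) (hn' : n' ≠ 0) (hnn' : n ≠ n')
    (hb : ∀ P : Spectrum B, (∃ k, k ∉ P.ideal ∧ k * b = 0) ∨ ∃ k, k ∉ P.ideal ∧ k * b' = 0)
    {k : sec Y.toSpace U} (hk : IsUnit k) {x y : N₁}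
    (hx : k * γ (monomial 1 n) = rs Y.toSpace hU (β (monomial 1 x)))
    (hy : k * γ (monomial 1 n') = rs Y.toSpace hU (β (monomial 1 y))) : b = 0 ∨ b' = 0 := by
  classical
  by_contra! hbb
  obtain ⟨hb0, hb0'⟩ := hbb
  -- By `base_ext`, an element of `B` that vanishes locally everywhere is zero.
  have aux : ∀ b : B, b ≠ 0 → ∃ P : Spectrum B, ∀ k, k ∉ P.ideal → k * b ≠ 0 := fun b hb => by
    by_contra! hcon
    refine hb (hγ₁.base_ext fun P => ?_)
    obtain ⟨k, hk, e⟩ := hcon P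
    exact ⟨k, hk, by rw [e, mul_zero]⟩
  obtain ⟨P₀, hP₀⟩ := aux b hb0
  obtain ⟨P₁, hP₁⟩ := aux b' hb0'
  have hne : ∀ {n : N}, n ≠ 0 → γ (monomial 1 n) ≠ 0 := fun {n} hn h => by
    obtain ⟨c, hc, e⟩ := (hγ.secEqOver_zero_iff hn).1 (SecEqOver.of_eq (P := P₀) h)
    rw [mul_one] at e
    exact P₀.ne_zero hc e
  have hx0 : x ≠ 0 := by
    rintro rfl
    rw [monomial_zero_right, hom_zero, hom_zero, hk.mul_right_eq_zero] at hx
    exact hne hn hx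
  have hy0 : y ≠ 0 := by
    rintro rfl
    rw [monomial_zero_right, hom_zero, hom_zero, hk.mul_right_eq_zero] at hy
    exact hne hn' hy
  -- The same unit `k` occurs for `n` and `n'`, so `x = y` would give `n = n'`.
  have hxy : x ≠ y := by
    rintro rfl
    obtain ⟨c, hc, e⟩ := hγ.secEqOver_iff.1
      (SecEqOver.of_eq (P := P₀) (hk.mul_left_cancel (hx.trans hy.symm)))
    rw [mul_one] at e
    exact hnn' (monomial_right_injective e (P₀.ne_zero hc) hn).2
  -- The part of `Spec B` on which `b'` vanishes locally; off it, `b` vanishes locally.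
  let T : Spectrum B → Prop := fun P => ∃ k, k ∉ P.ideal ∧ k * b' = 0
  have hg : ∀ P, ∃ g, g ∉ P.ideal ∧ (T P → g * b' = 0) ∧ (¬ T P → g * b = 0) := fun P => by
    by_cases hT : T P
    · obtain ⟨k, hk, e⟩ := hT
      exact ⟨k, hk, fun _ => e, fun h => absurd ⟨k, hk, e⟩ h⟩
    · obtain ⟨k, hk, e⟩ := (hb P).resolve_right hT
      exact ⟨k, hk, fun h => absurd h hT, fun _ => e⟩
  choose g hg hgT hgT' using hg
  have key : ∀ P Q R : Spectrum B, T P → ¬ T Q → g P ∉ R.ideal → g Q ∉ R.ideal →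
      SecEqOver π R (β (monomial b x)) (β (monomial b' y)) := fun P Q R hP hQ hPR hQR =>
    ((hβ.secEqOver_zero_iff hx0).2 ⟨g Q, hQR, hgT' Q hQ⟩).trans
      ((hβ.secEqOver_zero_iff hy0).2 ⟨g P, hPR, hgT P hP⟩).symm
  -- The section `b ∧ x` on `T` and `b' ∧ y` elsewhere. On mixed overlaps both are zero.
  obtain ⟨w, hw⟩ := exists_glue_over (π := π)
    (fun P => if T P then β (monomial b x) else β (monomial b' y)) g hg fun P Q R hP hQ => by
      by_cases hTP : T P <;> by_cases hTQ : T Q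
      · rw [if_pos hTP, if_pos hTQ]
        exact .of_eq rfl
      · rw [if_pos hTP, if_neg hTQ]
        exact key P Q R hTP hTQ hP hQ
      · rw [if_neg hTP, if_pos hTQ]
        exact (key Q P R hTQ hTP hQ hP).symm
      · rw [if_neg hTP, if_neg hTQ]
        exact .of_eq rfl
  obtain ⟨d, rfl⟩ := surjective_of_isIso γ₁ w
  obtain ⟨c, m, rfl⟩ := exists_monomial d
  have h0 : SecEqOver π P₀ (γ₁ (monomial c m)) (β (monomial b x)) := by
    have hT : T P₀ := (hb P₀).resolve_left fun ⟨k, hk, e⟩ => hP₀ k hk e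
    have := hw P₀
    rwa [if_pos hT] at this
  have h1 : SecEqOver π P₁ (γ₁ (monomial c m)) (β (monomial b' y)) := by
    have hT : ¬ T P₁ := fun ⟨k, hk, e⟩ => hP₁ k hk e
    have := hw P₁
    rwa [if_neg hT] at this
  have hm : m ≠ 0 := by
    rintro rfl
    rw [monomial_zero_right, hom_zero] at h0
    obtain ⟨k, hk, e⟩ := (hβ.secEqOver_zero_iff hx0).1 h0.symm
    exact hP₀ k hk e
  -- The exponent `l` of `m` is the same at `P₀` and `P₁`; it must be `x` at the first and `y` at
  -- the second.
  obtain ⟨l, hl⟩ := hγ₁.exists_compare hβ hm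
  obtain ⟨e, f, -, hf, h2⟩ := hl P₀
  obtain ⟨e', f', -, hf', h3⟩ := hl P₁
  exact hxy ((hβ.compare_unique hγ₁ hf h2 h0 hP₀ hx0).trans
    (hβ.compare_unique hγ₁ hf' h3 h1 hP₁ hy0).symm)

/-- The sections over a chart in `U₁` are the elements of the chart if this holds for some chart
over `U₁` itself. -/
theorem IsChartOver.isIso [PreconnectedSpace B.Spectrum] (hγ₁ : IsChartOver π γ₁)
    (hβ : IsChartOver π β) (hγ : IsChartOver π γ) (hU : U ≤ U₁)
    (hN : ∀ n n' : N, ∃ (k : sec Y.toSpace U) (x y : N₁), IsUnit k ∧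
      k * γ (monomial 1 n) = rs Y.toSpace hU (β (monomial 1 x)) ∧
      k * γ (monomial 1 n') = rs Y.toSpace hU (β (monomial 1 y))) : IsIso γ := by
  classical
  refine Blueprint.isIso_of_surjective (fun s => ?_) fun x y h => ?_
  · obtain ⟨b, hb⟩ := hγ₁.exists_coeffs hγ s
    -- Near each `P` only the coefficient at the local exponent `m` can be nonzero, so any two
    -- coefficients have disjoint supports.
    have hb' : ∀ n n' : N, n ≠ 0 → n' ≠ 0 → n ≠ n' → b n = 0 ∨ b n' = 0 :=
      fun n n' hn hn' hnn' => by
        obtain ⟨k, x, y, hk, hx, hy⟩ := hN n n'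
        refine hγ₁.eq_zero_or_eq_zero hβ hγ hU hn hn' hnn' (fun P => ?_) hk hx hy
        obtain ⟨a, f, m, hf, -, h⟩ := hb P
        have aux : ∀ l, l ≠ 0 → m ≠ l → ∃ k, k ∉ P.ideal ∧ k * b l = 0 := fun l hl hml => by
          obtain ⟨c, hc, e⟩ := h l hl
          rw [if_neg hml, mul_zero, ← mul_assoc] at e
          exact ⟨c * f, P.mul_notMem_iff.2 ⟨hc, hf⟩, e⟩
        by_cases hm : m = n
        · exact .inr (aux n' hn' (hm ▸ hnn'))
        · exact .inl (aux n hn hm)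
    -- If all coefficients vanish, any exponent serves.
    obtain ⟨n₀, hn₀⟩ : ∃ n₀ : N, ∀ n, n ≠ 0 → n ≠ n₀ → b n = 0 := by
      by_cases h : ∃ n, n ≠ 0 ∧ b n ≠ 0
      · obtain ⟨n₀, h0, hb0⟩ := h
        exact ⟨n₀, fun n hn hnn => (hb' n n₀ hn h0 hnn).resolve_right hb0⟩
      · push Not at h
        exact ⟨1, fun n hn _ => h n hn⟩
    refine ⟨monomial (b n₀) n₀, eq_of_secEqOver (π := π) fun P => ?_⟩
    obtain ⟨a, f, m, hf, h, h'⟩ := hb P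
    refine SecEqOver.cancel hf (SecEqOver.trans ?_ h.symm)
    rw [hγ.mul_apply, hγ.secEqOver_iff]
    have h1 : ∀ n, n ≠ 0 → ∃ c, c ∉ P.ideal ∧
        c * (if n₀ = n then f * b n₀ else 0) = c * if m = n then a else 0 := fun n hn => by
      obtain ⟨c, hc, e⟩ := h' n hn
      refine ⟨c, hc, Eq.trans ?_ e⟩
      split_ifs with hnn
      · rw [hnn]
      · rw [hn₀ n hn (Ne.symm hnn), mul_zero, mul_zero, mul_zero]
    have h2 : ∀ n, ∃ c, c ∉ P.ideal ∧ (n ≠ 0 →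
        c * (if n₀ = n then f * b n₀ else 0) = c * if m = n then a else 0) := fun n => by
      by_cases hn : n = 0
      · exact ⟨1, P.one_notMem, fun h => absurd hn h⟩
      · obtain ⟨c, hc, e⟩ := h1 n hn
        exact ⟨c, hc, fun _ => e⟩
    obtain ⟨c, hc, e⟩ := h2 n₀
    obtain ⟨d, hd, e'⟩ := h2 m
    -- `c` settles the coefficient at `n₀` and `d` the one at `m`; at all other exponents both sides
    -- are zero.
    refine ⟨c * d, P.mul_notMem_iff.2 ⟨hc, hd⟩, monomial_ext fun n hn => ?_⟩
    by_cases hm : m = n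
    · subst hm
      have := congrArg (c * ·) (e' hn)
      simpa only [mul_ite, mul_zero, mul_assoc] using this
    · by_cases hn0 : n₀ = n
      · subst hn0
        have := congrArg (d * ·) (e hn)
        simpa only [mul_ite, mul_zero, mul_assoc, mul_left_comm d c] using this
      · rw [if_neg hm, if_neg hn0]
  -- Injectivity on `B[N]⁺`: coefficients are compared locally on `Spec B`, which suffices by
  -- `plus_ext`.
  · refine monoidBlueprint_plus_ext fun n hn => hγ₁.plus_ext fun P => ?_
    obtain ⟨c, hc, e⟩ := hγ.exists_eq (P := P) (.of_eq h)
    refine ⟨c, hc, ?_⟩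
    have h1n : (1 : N) * n ≠ 0 := by rwa [one_mul]
    rw [← plusCoeff_mul n c 1 isUnit_one h1n hn, ← plusCoeff_mul n c 1 isUnit_one h1n hn, e]

end Glue

/-! ### Intersections of affine open subsets -/

variable {B : Blueprint.{u}} {X Y : BlueScheme.{u}}

theorem isMonoidalAffineOpen_of_isChart (f : X ⟶ Spec F1) {D : Blueprint.{u}}
    {V : X.OpenSubset} {α : D ⟶ sec X.toSpace V} (hα : IsChart α) (hD : D.HasTrivialRel) :
    IsMonoidalAffineOpen f V := by
  have := hα.isIso_of_hasTrivialRel hD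
  obtain ⟨M, _, e, -⟩ := hD.isMonoidBlueprint (fromF1 D)
  exact ⟨hα.isAffine, M, _, e ≪≫ asIso α, F1_hom_ext⟩

theorem IsMonoidalAffineOpen.exists_isChart {f : X ⟶ Spec F1} {V : X.OpenSubset}
    (h : IsMonoidalAffineOpen f V) : ∃ (N : Type u) (_ : CommMonoidWithZero N)
      (δ : monoidBlueprint F1 N ⟶ sec X.toSpace V), IsChart δ := by
  obtain ⟨h, N, _, e, -⟩ := h
  exact ⟨N, _, e.hom, .of_isAffine h _⟩

theorem exists_isChartOver {π : Y ⟶ Spec B} {U : Y.OpenSubset} (h : IsAffineOpen U)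
    (h' : HasMonoidBlueprintSections π U) : ∃ (M : Type u) (_ : CommMonoidWithZero M)
      (γ : monoidBlueprint B M ⟶ sec Y.toSpace U), IsIso γ ∧ IsChartOver π γ := by
  obtain ⟨M, _, e, he⟩ := h'
  exact ⟨M, _, e.hom, inferInstance, .of_isAffine h _, he⟩

/-- A monoidal chart at `x₀` has a basic open set between `x₀` and `V`; by minimality it equals `V`,
so `V` is the spectrum of a localization. -/
theorem IsLocallyMonoidal.isMonoidalAffineOpen (hX : IsLocallyMonoidal X) (f : X ⟶ Spec F1)
    {V : X.OpenSubset} {x₀ : X.toSpace} (hx₀ : x₀ ∈ V)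
    (hmin : ∀ W : X.OpenSubset, x₀ ∈ W → V ≤ W) : IsMonoidalAffineOpen f V := by
  obtain ⟨U, hU, M, _, α, hα⟩ := hX x₀
  obtain ⟨c, hc, h⟩ := hα.exists_basic x₀ hU V hx₀
  obtain rfl : V = unitLocus (α c) := le_antisymm (hmin _ hc) fun z hz => h z hz
  exact isMonoidalAffineOpen_of_isChart f (hα.locChart c)
    ((hasTrivialRel_monoidBlueprint hasTrivialRel_F1 M).localization _)

/-- `V₁ ∩ V₂` is the inverse image under the diagonal of `V₁ × V₂`, which is the spectrum of a
blueprint with trivial relations. -/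
theorem IsSeparated.isMonoidalAffineOpen_inf {f : X ⟶ Spec F1} (h : IsSeparated f)
    {V₁ V₂ : X.OpenSubset} (h₁ : IsMonoidalAffineOpen f V₁) (h₂ : IsMonoidalAffineOpen f V₂) :
    IsMonoidalAffineOpen f (V₁ ⊓ V₂) := by
  obtain ⟨P, p₁, p₂, hP, hΔ⟩ := h
  obtain ⟨N₁, _, δ₁, hδ₁⟩ := h₁.exists_isChart
  obtain ⟨N₂, _, δ₂, hδ₂⟩ := h₂.exists_isChart
  let W : P.OpenSubset := preimage p₁ V₁ ⊓ preimage p₂ V₂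
  have hW := isChart_prodChart hP hδ₁ hδ₂ (W := W) (fun _ hx => hx.1) (fun _ hx => hx.2)
    fun _ h h' => ⟨h, h'⟩
  have h3 := (hΔ W (isMonoidalAffineOpen_of_isChart _ hW (hasTrivialRel_monoidBlueprint
    (hasTrivialRel_monoidBlueprint hasTrivialRel_F1 N₂) N₁))).1
  have e : preimage (hP.lift (𝟙 X) (𝟙 X) rfl) W = V₁ ⊓ V₂ := by
    refine Opens.ext (Set.ext fun x => ?_)
    have e₁ := base_of_comp_eq (congrArg Hom.toHom (hP.lift_fst (𝟙 X) (𝟙 X) rfl)) x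
    have e₂ := base_of_comp_eq (congrArg Hom.toHom (hP.lift_snd (𝟙 X) (𝟙 X) rfl)) x
    change _ ∈ V₁ ∧ _ ∈ V₂ ↔ x ∈ V₁ ∧ x ∈ V₂
    rw [← e₁, ← e₂]
    rfl
  rw [e, hom_F1_ext (_ ≫ p₁ ≫ f) f] at h3
  exact h3

/-- The zero blueprint is `B[M]` for the monoid `M` with `0 = 1`. -/
theorem hasMonoidBlueprintSections_of_isEmpty (π : Y ⟶ Spec B) {U : Y.OpenSubset}
    (hU : ∀ z, z ∉ U) : HasMonoidBlueprintSections π U := by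
  have h : ∀ s t : sec Y.toSpace U, s = t := fun s t => sec_ext fun z hz => absurd hz (hU z)
  let ψ : PUnit.{u + 1} →*₀ sec Y.toSpace U :=
    { toFun := fun _ => 0
      map_zero' := rfl
      map_one' := h _ _
      map_mul' := fun _ _ => h _ _ }
  let φ : monoidBlueprint B PUnit.{u + 1} ⟶ sec Y.toSpace U := monoidLift (structureMap π U) ψ
  have hφ : IsIso φ := isIso_of_forall_notMem hU (monomial_zero_right (B := B) (1 : B)).symm φ
  exact ⟨PUnit, inferInstance, asIso φ, toMonoidBlueprint_monoidLift _ _⟩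

/-- On a smaller spectrum of a monoid, all functions are fractions of functions, with invertible
denominators. -/
theorem exists_monomial_frac {V V₁ : X.OpenSubset} (hV : V ≤ V₁) {N N₁ : Type u}
    [CommMonoidWithZero N] [CommMonoidWithZero N₁]
    {δ : monoidBlueprint F1 N ⟶ sec X.toSpace V} {δ₁ : monoidBlueprint F1 N₁ ⟶ sec X.toSpace V₁}
    (hδ : IsChart δ) (hδ₁ : IsChart δ₁) {x₀ : X.toSpace} (hx₀ : x₀ ∈ V) (s : sec X.toSpace V) :
    ∃ h x : N₁, IsUnit (rs X.toSpace hV (δ₁ (monomial 1 h))) ∧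
      rs X.toSpace hV (δ₁ (monomial 1 h)) * s = rs X.toSpace hV (δ₁ (monomial 1 x)) := by
  have hF : ∀ a : monoidBlueprint F1 N₁, ∃ x, a = monomial 1 x := fun a => by
    obtain ⟨b, x, rfl⟩ := exists_monomial a
    rcases F1_eq_zero_or_one b with rfl | rfl
    · exact ⟨0, by rw [monomial_zero_left, monomial_zero_right]⟩
    · exact ⟨x, rfl⟩
  obtain ⟨y₀, hy₀, -, hmin⟩ := hδ.exists_minimal_point
    (hasTrivialRel_monoidBlueprint hasTrivialRel_F1 N) (hδ.zero_ne_one hx₀)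
  -- `V` has no smaller neighbourhood of `y₀` inside it, so a fraction at `y₀` is valid, with
  -- invertible denominator, on all of `V`.
  obtain ⟨a, k, hk, e⟩ := hδ₁.exists_frac y₀ V hV hy₀ s
  obtain ⟨x, rfl⟩ := hF a
  obtain ⟨h, rfl⟩ := hF k
  refine ⟨h, x, isUnit_rs_of_unitAt hV fun z hz => hmin (unitLocus _) hk hz, ?_⟩
  rw [eqAt_toPlus_iff] at e
  obtain ⟨W, hW, hyW, e⟩ := e
  obtain rfl := le_antisymm hW (hmin W hyW)
  rwa [rs_self, rs_self] at e

/-- In the base extension of a separated monoidal scheme to a base with connected spectrum,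
intersections of spectra of monoid blueprints over the base have monoid blueprints over the base as
sections. -/
theorem hasMonoidBlueprintSections_inf [PreconnectedSpace B.Spectrum] {f : X ⟶ Spec F1}
    {g : Spec B ⟶ Spec F1} {p : Y ⟶ X} {π : Y ⟶ Spec B} (hX : IsLocallyMonoidal X)
    (hsep : IsSeparated f) (hY : IsPullback p π f g) {U₁ U₂ : Y.OpenSubset}
    (hU₁ : IsAffineOpen U₁) (hU₂ : IsAffineOpen U₂) (hM₁ : HasMonoidBlueprintSections π U₁)
    (hM₂ : HasMonoidBlueprintSections π U₂) : HasMonoidBlueprintSections π (U₁ ⊓ U₂) := by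
  by_cases hz : ∃ z, z ∈ U₁ ⊓ U₂
  swap
  · exact hasMonoidBlueprintSections_of_isEmpty π fun z h => hz ⟨z, h⟩
  obtain ⟨z, hz⟩ := hz
  obtain ⟨M₁, _, γ₁, _, hγ₁⟩ := exists_isChartOver hU₁ hM₁
  obtain ⟨M₂, _, γ₂, -, hγ₂⟩ := exists_isChartOver hU₂ hM₂
  -- From here on `U₁` and `U₂` are inverse images of open subsets of `X` that have smallest points.
  obtain ⟨V₁, x₁, hx₁, hmin₁, rfl⟩ := hγ₁.exists_preimage hY hX hz.1
  obtain ⟨V₂, x₂, hx₂, hmin₂, rfl⟩ := hγ₂.exists_preimage hY hX hz.2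
  have hV₁ := hX.isMonoidalAffineOpen f hx₁ hmin₁
  have hV := hsep.isMonoidalAffineOpen_inf hV₁ (hX.isMonoidalAffineOpen f hx₂ hmin₂)
  obtain ⟨N₁, _, δ₁, hδ₁⟩ := hV₁.exists_isChart
  obtain ⟨N, _, δ, hδ⟩ := hV.exists_isChart
  have hβ := isChartOver_baseChart hY hδ₁
  have hγ := isChartOver_baseChart hY hδ
  have hle : V₁ ⊓ V₂ ≤ V₁ := inf_le_left
  have hle' : preimage p (V₁ ⊓ V₂) ≤ preimage p V₁ := fun z hz => hle hz
  have := hγ₁.nontrivial hz.1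
  have := hβ.nontrivial hz.1
  have := hγ.nontrivial (z := z) hz
  let ρ : sec X.toSpace (V₁ ⊓ V₂) ⟶ sec Y.toSpace (preimage p (V₁ ⊓ V₂)) :=
    pb p.toHom fun _ h => h
  have hρ : ∀ m, rs Y.toSpace hle' (baseChart p π δ₁ (monomial 1 m)) =
      ρ (rs X.toSpace hle (δ₁ (monomial 1 m))) := fun m =>
    (congrArg (rs Y.toSpace hle') (baseChart_monomial m)).trans
      ((rs_pb_apply _ _ _ _).trans (pb_rs_apply _ _ _ _).symm)
  have key : ∀ {t : sec X.toSpace (V₁ ⊓ V₂)} {n : N} {x : N₁},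
      t * δ (monomial 1 n) = rs X.toSpace hle (δ₁ (monomial 1 x)) →
      ρ t * baseChart p π δ (monomial 1 n) =
        rs Y.toSpace hle' (baseChart p π δ₁ (monomial 1 x)) := fun {t n x} e =>
    (congrArg (ρ t * ·) (baseChart_monomial n)).trans ((hom_mul ρ _ _).symm.trans
      ((congrArg (fun s => ρ s) e).trans (hρ x).symm))
  have hiso : IsIso (baseChart p π δ) := hγ₁.isIso hβ hγ hle' fun n n' => by
    obtain ⟨h, x, hu, e⟩ := exists_monomial_frac hle hδ hδ₁ (show _ ∈ V₁ ⊓ V₂ from hz)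
      (δ (monomial 1 n))
    obtain ⟨h', x', hu', e'⟩ := exists_monomial_frac hle hδ hδ₁ (show _ ∈ V₁ ⊓ V₂ from hz)
      (δ (monomial 1 n'))
    have hmul : ∀ m m', rs X.toSpace hle (δ₁ (monomial 1 (m * m'))) =
        rs X.toSpace hle (δ₁ (monomial 1 m)) * rs X.toSpace hle (δ₁ (monomial 1 m')) :=
      fun m m' => by rw [← hom_mul, ← hom_mul, ← monomial_mul, one_mul]
    -- The denominators `h` of `n` and `h'` of `n'` are brought to the common denominator `h * h'`.
    refine ⟨ρ (rs X.toSpace hle (δ₁ (monomial 1 (h * h')))), x * h', x' * h, isUnit_map _ ?_,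
      key ?_, key ?_⟩
    · rw [hmul]
      exact hu.mul hu'
    · rw [hmul, hmul, ← e, mul_right_comm]
    · rw [hmul, hmul, ← e', mul_assoc, mul_comm]
  have h : HasMonoidBlueprintSections π (preimage p (V₁ ⊓ V₂)) :=
    ⟨N, _, asIso (baseChart p π δ), hγ.comp⟩
  exact h

end BlueScheme

end Blue

end

theorem mainTheorem6 (B : Blue.Blueprint.{u}) [PreconnectedSpace B.Spectrum]
    (X XB : Blue.BlueScheme.{u})
    (f : X ⟶ Blue.BlueScheme.Spec Blue.Blueprint.F1.{u})
    (g : Blue.BlueScheme.Spec B ⟶ Blue.BlueScheme.Spec Blue.Blueprint.F1.{u})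
    (p : XB ⟶ X) (π : XB ⟶ Blue.BlueScheme.Spec B)
    (hX : Blue.BlueScheme.IsMonoidal f) (hsep : Blue.BlueScheme.IsSeparated f)
    (hXB : IsPullback p π f g)
    (U₁ U₂ : XB.OpenSubset)
    (hU₁ : Blue.BlueScheme.IsAffineOpen U₁) (hU₂ : Blue.BlueScheme.IsAffineOpen U₂)
    (hM₁ : Blue.BlueScheme.HasMonoidBlueprintSections π U₁)
    (hM₂ : Blue.BlueScheme.HasMonoidBlueprintSections π U₂) :
    Blue.BlueScheme.HasMonoidBlueprintSections π (U₁ ⊓ U₂) :=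
  Blue.BlueScheme.hasMonoidBlueprintSections_inf hX.isLocallyMonoidal hsep hXB hU₁ hU₂ hM₁ hM₂
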